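/- **Setting.** Let $n\ge 2$ agents minimise $f=\frac1n\sum_{i=1}^n f_i$ over $\mathbb R^p$, where each $f_i:\mathbb R^p\to\mathbb R$ is differentiable with $L$-Lipschitz gradient and $\langle\nabla f(x)-\nabla f(x'),x-x'\rangle\ge\mu\|x-x'\|^2$ for all $x,x'$ ($L,\mu>0$); let $x^*$ be the minimiser of $f$. The agents are linked by a connected undirected graph, and $W=(w_{ij})\in\mathbb R^{n\times n}$ is nonnegative, symmetric and stochastic ($W\mathbf 1=\mathbf 1$) with, for $i\ne j$, $w_{ij}>0$ if and only if $i$ and $j$ are linked. Let $\lambda_2$ be the second largest eigenvalue of $W$. **Algorithm (CEDAS).** Given $x_{i,-1}$, put $h_{i,0}=x_{i,-1}$, $d_{i,0}=0$, $(h_w)_{i,0}=\sum_j w_{ij}h_{j,0}$ and $x_{i,0}=x_{i,-1}-\eta_{-1}\,g_{i,-1}$. For $k\ge0$ put $y_{i,k}=x_{i,k}-\eta_k g_{i,k}-d_{i,k}$, $q_{i,k}=\mathcal C(y_{i,k}-h_{i,k})$, $\hat y_{i,k}=h_{i,k}+q_{i,k}$, $(\hat y_w)_{i,k}=(h_w)_{i,k}+\sum_j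 w_{ij}q_{j,k}$, $h_{i,k+1}=(1-\alpha)h_{i,k}+\alpha\hat y_{i,k}$, $(h_w)_{i,k+1}=(1-\alpha)(h_w)_{i,k}+\alpha(\hat y_w)_{i,k}$, $d_{i,k+1}=d_{i,k}+\frac\gamma2(\hat y_{i,k}-(\hat y_w)_{i,k})$ and $x_{i,k+1}=x_{i,k}-\eta_kg_{i,k}-d_{i,k+1}$. Here $g_{i,k}=\nabla f_i(x_{i,k};\xi_{i,k})$ ($k\ge-1$) are stochastic gradients such that, conditionally on everything sampled before, the $\xi_{i,k}$ are independent across $i$, $g_{i,k}$ has mean $\nabla f_i(x_{i,k})$, and $\mathbb E\|g_{i,k}-\nabla f_i(x_{i,k})\|^2\le\sigma^2$ ($\sigma>0$). The compressor $\mathcal C$ is random and unbiased with parameter $C$: $\mathbb E[\mathcal C(x)]=x$ and $\mathbb E\|\mathcal C(x)-x\|^2\le C\|x\|^2$ for all $x\in\mathbb R^p$; each call uses randomness independent of everything sampled before (calls of different agents in the same iteration may be dependent). **Parameters.** $\alpha=\frac1{12C}$ with $\alpha\le1$ (that is, $C\ge\frac1{12}$); $\eta_k=\frac{\theta}{\mu(k+m)}$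 with $\theta>18$; $$\gamma\le\gamma_{\max}:=\min\Big\{\tfrac{\sqrt\alpha}{2\sqrt C},\tfrac12,\tfrac{(1-\lambda_2)\alpha^2}{1296C},\tfrac{\alpha}{1-\lambda_2}\Big\},\qquad m=\max\Big\{\tfrac{32\theta}{\gamma(1-\lambda_2)},\tfrac{8\sqrt2L}{\mu\gamma(1-\lambda_2)},\tfrac{3\theta L\sqrt6}{2\sqrt\alpha\,\mu},\tfrac{8\theta}{\alpha}\Big\},$$ and $\gamma$ is of the order of its upper bound: $\gamma\ge c_\gamma\gamma_{\max}$ for a constant $c_\gamma\in(0,1]$. **Claim.** Let $q>0$, $r\ge0$ with $\theta\ge\frac32(1+q+2r)$, and let $c_1,c_2,c_3,c_4$ be constants. There are $A,B>0$, depending only on $L,\mu,\sigma,\theta,c_\gamma,q,r,c_1,\dots,c_4$ (so not on $n$, $p$, $W$, $C$, $f_i$, $x_{i,-1}$ or the random variables), such that, whenever $$\sum_{i}\|\nabla f_i(x^*)\|^2\le c_1n^3,\quad \sum_i\|x_{i,-1}-x^*\|^2\le c_2n^2,\quad \frac1{1-\lambda_2}\le c_3n^q,\quad C\le c_4n^r,$$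 the transient time $$K_T:=\min\Big\{K\ge1:\ \frac1n\sum_{i=1}^n\mathbb E\|x_{i,k}-x^*\|^2\le\frac{B}{nk}\ \text{ for all }k\ge K\Big\}$$ is finite and satisfies $$K_T\le A\,\frac{nC^3}{(1-\lambda_2)^2}.$$ -/

import Mathlib

open MeasureTheory ProbabilityTheory
open scoped ENNReal BigOperators

noncomputable section

namespace CEDAS

/-- The decision space `ℝᵖ` with its Euclidean norm. -/
abbrev Vec (p : ℕ) : Type := EuclideanSpace ℝ (Fin p)

/-! ### Network and mixing matrix -/

/-- `W` is a mixing matrix compliant to the undirected connected graph `G`: two distinct agents are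
linked iff the corresponding weight is positive (otherwise it vanishes, by nonnegativity), and
`W` is nonnegative, symmetric and stochastic. -/
structure IsMixingMatrix {n : ℕ} (G : SimpleGraph (Fin n)) (W : Matrix (Fin n) (Fin n) ℝ) :
    Prop where
  connected : G.Connected
  adj_iff : ∀ i j, i ≠ j → (G.Adj i j ↔ 0 < W i j)
  nonneg : ∀ i j, 0 ≤ W i j
  symm : W.IsSymm
  row_sum : ∀ i, ∑ j, W i j = 1

theorem IsMixingMatrix.isHermitian {n : ℕ} {G : SimpleGraph (Fin n)}
    {W : Matrix (Fin n) (Fin n) ℝ} (hW : IsMixingMatrix G W) : W.IsHermitian := by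
  unfold Matrix.IsHermitian
  rw [Matrix.conjTranspose_eq_transpose_of_trivial]
  exact hW.symm

/-- The second largest eigenvalue `λ₂` (with multiplicity) of a symmetric `n × n` matrix, `n ≥ 2`:
`Matrix.IsHermitian.eigenvalues₀` lists the eigenvalues in decreasing order. -/
def lambda2 {n : ℕ} {W : Matrix (Fin n) (Fin n) ℝ} (hW : W.IsHermitian) (hn : 2 ≤ n) : ℝ :=
  hW.eigenvalues₀ ⟨1, by simpa using (show 1 < n by omega)⟩

/-! ### Objective functions -/

/-- The average objective `f = (1/n) ∑ fᵢ`. -/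
def avgObjective {n p : ℕ} (f : Fin n → Vec p → ℝ) : Vec p → ℝ :=
  fun x => (1 / (n : ℝ)) * ∑ i, f i x

/-- Each `fᵢ` has an `L`-Lipschitz gradient and the average `f` is `μ`-strongly convex. -/
structure IsSmoothStronglyConvex {n p : ℕ} (L μ : ℝ) (f : Fin n → Vec p → ℝ) : Prop where
  differentiable : ∀ i, Differentiable ℝ (f i)
  lipschitz : ∀ i x x', ‖gradient (f i) x - gradient (f i) x'‖ ≤ L * ‖x - x'‖
  stronglyConvex : ∀ x x',
    μ * ‖x - x'‖ ^ 2 ≤ inner ℝ (gradient (avgObjective f) x - gradient (avgObjective f) x') (x - x')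

/-! ### The algorithm

Gradient samples and stepsizes are indexed by `s : ℕ`, where `s` stands for iteration `s - 1`; so
`s = 0` is the initial step at `x_{i,-1}` and `s = k + 1` is iteration `k`.  Compressor samples are
indexed by the iteration `k : ℕ` itself. -/

/-- The stepsize policy `η_k = θ / (μ (k + m))` for `k = s - 1 ≥ -1`. -/
def stepsize (θ μ m : ℝ) (s : ℕ) : ℝ := θ / (μ * (((s : ℝ) - 1) + m))

/-- The variables kept by the agents at the beginning of an iteration. -/
structure State (n p : ℕ) where
  /-- local solutions `x_{i,k}` -/
  x : Fin n → Vec p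
  /-- correction terms `d_{i,k}` -/
  d : Fin n → Vec p
  /-- reference points `h_{i,k}` -/
  h : Fin n → Vec p
  /-- mixed reference points `(h_w)_{i,k}` -/
  hw : Fin n → Vec p

/-- One iteration, with mixing matrix `W`, parameters `γ` and `α`, stepsize `η`, noisy gradients
`g i`, and compressor `Q` called by agent `i` with randomness `z i`.  Sums over `j ∈ 𝒩ᵢ ∪ {i}` are
written over all `j`, because `w_{ij} = 0` for the other `j`. -/
def step {n p : ℕ} {Z : Type*} (W : Matrix (Fin n) (Fin n) ℝ) (γ α η : ℝ) (g : Fin n → Vec p)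
    (Q : Vec p → Z → Vec p) (z : Fin n → Z) (S : State n p) : State n p :=
  let y : Fin n → Vec p := fun i => S.x i - η • g i - S.d i
  let q : Fin n → Vec p := fun i => Q (y i - S.h i) (z i)
  let yhat : Fin n → Vec p := fun i => S.h i + q i
  let yhatw : Fin n → Vec p := fun i => S.hw i + ∑ j, W i j • q j
  let d' : Fin n → Vec p := fun i => S.d i + (γ / 2) • (yhat i - yhatw i)
  { x := fun i => S.x i - η • g i - d' i
    d := d'
    h := fun i => (1 - α) • S.h i + α • yhat i
    hw := fun i => (1 - α) • S.hw i + α • yhatw i }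

/-- The run of the algorithm from `x_{i,-1} = xinit i` and `h_{i,0} = h0 i`, for stochastic gradients
`g i x ξ` evaluated at the samples `ξ i s` and the compressor `Q` at the samples `z i k`. -/
def run {n p : ℕ} {Ξ Z : Type*} (W : Matrix (Fin n) (Fin n) ℝ) (γ α : ℝ) (η : ℕ → ℝ)
    (g : Fin n → Vec p → Ξ → Vec p) (Q : Vec p → Z → Vec p) (xinit h0 : Fin n → Vec p)
    (ξ : Fin n → ℕ → Ξ) (z : Fin n → ℕ → Z) : ℕ → State n p
  | 0 =>
    { x := fun i => xinit i - η 0 • g i (xinit i) (ξ i 0)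
      d := fun _ => 0
      h := h0
      hw := fun i => ∑ j, W i j • h0 j }
  | k + 1 =>
    let S := run W γ α η g Q xinit h0 ξ z k
    step W γ α (η (k + 1)) (fun i => g i (S.x i) (ξ i (k + 1))) Q (fun i => z i k) S

/-- The solution of agent `i` at iteration `k`, as a random variable. -/
def iterate {n p : ℕ} {Ω Ξ Z : Type*} (W : Matrix (Fin n) (Fin n) ℝ) (γ α : ℝ) (η : ℕ → ℝ)
    (g : Fin n → Vec p → Ξ → Vec p) (Q : Vec p → Z → Vec p) (xinit h0 : Fin n → Vec p)
    (ξ : Fin n → ℕ → Ω → Ξ) (z : Fin n → ℕ → Ω → Z) (i : Fin n) (k : ℕ) (ω : Ω) : Vec p :=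
  (run W γ α η g Q xinit h0 (fun i s => ξ i s ω) (fun i k => z i k ω) k).x i

/-! ### Randomness -/

/-- The σ-algebra generated by the gradient samples `ξ i s`, `s < a`, and the compressor samples
`z i k`, `k < b`, of all agents. -/
abbrev history {n : ℕ} {Ω Ξ Z : Type*} [mΞ : MeasurableSpace Ξ] [mZ : MeasurableSpace Z]
    (ξ : Fin n → ℕ → Ω → Ξ) (z : Fin n → ℕ → Ω → Z) (a b : ℕ) : MeasurableSpace Ω :=
  (⨆ (i : Fin n) (s : ℕ) (_ : s < a), mΞ.comap (ξ i s)) ⊔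
    (⨆ (i : Fin n) (k : ℕ) (_ : k < b), mZ.comap (z i k))

/-- Everything sampled before the gradients of time `s` (iteration `s - 1`) are sampled. -/
abbrev gradHistory {n : ℕ} {Ω Ξ Z : Type*} [MeasurableSpace Ξ] [MeasurableSpace Z]
    (ξ : Fin n → ℕ → Ω → Ξ) (z : Fin n → ℕ → Ω → Z) (s : ℕ) : MeasurableSpace Ω :=
  history ξ z s (s - 1)

/-- Everything sampled before the compressors of iteration `k` are called; this includes the
gradient samples of iteration `k`, whose time is `k + 1`. -/
abbrev compHistory {n : ℕ} {Ω Ξ Z : Type*} [MeasurableSpace Ξ] [MeasurableSpace Z]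
    (ξ : Fin n → ℕ → Ω → Ξ) (z : Fin n → ℕ → Ω → Z) (k : ℕ) : MeasurableSpace Ω :=
  history ξ z (k + 2) k

/-- The random variables `X i` are conditionally independent given `m`. Stated through conditional
probabilities, so that it makes sense on every probability space. -/
def CondIndepFamily {ι Ω Ξ : Type*} [Fintype ι] [MeasurableSpace Ξ] (m : MeasurableSpace Ω)
    {mΩ : MeasurableSpace Ω} (P : Measure Ω) (X : ι → Ω → Ξ) : Prop :=
  ∀ A : ι → Set Ξ, (∀ i, MeasurableSet (A i)) →
    P[(⋂ i, X i ⁻¹' A i).indicator (fun _ => (1 : ℝ)) | m] =ᵐ[P]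
      fun ω => ∏ i, (P[(X i ⁻¹' A i).indicator (fun _ => (1 : ℝ)) | m]) ω

/-- The point at which agent `i` samples its gradient at time `s`: `x_{i,-1}` for `s = 0` and
`x_{i,k}` for `s = k + 1`. -/
def queryPoint {Ω V : Type*} {n : ℕ} (xinit : Fin n → V) (x : Fin n → ℕ → Ω → V) (i : Fin n) :
    ℕ → Ω → V
  | 0 => fun _ => xinit i
  | k + 1 => x i k

/-- The gradient noise `∇fᵢ(x_{i,k}; ξ_{i,k}) - ∇fᵢ(x_{i,k})` at time `s = k + 1`. -/
def gradNoise {n p : ℕ} {Ω Ξ : Type*} (f : Fin n → Vec p → ℝ) (g : Fin n → Vec p → Ξ → Vec p)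
    (ξ : Fin n → ℕ → Ω → Ξ) (xq : Fin n → ℕ → Ω → Vec p) (i : Fin n) (s : ℕ) (ω : Ω) : Vec p :=
  g i (xq i s ω) (ξ i s ω) - gradient (f i) (xq i s ω)

/-- Stochastic gradient assumption: given the past, the samples `ξ i s` of the agents are independent
across `i`, and the noisy gradients at the query points `xq i s` are unbiased with variance at
most `σ ^ 2`. -/
structure IsGradientOracle {n p : ℕ} {Ω Ξ Z : Type*} [MeasurableSpace Ω] [MeasurableSpace Ξ]
    [MeasurableSpace Z] (P : Measure Ω) (σ : ℝ) (f : Fin n → Vec p → ℝ)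
    (g : Fin n → Vec p → Ξ → Vec p) (ξ : Fin n → ℕ → Ω → Ξ) (z : Fin n → ℕ → Ω → Z)
    (xq : Fin n → ℕ → Ω → Vec p) : Prop where
  measurable_oracle : ∀ i, Measurable (Function.uncurry (g i))
  measurable_sample : ∀ i s, Measurable (ξ i s)
  indep : ∀ s, CondIndepFamily (gradHistory ξ z s) P (fun i => ξ i s)
  square_integrable : ∀ i s, MemLp (gradNoise f g ξ xq i s) 2 P
  unbiased : ∀ i s, P[gradNoise f g ξ xq i s | gradHistory ξ z s] =ᵐ[P] 0
  variance_le : ∀ i s,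
    P[fun ω => ‖gradNoise f g ξ xq i s ω‖ ^ 2 | gradHistory ξ z s] ≤ᵐ[P] fun _ => σ ^ 2

/-- `Q`, with internal randomness of law `ν`, is an unbiased compression operator with
parameter `C`: `𝔼[Q(x)] = x` and `𝔼‖Q(x) - x‖² ≤ C ‖x‖²` for every `x`. -/
structure IsUnbiasedCompressor {p : ℕ} {Z : Type*} [MeasurableSpace Z] (C : ℝ)
    (Q : Vec p → Z → Vec p) (ν : Measure Z) : Prop where
  measurable : Measurable (Function.uncurry Q)
  square_integrable : ∀ x, MemLp (Q x) 2 ν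
  unbiased : ∀ x, ∫ w, Q x w ∂ν = x
  variance_le : ∀ x, ∫ w, ‖Q x w - x‖ ^ 2 ∂ν ≤ C * ‖x‖ ^ 2

/-- At every call the compressor draws fresh randomness of law `ν`, independent of everything sampled
before (no independence across the agents is required). -/
structure IsFreshCompressorSample {n : ℕ} {Ω Ξ Z : Type*} [MeasurableSpace Ω] [MeasurableSpace Ξ]
    [mZ : MeasurableSpace Z] (P : Measure Ω) (ν : Measure Z) (ξ : Fin n → ℕ → Ω → Ξ)
    (z : Fin n → ℕ → Ω → Z) : Prop where
  measurable : ∀ i k, Measurable (z i k)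
  law : ∀ i k, P.map (z i k) = ν
  indep : ∀ i k, Indep (mZ.comap (z i k)) (compHistory ξ z k) P

/-! ### Parameters -/

/-- The upper bound on `γ`. -/
def gammaBound (α C lam2 : ℝ) : ℝ :=
  min (min (√α / (2 * √C)) (1 / 2)) (min ((1 - lam2) * α ^ 2 / (1296 * C)) (α / (1 - lam2)))

/-- The stepsize offset `m`. -/
def offset (θ L μ α γ lam2 : ℝ) : ℝ :=
  max (max (32 * θ / (γ * (1 - lam2))) (8 * √2 * L / (μ * γ * (1 - lam2))))
    (max (3 * θ * L * √6 / (2 * √α * μ)) (8 * θ / α))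

/-! ### Error and transient time -/

/-- The total expected error `(1/n) ∑ᵢ 𝔼‖x_{i,k} - x*‖²`, as an extended nonnegative real. -/
def expectedError {n p : ℕ} {Ω : Type*} [MeasurableSpace Ω] (P : Measure Ω)
    (x : Fin n → ℕ → Ω → Vec p) (xstar : Vec p) (k : ℕ) : ℝ≥0∞ :=
  (n : ℝ≥0∞)⁻¹ * ∑ i, ∫⁻ ω, ‖x i k ω - xstar‖ₑ ^ 2 ∂P

/-- The transient time for the rate `B / (n k)`: the least `K ≥ 1` such that the error at iteration
`k` is at most `B / (n k)` for all `k ≥ K` (and `⊤` if there is none). -/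
def transientTime (n : ℕ) (B : ℝ) (err : ℕ → ℝ≥0∞) : ℕ∞ :=
  ⨅ (K : ℕ) (_ : 1 ≤ K ∧ ∀ k, K ≤ k → err k ≤ ENNReal.ofReal (B / (n * k))), (K : ℕ∞)

end CEDAS

end

/-! ### Spectral decomposition of the mixing matrix -/

/-! Put κ = γ(1 - λ₂)/2 and τ = m + k. The parameter choice makes 1/κ at most a constant times C³/(1
- λ₂)² and keeps κm between positive constants (`isTuned`). It therefore suffices that the error is
O(1/(nk)) as soon as k exceeds a constant multiple of n/κ.

Randomness is turned into Hilbert space geometry. All error variables are elements of L².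
Unbiasedness given the past says that gradient and compression noise are orthogonal to the subspace
of L² functions measurable with respect to that past, and conditional independence across agents
makes the gradient noises pairwise orthogonal. `IsErrorIteration` collects these facts, and the
analysis of one step uses nothing else about probability.

The error variables are X = x - x*, S = d + η∇fᵢ(x*) and T = h - x + S. In an eigenbasis of W the
mixing operator (γ/2)(I - W) acts on each mode as a scalar μⱼ, with κ ≤ μⱼ ≤ γ off the constant
mode. There the weighted norm ‖X‖² + (1/μⱼ - 1)‖S‖² obeys an exact identity with contraction factor
1 - μⱼ (`mode_identity`). Compression noise enters with weight μⱼ and has squared norm at most C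
times that of T plus a gradient step. In turn T contracts at rate α up to a defect of order γ times
the energy (`mode_tracking_defect`). Hence energy + (12γC/α)‖T‖² contracts at rate κ/4
(`lyapunov_arith`, `lyapunov_step`).

On the constant mode neither mixing nor corrections act, so the average performs a noisy gradient
step on f. It contracts at rate 7θ/(4τ), feels the disagreement through the Lipschitz bound, and its
noise variance carries the factor 1/n (`mean_step`).

The two resulting scalar recursions are compared with the envelope 1/(nτ) + 1/(κτ²) + n²/(κ³τ⁴) +
Z(m/τ)^(3θ/2) in `coupled_recursion`. Its terms stem from averaged gradient noise, gradient noise in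
the disagreement, drift of the target of the corrections caused by the changing stepsize, and the
initial error Z = O(n²). For k ≥ const · n/κ the first three are at most 1/(nk) each. For the last
one, m/τ ≤ 1/n while m grows at most polynomially in n, and the lower bounds on θ make the power of
m/τ win (`envelope_le`). -/

namespace CEDAS

/-- The rows of `v` form an orthonormal eigenbasis of `W` with eigenvalues `lam`, in which the mode
`j₀` is constant and all others have an eigenvalue in `[-1, l]`. -/
structure IsModeBasis {n : ℕ} (W : Matrix (Fin n) (Fin n) ℝ) (v : Fin n → Fin n → ℝ)
    (lam : Fin n → ℝ) (j₀ : Fin n) (l : ℝ) : Prop where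
  orthonormal : ∀ j j', ∑ i, v j i * v j' i = if j = j' then 1 else 0
  complete : ∀ i i', ∑ j, v j i * v j i' = if i = i' then 1 else 0
  eigen : ∀ j i, ∑ l, v j l * W l i = lam j * v j i
  lam_top : lam j₀ = 1
  const_mode : ∀ i i', v j₀ i = v j₀ i'
  lam_le : ∀ j, j ≠ j₀ → lam j ≤ l
  neg_one_le : ∀ j, -1 ≤ lam j

namespace IsMixingMatrix

variable {n : ℕ} {G : SimpleGraph (Fin n)} {W : Matrix (Fin n) (Fin n) ℝ}

/-- Discrete maximum principle: where `u` is maximal, it is an average of values that are no larger,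
so every neighbour is maximal too; connectivity carries this along walks. -/
theorem const_of_mulVec_eq (hW : IsMixingMatrix G W) {u : Fin n → ℝ}
    (hu : ∀ i, ∑ l, W i l * u l = u i) (i i' : Fin n) : u i = u i' := by
  obtain ⟨k, -, hk⟩ := Finset.exists_max_image Finset.univ u ⟨i, Finset.mem_univ i⟩
  have key : ∀ a b, G.Adj a b → u a = u k → u b = u k := by
    intro a b hab ha
    have h0 : ∑ l, W a l * (u a - u l) = 0 := by
      simp only [mul_sub, Finset.sum_sub_distrib, hu a, ← Finset.sum_mul, hW.row_sum a]
      ring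
    have h1 := (Finset.sum_eq_zero_iff_of_nonneg (fun l _ => mul_nonneg (hW.nonneg a l)
      (by rw [ha]; exact sub_nonneg.2 (hk l (Finset.mem_univ l))))).1 h0 b (Finset.mem_univ b)
    have h2 := (hW.adj_iff a b hab.ne).1 hab
    rcases mul_eq_zero.1 h1 with h | h
    · exact absurd h h2.ne'
    · linarith
  have all : ∀ b, u b = u k := by
    intro b
    obtain ⟨p⟩ := hW.connected.preconnected k b
    have : ∀ (a b : Fin n) (_ : G.Walk a b), u a = u k → u b = u k := by
      intro a b p
      induction p with
      | nil => exact id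
      | cons h _ ih => exact fun ha => ih (key _ _ h ha)
    exact this k b p rfl
  rw [all i, all i']

/-- Read the eigenvalue equation at a coordinate of maximal modulus and use that the row is a
probability vector. -/
theorem abs_le_one_of_eigen (hW : IsMixingMatrix G W) {u : Fin n → ℝ} {t : ℝ} (hne : u ≠ 0)
    (hu : ∀ i, ∑ l, W i l * u l = t * u i) : |t| ≤ 1 := by
  obtain ⟨i, hi⟩ := Function.ne_iff.1 hne
  obtain ⟨k, -, hk⟩ := Finset.exists_max_image Finset.univ (fun i => |u i|) ⟨i, Finset.mem_univ i⟩
  have hpos : 0 < |u k| := lt_of_lt_of_le (abs_pos.2 hi) (hk i (Finset.mem_univ i))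
  have h : |t| * |u k| ≤ 1 * |u k| := by
    rw [← abs_mul, ← hu k]
    calc |∑ l, W k l * u l| ≤ ∑ l, |W k l * u l| := Finset.abs_sum_le_sum_abs _ _
      _ ≤ ∑ l, W k l * |u k| := Finset.sum_le_sum fun l _ => by
          rw [abs_mul, abs_of_nonneg (hW.nonneg k l)]
          exact mul_le_mul_of_nonneg_left (hk l (Finset.mem_univ l)) (hW.nonneg k l)
      _ = 1 * |u k| := by rw [← Finset.sum_mul, hW.row_sum k]
  exact le_of_mul_le_mul_right h hpos

theorem lambda2_lt_one_and_exists_modeBasis (hW : IsMixingMatrix G W) (hn : 2 ≤ n) :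
    lambda2 hW.isHermitian hn < 1 ∧ -1 ≤ lambda2 hW.isHermitian hn ∧
      ∃ v lam j₀, IsModeBasis W v lam j₀ (lambda2 hW.isHermitian hn) := by
  set hA := hW.isHermitian
  set b := hA.eigenvectorBasis
  set v : Fin n → Fin n → ℝ := fun j i => b j i
  have orth : ∀ j j', ∑ i, v j i * v j' i = if j = j' then 1 else 0 := by
    intro j j'
    have := orthonormal_iff_ite.1 b.orthonormal j j'
    rw [← this]
    simp [v, PiLp.inner_apply, mul_comm]
  have compl : ∀ i i', ∑ j, v j i * v j i' = if i = i' then 1 else 0 := by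
    intro i i'
    have := b.sum_inner_mul_inner (EuclideanSpace.single i (1:ℝ)) (EuclideanSpace.single i' (1:ℝ))
    simpa [v, EuclideanSpace.inner_single_left, EuclideanSpace.inner_single_right, eq_comm]
      using this
  have eig : ∀ j i, ∑ l, W i l * v j l = hA.eigenvalues j * v j i := by
    intro j i
    have := congrFun (hA.mulVec_eigenvectorBasis j) i
    simpa [Matrix.mulVec, dotProduct] using this
  have hvne : ∀ j, v j ≠ 0 := by
    intro j h
    have := orth j j
    simp [h] at this
  have habs : ∀ j, |hA.eigenvalues j| ≤ 1 := fun j => hW.abs_le_one_of_eigen (hvne j) (eig j)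
  let ee : Fin (Fintype.card (Fin n)) ≃ Fin n := Fintype.equivOfCardEq (Fintype.card_fin _)
  have hee : ∀ t, hA.eigenvalues (ee t) = hA.eigenvalues₀ t := by
    intro t
    simp [Matrix.IsHermitian.eigenvalues, ee]
  let i0 : Fin (Fintype.card (Fin n)) := ⟨0, by simp; omega⟩
  let i1 : Fin (Fintype.card (Fin n)) := ⟨1, by simp; omega⟩
  have hl2 : lambda2 hA hn = hA.eigenvalues₀ i1 := rfl
  -- Column sums are one, so an eigenvector with eigenvalue other than 1 has coordinate sum zero. If
  -- all were of this kind, completeness of the basis would fail on the constant vector.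
  have hex : ∃ j, hA.eigenvalues j = 1 := by
    by_contra hcon
    push Not at hcon
    have hz : ∀ j, ∑ i, v j i = 0 := by
      intro j
      have h1 : ∑ i, ∑ l, W i l * v j l = ∑ l, v j l := by
        rw [Finset.sum_comm]
        refine Finset.sum_congr rfl fun l _ => ?_
        rw [← Finset.sum_mul]
        have : ∑ i, W i l = 1 := by
          rw [← hW.row_sum l]
          exact Finset.sum_congr rfl fun i _ => hW.symm.apply l i
        rw [this, one_mul]
      simp only [eig, ← Finset.mul_sum] at h1
      have : (hA.eigenvalues j - 1) * ∑ i, v j i = 0 := by linarith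
      rcases mul_eq_zero.1 this with h | h
      · exact absurd (by linarith) (hcon j)
      · exact h
    have h2 : ∑ i', ∑ j, v j ⟨0, by omega⟩ * v j i' = (0:ℝ) := by
      rw [Finset.sum_comm]
      simp [← Finset.mul_sum, hz]
    simp [compl] at h2
  have hlt : lambda2 hA hn < 1 := by
    have h0 : hA.eigenvalues (ee i0) = 1 := by
      obtain ⟨j, hj⟩ := hex
      refine le_antisymm (abs_le.1 (habs _)).2 ?_
      rw [hee, ← hj, ← ee.apply_symm_apply j, hee]
      exact hA.eigenvalues₀_antitone (Fin.mk_le_of_le_val (Nat.zero_le _))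
    -- If the second eigenvalue were also 1, the two leading eigenvectors would both be constant,
    -- which two orthogonal unit vectors cannot be.
    refine lt_of_le_of_ne (hl2 ▸ hee i1 ▸ (abs_le.1 (habs _)).2) fun h => ?_
    have h1 : hA.eigenvalues (ee i1) = 1 := by rw [hee, ← hl2, h]
    have c0 := hW.const_of_mulVec_eq (u := v (ee i0)) (fun i => by rw [eig, h0, one_mul])
    have c1 := hW.const_of_mulVec_eq (u := v (ee i1)) (fun i => by rw [eig, h1, one_mul])
    have hne : ee i0 ≠ ee i1 := by simp [i0, i1]
    have o := orth (ee i0) (ee i1)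
    have o0 := orth (ee i0) (ee i0)
    have o1 := orth (ee i1) (ee i1)
    let z : Fin n := ⟨0, by omega⟩
    simp only [fun i => c0 i z, fun i => c1 i z, hne, if_true, if_false, Finset.sum_const,
      Finset.card_univ, Fintype.card_fin, nsmul_eq_mul] at o o0 o1
    have hn0 : (n : ℝ) ≠ 0 := by positivity
    rcases mul_eq_zero.1 o with h | h
    · exact hn0 h
    · rcases mul_eq_zero.1 h with h | h
      · rw [h] at o0; simp at o0
      · rw [h] at o1; simp at o1
  refine ⟨hlt, ?_, v, hA.eigenvalues, ee i0, ?_⟩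
  · rw [hl2, ← hee]; exact (abs_le.1 (habs _)).1
  have hle : ∀ j, j ≠ ee i0 → hA.eigenvalues j ≤ lambda2 hA hn := by
    intro j hj
    rw [← ee.apply_symm_apply j, hee, hl2]
    apply hA.eigenvalues₀_antitone
    rw [Fin.le_def]
    have : (ee.symm j).val ≠ 0 := fun h => hj (by
      rw [← ee.apply_symm_apply j]; congr 1; exact Fin.ext h)
    show 1 ≤ _
    omega
  have h0 : hA.eigenvalues (ee i0) = 1 := by
    obtain ⟨j, hj⟩ := hex
    by_cases h : j = ee i0
    · rw [← h, hj]
    · exact absurd (hle j h) (by rw [hj]; exact not_le.2 hlt)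
  exact
    { orthonormal := orth
      complete := compl
      eigen := fun j i => by
        rw [← eig]
        exact Finset.sum_congr rfl fun l _ => by rw [mul_comm, hW.symm.apply l i]
      lam_top := h0
      const_mode := hW.const_of_mulVec_eq fun i => by rw [eig, h0, one_mul]
      lam_le := hle
      neg_one_le := fun j => (abs_le.1 (habs j)).1 }

end IsMixingMatrix

end CEDAS

noncomputable section

/-! ### One iteration in an abstract inner product space -/

namespace CEDAS

variable {E : Type*} [NormedAddCommGroup E] [InnerProductSpace ℝ E]

theorem norm_add_sq_le_young (a b : E) {t : ℝ} (ht : 0 < t) :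
    ‖a + b‖ ^ 2 ≤ (1 + t) * ‖a‖ ^ 2 + (1 + 1 / t) * ‖b‖ ^ 2 := by
  have h1 : ‖a + b‖ ≤ ‖a‖ + ‖b‖ := norm_add_le a b
  have h2 : 0 ≤ t * (‖a‖ - ‖b‖ / t) ^ 2 := by positivity
  have h3 : t * (‖a‖ - ‖b‖ / t) ^ 2 = t * ‖a‖ ^ 2 - 2 * (‖a‖ * ‖b‖) + 1 / t * ‖b‖ ^ 2 := by
    field_simp
    ring
  nlinarith [norm_nonneg (a + b), norm_nonneg a, norm_nonneg b, h1]

theorem norm_sub_sq_le_young (a b : E) {t : ℝ} (ht : 0 < t) :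
    ‖a - b‖ ^ 2 ≤ (1 + t) * ‖a‖ ^ 2 + (1 + 1 / t) * ‖b‖ ^ 2 := by
  have := norm_add_sq_le_young a (-b) ht
  rwa [norm_neg, ← sub_eq_add_neg] at this

theorem norm_add_sq_of_inner_eq_zero {a b : E} (h : inner ℝ b a = 0) :
    ‖a + b‖ ^ 2 = ‖a‖ ^ 2 + ‖b‖ ^ 2 := by
  rw [norm_add_sq_real, real_inner_comm, h]
  ring

theorem norm_sq_sum_four_le (a b c d : E) :
    ‖a + b + c + d‖ ^ 2 ≤ 4 * (‖a‖ ^ 2 + ‖b‖ ^ 2 + ‖c‖ ^ 2 + ‖d‖ ^ 2) := by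
  have h1 := norm_add_sq_le_young (a + b) (c + d) one_pos
  have h2 := norm_add_sq_le_young a b one_pos
  have h3 := norm_add_sq_le_young c d one_pos
  rw [← add_assoc] at h1
  linarith

variable {n : ℕ}

/-- The coordinate of a family of vectors along the mode `j`. -/
def modeCoord (v : Fin n → Fin n → ℝ) (j : Fin n) : (Fin n → E) →ₗ[ℝ] E :=
  ∑ i, v j i • LinearMap.proj i

theorem modeCoord_apply (v : Fin n → Fin n → ℝ) (j : Fin n) (X : Fin n → E) :
    modeCoord v j X = ∑ i, v j i • X i := by
  simp [modeCoord, LinearMap.sum_apply]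

/-- The operator `(γ / 2) (I - W)` acting on families of vectors. -/
def mixLap (W : Matrix (Fin n) (Fin n) ℝ) (γ : ℝ) : (Fin n → E) →ₗ[ℝ] (Fin n → E) :=
  LinearMap.pi fun i => (γ / 2) • (LinearMap.proj i - ∑ l, W i l • LinearMap.proj l)

theorem mixLap_apply (W : Matrix (Fin n) (Fin n) ℝ) (γ : ℝ) (X : Fin n → E) (i : Fin n) :
    mixLap W γ X i = (γ / 2) • (X i - ∑ l, W i l • X l) := by
  simp [mixLap, LinearMap.sum_apply]

/-- The sum of the squared norms of a family of vectors. -/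
def sumSq (X : Fin n → E) : ℝ := ∑ i, ‖X i‖ ^ 2

theorem sumSq_nonneg (X : Fin n → E) : 0 ≤ sumSq X := Finset.sum_nonneg fun _ _ => by positivity

theorem modeCoord_mem (v : Fin n → Fin n → ℝ) (j : Fin n) {X : Fin n → E} {K : Submodule ℝ E}
    (hX : ∀ i, X i ∈ K) : modeCoord v j X ∈ K := by
  rw [modeCoord_apply]
  exact K.sum_mem fun i _ => K.smul_mem _ (hX i)

theorem inner_modeCoord_eq_zero (v : Fin n → Fin n → ℝ) (j : Fin n) {e : Fin n → E} {y : E}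
    (h : ∀ i, inner ℝ (e i) y = 0) : inner ℝ (modeCoord v j e) y = 0 := by
  rw [modeCoord_apply, sum_inner]
  exact Finset.sum_eq_zero fun i _ => by rw [real_inner_smul_left, h, mul_zero]

/-- The eigenvalue of `mixLap W γ` on the mode `j`. -/
def modeRate (γ : ℝ) (lam : Fin n → ℝ) (j : Fin n) : ℝ := γ / 2 * (1 - lam j)

/-- The primal-dual consensus energy of the pair `(X, S)`. -/
def energy (γ : ℝ) (v : Fin n → Fin n → ℝ) (lam : Fin n → ℝ) (j₀ : Fin n) (X S : Fin n → E) : ℝ :=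
  ∑ j ∈ Finset.univ.erase j₀,
    (‖modeCoord v j X‖ ^ 2 + (1 / modeRate γ lam j - 1) * ‖modeCoord v j S‖ ^ 2)

namespace IsModeBasis

variable {W : Matrix (Fin n) (Fin n) ℝ} {v : Fin n → Fin n → ℝ} {lam : Fin n → ℝ} {j₀ : Fin n}
  {l2 : ℝ}

theorem parseval (hB : IsModeBasis W v lam j₀ l2) (X : Fin n → E) :
    ∑ j, ‖modeCoord v j X‖ ^ 2 = sumSq X := by
  have h : ∀ j, ‖modeCoord v j X‖ ^ 2 = ∑ i, ∑ i', v j i * v j i' * inner ℝ (X i) (X i') := by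
    intro j
    rw [← real_inner_self_eq_norm_sq, modeCoord_apply, sum_inner]
    refine Finset.sum_congr rfl fun i _ => ?_
    rw [inner_sum]
    refine Finset.sum_congr rfl fun i' _ => ?_
    rw [real_inner_smul_left, real_inner_smul_right]
    ring
  simp only [h, sumSq]
  rw [Finset.sum_comm]
  refine Finset.sum_congr rfl fun i _ => ?_
  rw [Finset.sum_comm]
  simp [← Finset.sum_mul, hB.complete]

theorem sum_erase_le (hB : IsModeBasis W v lam j₀ l2) (X : Fin n → E) :
    ∑ j ∈ Finset.univ.erase j₀, ‖modeCoord v j X‖ ^ 2 ≤ sumSq X := by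
  rw [← hB.parseval]
  exact Finset.sum_le_sum_of_subset_of_nonneg (Finset.erase_subset _ _)
    fun _ _ _ => by positivity

theorem modeCoord_mixLap (hB : IsModeBasis W v lam j₀ l2) (γ : ℝ) (j : Fin n) (X : Fin n → E) :
    modeCoord v j (mixLap W γ X) = modeRate γ lam j • modeCoord v j X := by
  simp only [modeCoord_apply, mixLap_apply, modeRate]
  have h : ∑ i, v j i • ∑ l, W i l • X l = lam j • ∑ l, v j l • X l := by
    simp only [Finset.smul_sum, smul_smul]
    rw [Finset.sum_comm]
    refine Finset.sum_congr rfl fun l _ => ?_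
    rw [← Finset.sum_smul, hB.eigen]
  have h2 : ∑ i, v j i • (γ / 2) • (X i - ∑ l, W i l • X l)
      = (γ / 2) • (∑ i, v j i • X i - ∑ i, v j i • ∑ l, W i l • X l) := by
    rw [← Finset.sum_sub_distrib, Finset.smul_sum]
    refine Finset.sum_congr rfl fun i _ => ?_
    rw [smul_comm, smul_sub]
  rw [h2, h]
  module

theorem modeRate_le (hB : IsModeBasis W v lam j₀ l2) {γ : ℝ} (hγ : 0 ≤ γ) (j : Fin n) :
    modeRate γ lam j ≤ γ := by
  have := hB.neg_one_le j
  unfold modeRate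
  nlinarith

theorem le_modeRate (hB : IsModeBasis W v lam j₀ l2) {γ : ℝ} (hγ : 0 ≤ γ) {j : Fin n}
    (hj : j ≠ j₀) : γ / 2 * (1 - l2) ≤ modeRate γ lam j := by
  have := hB.lam_le j hj
  unfold modeRate
  exact mul_le_mul_of_nonneg_left (by linarith) (by linarith)

theorem modeRate_top (hB : IsModeBasis W v lam j₀ l2) (γ : ℝ) : modeRate γ lam j₀ = 0 := by
  simp [modeRate, hB.lam_top]

theorem const_mode_sq (hB : IsModeBasis W v lam j₀ l2) (i : Fin n) :
    (n : ℝ) * (v j₀ i) ^ 2 = 1 := by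
  have := hB.orthonormal j₀ j₀
  simp only [fun i' => hB.const_mode i' i, if_true, Finset.sum_const, Finset.card_univ,
    Fintype.card_fin, nsmul_eq_mul] at this
  rw [sq]; exact this

theorem modeCoord_top (hB : IsModeBasis W v lam j₀ l2) (X : Fin n → E) :
    modeCoord v j₀ X = v j₀ j₀ • ∑ i, X i := by
  rw [modeCoord_apply, Finset.smul_sum]
  exact Finset.sum_congr rfl fun i _ => by rw [hB.const_mode i j₀]

theorem modeCoord_const (hB : IsModeBasis W v lam j₀ l2) {j : Fin n} (hj : j ≠ j₀) (y : E) :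
    modeCoord v j (fun _ => y) = 0 := by
  have h := hB.orthonormal j j₀
  simp only [fun i' => hB.const_mode i' j₀, hj, if_false, ← Finset.sum_mul] at h
  have h0 : v j₀ j₀ ≠ 0 := fun h0 => by simpa [h0] using hB.const_mode_sq j₀
  rw [modeCoord_apply, ← Finset.sum_smul, (mul_eq_zero.1 h).resolve_right h0, zero_smul]

theorem norm_modeCoord_top_sq (hB : IsModeBasis W v lam j₀ l2) (X : Fin n → E) :
    ‖modeCoord v j₀ X‖ ^ 2 = n * ‖(1 / (n : ℝ)) • ∑ i, X i‖ ^ 2 := by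
  have h := hB.const_mode_sq j₀
  have hn : (n : ℝ) ≠ 0 := fun h0 => by rw [h0] at h; simp at h
  rw [hB.modeCoord_top, norm_smul, norm_smul, mul_pow, mul_pow, Real.norm_eq_abs,
    Real.norm_eq_abs, sq_abs, sq_abs, ← mul_assoc]
  congr 1
  field_simp
  linarith

/-- Subtracting the mean removes exactly the constant mode; this identifies the consensus error with
the part of the norm that the energy controls. -/
theorem sumSq_sub_mean (hB : IsModeBasis W v lam j₀ l2) (X : Fin n → E) :
    sumSq (fun i => X i - (1 / (n : ℝ)) • ∑ l, X l)
      = ∑ j ∈ Finset.univ.erase j₀, ‖modeCoord v j X‖ ^ 2 := by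
  have h := hB.const_mode_sq j₀
  have hn : (n : ℝ) ≠ 0 := fun h0 => by rw [h0] at h; simp at h
  have he : (fun i => X i - (1 / (n : ℝ)) • ∑ l, X l)
      = X - fun _ => (1 / (n : ℝ)) • ∑ l, X l := rfl
  rw [← hB.parseval, ← Finset.add_sum_erase _ _ (Finset.mem_univ j₀), hB.norm_modeCoord_top_sq]
  have : ∑ i, (X i - (1 / (n : ℝ)) • ∑ l, X l) = 0 := by
    rw [Finset.sum_sub_distrib, Finset.sum_const, Finset.card_univ, Fintype.card_fin,
      ← Nat.cast_smul_eq_nsmul ℝ, smul_smul, mul_one_div_cancel hn, one_smul, sub_self]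
  rw [this, smul_zero, norm_zero]
  simp only [ne_eq, OfNat.ofNat_ne_zero, not_false_eq_true, zero_pow, mul_zero, zero_add]
  refine Finset.sum_congr rfl fun j hj => ?_
  rw [he, map_sub, hB.modeCoord_const (Finset.ne_of_mem_erase hj), sub_zero]

end IsModeBasis

/-- The weight 1/m - 1 on the dual variable is the one for which all unwanted cross terms cancel:
those of `y` with `e` cancel on the left, and those of `y` with `s` complete the square ‖y + s‖². No
orthogonality between `e` and `y` is needed. -/
theorem mode_identity {m : ℝ} (hm : m ≠ 0) (y : E) {s e : E} (hse : inner ℝ e s = 0) :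
    ‖y - m • (y + e)‖ ^ 2 + (1 / m - 1) * ‖s + m • (y + e)‖ ^ 2
      = (1 - m) * (‖y + s‖ ^ 2 + (1 / m - 1) * ‖s‖ ^ 2) + m * ‖e‖ ^ 2 := by
  have h1 : y - m • (y + e) = (1 - m) • y - m • e := by module
  rw [h1, norm_sub_sq_real, norm_add_sq_real s, norm_add_sq_real y s, norm_smul m (y + e),
    mul_pow, norm_add_sq_real y e]
  simp only [norm_smul, mul_pow, Real.norm_eq_abs, sq_abs, inner_add_right,
    real_inner_smul_left, real_inner_smul_right]
  rw [real_inner_comm e s, hse, real_inner_comm y s]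
  field_simp
  ring

/-- One mode of the primal-dual recursion contracts, up to gradient, noise, compression and drift
terms. -/
theorem mode_contraction {m κ γ η : ℝ} (hκ : 0 < κ) (hκm : κ ≤ m) (hmγ : m ≤ γ) (hγ : γ ≤ 1)
    {u s g ν e d : E} (hse : inner ℝ e s = 0) (hu : inner ℝ ν u = 0) (hg : inner ℝ ν g = 0) :
    ‖(u - s - η • (g + ν)) - m • ((u - s - η • (g + ν)) + e)‖ ^ 2
        + (1 / m - 1) * ‖s + m • ((u - s - η • (g + ν)) + e) + d‖ ^ 2
      ≤ (1 - κ / 2) * (‖u‖ ^ 2 + (1 / m - 1) * ‖s‖ ^ 2) + 5 / κ * η ^ 2 * ‖g‖ ^ 2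
        + η ^ 2 * ‖ν‖ ^ 2 + 5 / 4 * γ * ‖e‖ ^ 2 + 5 / κ ^ 2 * ‖d‖ ^ 2 := by
  have hm : 0 < m := hκ.trans_le hκm
  have hm1 : m ≤ 1 := hmγ.trans hγ
  have hκ1 : κ ≤ 1 := hκm.trans hm1
  have hw : 0 ≤ 1 / m - 1 := by rw [sub_nonneg, le_div_iff₀ hm]; linarith
  have hwκ : 1 / m - 1 ≤ 1 / κ := by
    have := one_div_le_one_div_of_le hκ hκm
    linarith
  obtain ⟨y, hy⟩ : ∃ y, y = u - s - η • (g + ν) := ⟨_, rfl⟩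
  rw [← hy]
  have hid := mode_identity hm.ne' y hse
  -- Adding `s` back removes the correction, so `y + s` is a plain gradient step from `u`, with
  -- noise orthogonal to the rest.
  have hys : y + s = (u - η • g) + (-η) • ν := by rw [hy]; module
  have hP : ‖y + s‖ ^ 2 ≤ (1 + κ / 4) * ‖u‖ ^ 2 + (1 + 1 / (κ / 4)) * (η ^ 2 * ‖g‖ ^ 2)
      + η ^ 2 * ‖ν‖ ^ 2 := by
    rw [hys, norm_add_sq_of_inner_eq_zero]
    · have := norm_sub_sq_le_young u (η • g) (t := κ / 4) (by positivity)
      rw [norm_smul, mul_pow, Real.norm_eq_abs, sq_abs] at this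
      rw [norm_smul, mul_pow, Real.norm_eq_abs, sq_abs, neg_sq]
      linarith
    · rw [real_inner_smul_left, inner_sub_right, real_inner_smul_right, hu, hg]; ring
  have hd := norm_add_sq_le_young (s + m • (y + e)) d (t := κ / 4) (by positivity)
  have e1 : (1 : ℝ) + 1 / (κ / 4) ≤ 5 / κ := by
    rw [show (1 : ℝ) + 1 / (κ / 4) = (κ + 4) / κ by field_simp]
    gcongr; linarith
  have e2 : (1 / m - 1) * (1 + 1 / (κ / 4)) ≤ 5 / κ ^ 2 := by
    calc (1 / m - 1) * (1 + 1 / (κ / 4)) ≤ 1 / κ * (5 / κ) := by gcongr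
      _ = 5 / κ ^ 2 := by field_simp
  have hsq0 : ‖y - m • (y + e)‖ ^ 2 ≤ (1 + κ / 4) * ‖y - m • (y + e)‖ ^ 2 :=
    le_mul_of_one_le_left (sq_nonneg _) (by linarith)
  have c3 : (1 + κ / 4) * (1 - m) ≤ 1 - 3 / 4 * κ := by
    have : (1 + κ / 4) * (1 - m) ≤ (1 + κ / 4) * (1 - κ) := by gcongr
    linarith [mul_pos hκ hκ]
  have c1 : (1 + κ / 4) * (1 - m) ≤ 1 := by linarith
  -- Two Young factors 1 + κ/4, one for the gradient and one for the drift, cost half of the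
  -- contraction 1 - m ≤ 1 - κ.
  have c2 : (1 + κ / 4) * (1 - m) * (1 + κ / 4) ≤ 1 - κ / 2 := by
    have : (1 + κ / 4) * (1 - m) * (1 + κ / 4) ≤ (1 - 3 / 4 * κ) * (1 + κ / 4) := by gcongr
    linarith [mul_pos hκ hκ]
  have c4 : (1 + κ / 4) * m ≤ 5 / 4 * γ := by
    have : (1 + κ / 4) * m ≤ 5 / 4 * m := by gcongr; linarith
    linarith
  have hA : ‖y - m • (y + e)‖ ^ 2 + (1 / m - 1) * ‖s + m • (y + e) + d‖ ^ 2
      ≤ (1 + κ / 4) * ((1 - m) * (‖y + s‖ ^ 2 + (1 / m - 1) * ‖s‖ ^ 2) + m * ‖e‖ ^ 2)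
        + (1 / m - 1) * (1 + 1 / (κ / 4)) * ‖d‖ ^ 2 := by
    rw [← hid]
    have := mul_le_mul_of_nonneg_left hd hw
    linarith
  refine hA.trans ?_
  have t1 : (1 + κ / 4) * (1 - m) * ‖y + s‖ ^ 2 ≤ (1 - κ / 2) * ‖u‖ ^ 2
      + 5 / κ * η ^ 2 * ‖g‖ ^ 2 + η ^ 2 * ‖ν‖ ^ 2 := by
    have h0 : 0 ≤ (1 + κ / 4) * (1 - m) := mul_nonneg (by positivity) (by linarith)
    have k1 := mul_le_mul_of_nonneg_left hP h0
    have k2 := mul_le_mul_of_nonneg_right c2 (sq_nonneg ‖u‖)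
    have k3 : (1 + κ / 4) * (1 - m) * ((1 + 1 / (κ / 4)) * (η ^ 2 * ‖g‖ ^ 2))
        ≤ 1 * (5 / κ * (η ^ 2 * ‖g‖ ^ 2)) := by
      gcongr
    have k4 := mul_le_mul_of_nonneg_right c1 (show 0 ≤ η ^ 2 * ‖ν‖ ^ 2 by positivity)
    linarith
  have t2 := mul_le_mul_of_nonneg_right (c3.trans (by linarith : _ ≤ 1 - κ / 2)) (show 0 ≤ (1 / m - 1) * ‖s‖ ^ 2 by positivity)
  have t3 := mul_le_mul_of_nonneg_right c4 (sq_nonneg ‖e‖)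
  have t4 := mul_le_mul_of_nonneg_right e2 (sq_nonneg ‖d‖)
  linarith

/-- This is the motion of the tracking target along one mode. Its part (1 - 2m)s is not small in
itself, but the energy weighs ‖s‖² by 1/m - 1, so relative to the energy it has size `γ`, uniformly
in the mode. -/
theorem mode_tracking_defect {m γ η : ℝ} (hm : 0 < m) (hmγ : m ≤ γ) (hγ : γ ≤ 1 / 4)
    {u s g d : E} :
    ‖s + (2 * m) • (u - s - η • g) + d‖ ^ 2
      ≤ 4 * γ * (‖u‖ ^ 2 + (1 / m - 1) * ‖s‖ ^ 2) + 16 * γ ^ 2 * η ^ 2 * ‖g‖ ^ 2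
        + 4 * ‖d‖ ^ 2 := by
  have h := norm_sq_sum_four_le ((1 - 2 * m) • s) ((2 * m) • u) ((-(2 * m * η)) • g) d
  have he : (1 - 2 * m) • s + (2 * m) • u + (-(2 * m * η)) • g + d
      = s + (2 * m) • (u - s - η • g) + d := by module
  rw [he] at h
  simp only [norm_smul, mul_pow, Real.norm_eq_abs, sq_abs] at h
  -- The right side is at least m(1/m - 1) = 1 - m, which dominates (1 - 2m)² for m ≤ 3/4.
  have a1 : (1 - 2 * m) ^ 2 ≤ γ * (1 / m - 1) := by
    have : m * (1 / m - 1) = 1 - m := by field_simp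
    have h0 : 0 ≤ 1 / m - 1 := by rw [sub_nonneg, le_div_iff₀ hm]; linarith
    nlinarith
  have a2 : (2 * m) ^ 2 ≤ γ := by nlinarith
  have a3 : (-(2 * m * η)) ^ 2 ≤ 4 * γ ^ 2 * η ^ 2 := by
    have : m ^ 2 ≤ γ ^ 2 := by gcongr
    nlinarith [mul_le_mul_of_nonneg_right this (sq_nonneg η)]
  have b1 := mul_le_mul_of_nonneg_right a1 (sq_nonneg ‖s‖)
  have b2 := mul_le_mul_of_nonneg_right a2 (sq_nonneg ‖u‖)
  have b3 := mul_le_mul_of_nonneg_right a3 (sq_nonneg ‖g‖)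
  rw [show (2 * m) ^ 2 = 2 ^ 2 * m ^ 2 by ring] at b2
  rw [show (-(2 * m * η)) ^ 2 = (2 * m * η)^2 by ring] at b3 h
  linarith

end CEDAS

end

/-! ### Energy, tracking error and Lyapunov function of the whole network -/

noncomputable section

namespace CEDAS

variable {E : Type*} [NormedAddCommGroup E] [InnerProductSpace ℝ E] {n : ℕ}

theorem sumSq_add_of_inner_eq_zero {A B : Fin n → E} (h : ∀ i, inner ℝ (B i) (A i) = 0) :
    sumSq (A + B) = sumSq A + sumSq B := by
  simp only [sumSq, ← Finset.sum_add_distrib, Pi.add_apply]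
  exact Finset.sum_congr rfl fun i _ => norm_add_sq_of_inner_eq_zero (h i)

theorem sumSq_smul (c : ℝ) (A : Fin n → E) : sumSq (c • A) = c ^ 2 * sumSq A := by
  simp only [sumSq, Finset.mul_sum, Pi.smul_apply, norm_smul, mul_pow, Real.norm_eq_abs, sq_abs]

theorem sumSq_add_le_young (A B : Fin n → E) {t : ℝ} (ht : 0 < t) :
    sumSq (A + B) ≤ (1 + t) * sumSq A + (1 + 1 / t) * sumSq B := by
  simp only [sumSq, Finset.mul_sum, ← Finset.sum_add_distrib, Pi.add_apply]
  exact Finset.sum_le_sum fun i _ => norm_add_sq_le_young (A i) (B i) ht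

namespace IsModeBasis

variable {W : Matrix (Fin n) (Fin n) ℝ} {v : Fin n → Fin n → ℝ} {lam : Fin n → ℝ} {j₀ : Fin n}
  {l2 : ℝ}

theorem energy_nonneg (hB : IsModeBasis W v lam j₀ l2) {γ : ℝ} (hγ : 0 < γ) (hγ1 : γ ≤ 1)
    (hl : l2 < 1) (X S : Fin n → E) : 0 ≤ energy γ v lam j₀ X S := by
  refine Finset.sum_nonneg fun j hj => ?_
  have h1 := hB.le_modeRate hγ.le (Finset.ne_of_mem_erase hj)
  have h2 := hB.modeRate_le hγ.le j
  have hm : 0 < modeRate γ lam j := lt_of_lt_of_le (by nlinarith) h1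
  have hw : 0 ≤ 1 / modeRate γ lam j - 1 := by rw [sub_nonneg, le_div_iff₀ hm]; linarith
  positivity

theorem consensus_le_energy (hB : IsModeBasis W v lam j₀ l2) {γ : ℝ} (hγ : 0 < γ) (hγ1 : γ ≤ 1)
    (hl : l2 < 1) (X S : Fin n → E) :
    ∑ j ∈ Finset.univ.erase j₀, ‖modeCoord v j X‖ ^ 2 ≤ energy γ v lam j₀ X S := by
  refine Finset.sum_le_sum fun j hj => ?_
  have h1 := hB.le_modeRate hγ.le (Finset.ne_of_mem_erase hj)
  have h2 := hB.modeRate_le hγ.le j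
  have hm : 0 < modeRate γ lam j := lt_of_lt_of_le (by nlinarith) h1
  have hw : 0 ≤ 1 / modeRate γ lam j - 1 := by rw [sub_nonneg, le_div_iff₀ hm]; linarith
  have : 0 ≤ (1 / modeRate γ lam j - 1) * ‖modeCoord v j S‖ ^ 2 := by positivity
  linarith

theorem energy_le (hB : IsModeBasis W v lam j₀ l2) {γ : ℝ} (hγ : 0 < γ) (hl : l2 < 1)
    (X S : Fin n → E) :
    energy γ v lam j₀ X S ≤ sumSq X + 1 / (γ / 2 * (1 - l2)) * sumSq S := by
  have hκ : 0 < γ / 2 * (1 - l2) := by nlinarith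
  have h : energy γ v lam j₀ X S ≤ ∑ j ∈ Finset.univ.erase j₀,
      (‖modeCoord v j X‖ ^ 2 + 1 / (γ / 2 * (1 - l2)) * ‖modeCoord v j S‖ ^ 2) := by
    refine Finset.sum_le_sum fun j hj => ?_
    have h1 := hB.le_modeRate hγ.le (Finset.ne_of_mem_erase hj)
    have h2 := one_div_le_one_div_of_le hκ h1
    gcongr
    linarith
  refine h.trans ?_
  rw [Finset.sum_add_distrib, ← Finset.mul_sum]
  gcongr
  · exact hB.sum_erase_le X
  · exact hB.sum_erase_le S

theorem sumSq_eq (hB : IsModeBasis W v lam j₀ l2) (X : Fin n → E) :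
    sumSq X = n * ‖(1 / (n : ℝ)) • ∑ i, X i‖ ^ 2
      + ∑ j ∈ Finset.univ.erase j₀, ‖modeCoord v j X‖ ^ 2 := by
  rw [← hB.parseval, ← Finset.add_sum_erase _ _ (Finset.mem_univ j₀), hB.norm_modeCoord_top_sq]

theorem energy_step (hB : IsModeBasis W v lam j₀ l2) {γ η κ : ℝ} (hκ : κ = γ / 2 * (1 - l2))
    (hκ0 : 0 < κ) (hγ : 0 < γ) (hγ1 : γ ≤ 1) {X S Gr N e δ Y : Fin n → E}
    (hY : Y = X - S - η • (Gr + N))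
    (hN : ∀ i i', inner ℝ (N i) (X i') = 0) (hN' : ∀ i i', inner ℝ (N i) (Gr i') = 0)
    (he : ∀ i i', inner ℝ (e i) (S i') = 0) :
    energy γ v lam j₀ (Y - mixLap W γ (Y + e)) (S + mixLap W γ (Y + e) + δ)
      ≤ (1 - κ / 2) * energy γ v lam j₀ X S + 5 / κ * η ^ 2 * sumSq Gr + η ^ 2 * sumSq N
        + 5 / 4 * γ * sumSq e + 5 / κ ^ 2 * sumSq δ := by
  have horth : ∀ (j : Fin n) {A B : Fin n → E}, (∀ i i', inner ℝ (A i) (B i') = 0) →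
      inner ℝ (modeCoord v j A) (modeCoord v j B) = 0 := by
    intro j A B h
    refine inner_modeCoord_eq_zero v j fun i => ?_
    rw [real_inner_comm]
    exact inner_modeCoord_eq_zero v j fun i' => by rw [real_inner_comm]; exact h i i'
  have hmode : ∀ j ∈ Finset.univ.erase j₀,
      ‖modeCoord v j (Y - mixLap W γ (Y + e))‖ ^ 2 + (1 / modeRate γ lam j - 1)
          * ‖modeCoord v j (S + mixLap W γ (Y + e) + δ)‖ ^ 2
        ≤ (1 - κ / 2) * (‖modeCoord v j X‖ ^ 2
            + (1 / modeRate γ lam j - 1) * ‖modeCoord v j S‖ ^ 2)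
          + 5 / κ * η ^ 2 * ‖modeCoord v j Gr‖ ^ 2 + η ^ 2 * ‖modeCoord v j N‖ ^ 2
          + 5 / 4 * γ * ‖modeCoord v j e‖ ^ 2 + 5 / κ ^ 2 * ‖modeCoord v j δ‖ ^ 2 := by
    intro j hj
    have h1 := hB.le_modeRate hγ.le (Finset.ne_of_mem_erase hj)
    rw [← hκ] at h1
    have := mode_contraction (η := η) hκ0 h1 (hB.modeRate_le hγ.le j) hγ1 (horth j he)
      (horth j hN) (horth j hN') (d := modeCoord v j δ)
    have hYj : modeCoord v j Y = modeCoord v j X - modeCoord v j S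
        - η • (modeCoord v j Gr + modeCoord v j N) := by
      rw [hY, map_sub, map_sub, map_smul, map_add]
    rw [map_sub, map_add _ _ δ, map_add _ S, hB.modeCoord_mixLap, map_add _ Y e, hYj]
    exact this
  have hsum := Finset.sum_le_sum hmode
  simp only [Finset.sum_add_distrib, ← Finset.mul_sum] at hsum
  have b1 := hB.sum_erase_le Gr
  have b2 := hB.sum_erase_le N
  have b3 := hB.sum_erase_le e
  have b4 := hB.sum_erase_le δ
  simp only [energy, Finset.sum_add_distrib]
  refine hsum.trans ?_
  gcongr

/-- The new tracking error is (1 - α) times the vector being compressed (up to sign), plus the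
defect `b`, plus compression noise with coefficient α + 2 · `modeRate`. The factor 2 arises because
the mixing step moves the solution and the correction in opposite directions. The noise is
orthogonal to the rest, so its square simply adds. -/
theorem tracking_step (hB : IsModeBasis W v lam j₀ l2) {γ η κ α : ℝ}
    (hκ : κ = γ / 2 * (1 - l2)) (hκ0 : 0 < κ) (hγ : 0 < γ) (hγ1 : γ ≤ 1 / 4)
    (hα : 0 < α) (hα1 : α ≤ 1) {X S T Gr N e δ Y : Fin n → E}
    (hY : Y = X - S - η • (Gr + N))
    (hN' : ∀ i i', inner ℝ (N i) (Gr i') = 0)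
    (hS0 : ∑ i, S i = 0) (hδ0 : ∑ i, δ i = 0)
    {K : Submodule ℝ E} (he : ∀ i, ∀ y ∈ K, inner ℝ (e i) y = 0)
    (hX : ∀ i, X i ∈ K) (hS : ∀ i, S i ∈ K) (hT : ∀ i, T i ∈ K) (hGr : ∀ i, Gr i ∈ K)
    (hNK : ∀ i, N i ∈ K) (hδ : ∀ i, δ i ∈ K) :
    sumSq ((1 - α) • (T + η • (Gr + N)) + α • e + S + (2 : ℝ) • mixLap W γ (Y + e) + δ)
      ≤ (1 - α) * sumSq (T + η • (Gr + N)) + (α + 2 * γ) ^ 2 * sumSq e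
        + 2 / α * (4 * γ * energy γ v lam j₀ X S
          + 16 * γ ^ 2 * η ^ 2 * (sumSq Gr + sumSq N) + 4 * sumSq δ) := by
  set b : Fin n → E := fun j => modeCoord v j S + (2 * modeRate γ lam j) • modeCoord v j Y
    + modeCoord v j δ with hb
  have hmode : ∀ j, ‖modeCoord v j ((1 - α) • (T + η • (Gr + N)) + α • e + S
        + (2 : ℝ) • mixLap W γ (Y + e) + δ)‖ ^ 2
      ≤ (1 - α) * ‖modeCoord v j (T + η • (Gr + N))‖ ^ 2
        + (α + 2 * γ) ^ 2 * ‖modeCoord v j e‖ ^ 2 + 2 / α * ‖b j‖ ^ 2 := by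
    intro j
    have hYK : ∀ i, Y i ∈ K := fun i => by
      rw [hY]
      exact K.sub_mem (K.sub_mem (hX i) (hS i)) (K.smul_mem _ (K.add_mem (hGr i) (hNK i)))
    have hτK : ∀ i, (T + η • (Gr + N)) i ∈ K := fun i =>
      K.add_mem (hT i) (K.smul_mem _ (K.add_mem (hGr i) (hNK i)))
    have hbK : b j ∈ K := K.add_mem (K.add_mem (modeCoord_mem v j hS)
      (K.smul_mem _ (modeCoord_mem v j hYK))) (modeCoord_mem v j hδ)
    have hτ := modeCoord_mem v j hτK
    have hdec : modeCoord v j ((1 - α) • (T + η • (Gr + N)) + α • e + S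
        + (2 : ℝ) • mixLap W γ (Y + e) + δ)
        = ((1 - α) • modeCoord v j (T + η • (Gr + N)) + b j)
          + (α + 2 * modeRate γ lam j) • modeCoord v j e := by
      rw [map_add, map_add, map_add, map_add, map_smul _ (1 - α), map_smul _ α,
        map_smul _ (2 : ℝ), hB.modeCoord_mixLap, map_add _ Y e, hb]
      module
    rw [hdec, norm_add_sq_of_inner_eq_zero]
    · have h1 := norm_add_sq_le_young ((1 - α) • modeCoord v j (T + η • (Gr + N))) (b j) hα
      rw [norm_smul, mul_pow, Real.norm_eq_abs, sq_abs] at h1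
      rw [norm_smul, mul_pow, Real.norm_eq_abs, sq_abs]
      -- Young's inequality with parameter `α` uses up one of the two factors 1 - α.
      have k1 : (1 + α) * (1 - α) ^ 2 ≤ 1 - α := by
        have := mul_nonneg (sub_nonneg.2 hα1) (sq_nonneg α)
        linarith
      have k2 : 1 + 1 / α ≤ 2 / α := by
        rw [show 1 + 1 / α = (α + 1) / α by field_simp]
        gcongr
        linarith
      have hm0 : 0 ≤ modeRate γ lam j := by
        by_cases hj : j = j₀
        · rw [hj, hB.modeRate_top]
        · exact (hκ ▸ hκ0).le.trans (hB.le_modeRate hγ.le hj)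
      have k3 : (α + 2 * modeRate γ lam j) ^ 2 ≤ (α + 2 * γ) ^ 2 := by
        have := hB.modeRate_le hγ.le j
        gcongr
      have q1 := mul_le_mul_of_nonneg_right k1
        (sq_nonneg ‖modeCoord v j (T + η • (Gr + N))‖)
      have q2 := mul_le_mul_of_nonneg_right k2 (sq_nonneg ‖b j‖)
      have q3 := mul_le_mul_of_nonneg_right k3 (sq_nonneg ‖modeCoord v j e‖)
      linarith
    · rw [real_inner_smul_left, inner_modeCoord_eq_zero v j fun i => he i _
        (K.add_mem (K.smul_mem _ hτ) hbK), mul_zero]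
  have hbsum : ∑ j, ‖b j‖ ^ 2 ≤ 4 * γ * energy γ v lam j₀ X S
      + 16 * γ ^ 2 * η ^ 2 * (sumSq Gr + sumSq N) + 4 * sumSq δ := by
    -- The energy says nothing about the constant mode, but the defect vanishes there: corrections
    -- and drift sum to zero and the mixing rate is zero.
    have hb0 : b j₀ = 0 := by
      simp [hb, hB.modeRate_top, hB.modeCoord_top, hS0, hδ0]
    rw [← Finset.add_sum_erase _ _ (Finset.mem_univ j₀), hb0, norm_zero, zero_pow two_ne_zero,
      zero_add]
    have hm : ∀ j ∈ Finset.univ.erase j₀, ‖b j‖ ^ 2 ≤ 4 * γ * (‖modeCoord v j X‖ ^ 2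
        + (1 / modeRate γ lam j - 1) * ‖modeCoord v j S‖ ^ 2)
        + 16 * γ ^ 2 * η ^ 2 * ‖modeCoord v j (Gr + N)‖ ^ 2 + 4 * ‖modeCoord v j δ‖ ^ 2 := by
      intro j hj
      have h1 := hB.le_modeRate hγ.le (Finset.ne_of_mem_erase hj)
      have := mode_tracking_defect (η := η) (lt_of_lt_of_le (hκ ▸ hκ0) h1)
        (hB.modeRate_le hγ.le j) hγ1 (u := modeCoord v j X) (s := modeCoord v j S)
        (g := modeCoord v j (Gr + N)) (d := modeCoord v j δ)
      rw [← map_smul, ← map_sub, ← map_sub, ← hY] at this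
      exact this
    have hsum := Finset.sum_le_sum hm
    simp only [Finset.sum_add_distrib, ← Finset.mul_sum] at hsum
    have b1 := hB.sum_erase_le (Gr + N)
    have b4 := hB.sum_erase_le δ
    rw [sumSq_add_of_inner_eq_zero fun i => hN' i i] at b1
    simp only [energy, Finset.sum_add_distrib]
    refine hsum.trans ?_
    gcongr
  have hsum := Finset.sum_le_sum fun j (_ : j ∈ Finset.univ) => hmode j
  simp only [Finset.sum_add_distrib, ← Finset.mul_sum, hB.parseval] at hsum
  refine hsum.trans ?_
  gcongr

end IsModeBasis

/-- The Lyapunov function: consensus energy plus weighted compression error. -/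
def lyapunov (γ α C : ℝ) (v : Fin n → Fin n → ℝ) (lam : Fin n → ℝ) (j₀ : Fin n)
    (X S T : Fin n → E) : ℝ :=
  energy γ v lam j₀ X S + 12 * γ * C / α * sumSq T

/-- A small-gain argument. With weight ω = γ/α² on the tracking error, the compression noise in the
energy costs a fraction of ωατ, paid by the contraction of the tracking error. The feedback of the
energy into the tracking error costs 8ωγ/α, at most κ/4 by the quadratic bound on `γ`. -/
theorem lyapunov_arith {γ κ α C η V V' T T' τ e g N d : ℝ} (hκ : 0 < κ) (hκγ : κ ≤ γ)
    (hα : 0 < α) (hα1 : α ≤ 1) (hαC : α * C = 1 / 12) (hγ : 648 * γ ^ 2 * C ≤ κ * α ^ 2)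
    (hV0 : 0 ≤ V) (hT0 : 0 ≤ T) (hg0 : 0 ≤ g) (hN0 : 0 ≤ N) (hd0 : 0 ≤ d) (hτ0 : 0 ≤ τ)
    (hV : V' ≤ (1 - κ / 2) * V + 5 / κ * η ^ 2 * g + η ^ 2 * N + 5 / 4 * γ * e + 5 / κ ^ 2 * d)
    (hT : T' ≤ (1 - α) * τ + (α + 2 * γ) ^ 2 * e
      + 2 / α * (4 * γ * V + 16 * γ ^ 2 * η ^ 2 * (g + N) + 4 * d))
    (he : e ≤ C * τ) (hτ : τ ≤ (1 + α / 4) * T + 5 / α * η ^ 2 * g + η ^ 2 * N) :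
    V' + 12 * γ * C / α * T' ≤ (1 - κ / 4) * (V + 12 * γ * C / α * T)
      + 6 / κ * η ^ 2 * g + 2 * η ^ 2 * N + 6 / κ ^ 2 * d := by
  have hγ0 : 0 < γ := hκ.trans_le hκγ
  have hC : C = 1 / (12 * α) := by field_simp; linarith
  have hC0 : 0 < C := by rw [hC]; positivity
  -- the weight `ω` of the compression error, with `γ = ω α ^ 2`
  obtain ⟨ω, hω⟩ : ∃ ω, γ = ω * α ^ 2 := ⟨γ / α ^ 2, by field_simp⟩
  have hω0 : 0 < ω := by
    rw [hω] at hγ0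
    exact pos_of_mul_pos_left hγ0 (sq_nonneg α)
  have hb : 12 * γ * C / α = ω := by rw [hω, hC]; field_simp
  have hγ2 : 54 * γ * ω ≤ κ * α := by
    have : 648 * γ ^ 2 * C = 54 * γ * ω * α := by
      rw [hC, hω]; field_simp; ring
    rw [this, sq, ← mul_assoc] at hγ
    exact le_of_mul_le_mul_right hγ hα
  have hωα : 54 * ω ≤ α := by
    refine le_of_mul_le_mul_left ?_ hγ0
    have := mul_le_mul_of_nonneg_right hκγ hα.le
    linarith
  have hωκ : ω * γ ≤ κ * α / 54 := by linarith
  have hγω : γ ≤ ω := by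
    rw [hω]
    exact mul_le_of_le_one_right hω0.le (pow_le_one₀ hα.le hα1)
  have hκα : κ ≤ α / 54 := by linarith
  rw [hb]
  have hγα : γ ≤ α / 54 := by linarith
  have hγC : γ * C ≤ ω * α / 12 := by rw [hω, hC]; apply le_of_eq; field_simp
  -- compression error of the tracking variable
  have hTe : T' ≤ (1 - 9 / 10 * α) * τ + 2 / α * (4 * γ * V + 16 * γ ^ 2 * η ^ 2 * (g + N)
      + 4 * d) := by
    -- From γ ≤ α/54. Since Cα² = α/12, the noise then eats less than α/10 of the contraction 1 - α.
    have h1 : (α + 2 * γ) ^ 2 ≤ (28 / 27 * α) ^ 2 := by gcongr; linarith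
    have h2 : (α + 2 * γ) ^ 2 * e ≤ (28 / 27 * α) ^ 2 * (C * τ) :=
      (mul_le_mul_of_nonneg_left he (sq_nonneg _)).trans
        (mul_le_mul_of_nonneg_right h1 (by positivity))
    have h3 : (28 / 27 * α) ^ 2 * (C * τ) = (28 / 27) ^ 2 / 12 * (α * τ) := by
      rw [hC]; field_simp
    have h4 : 0 ≤ α * τ := mul_nonneg hα.le hτ0
    rw [h3] at h2
    linarith
  have hVe : V' ≤ (1 - κ / 2) * V + 5 / κ * η ^ 2 * g + η ^ 2 * N + 5 / 48 * (ω * α) * τ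
      + 5 / κ ^ 2 * d := by
    have h1 : γ * e ≤ ω * α / 12 * τ := by
      calc γ * e ≤ γ * (C * τ) := by gcongr
        -- With γC ≤ ωα/12 the energy receives 5/4 · ωα/12 = 5/48 · ωα times τ, which leaves at
        -- least 7/10 of the rate `α`.
        _ = γ * C * τ := by ring
        _ ≤ ω * α / 12 * τ := by gcongr
    linarith
  have hsum : V' + ω * T' ≤ (1 - κ / 2) * V + 5 / κ * η ^ 2 * g + η ^ 2 * N + 5 / κ ^ 2 * d
      + ω * ((1 - 7 / 10 * α) * τ) + 2 * ω / α * (4 * γ * V + 16 * γ ^ 2 * η ^ 2 * (g + N)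
      + 4 * d) := by
    have h1 := mul_le_mul_of_nonneg_left hTe hω0.le
    have h2 : 2 * ω / α * (4 * γ * V + 16 * γ ^ 2 * η ^ 2 * (g + N) + 4 * d)
      = ω * (2 / α * (4 * γ * V + 16 * γ ^ 2 * η ^ 2 * (g + N) + 4 * d)) := by ring
    have h3 : 0 ≤ ω * α * τ := by positivity
    rw [h2]
    linarith
  have hτ' : (1 - 7 / 10 * α) * τ ≤ (1 - 4 / 10 * α) * T + 5 / α * η ^ 2 * g + η ^ 2 * N := by
    have h0 : 0 ≤ 1 - 7 / 10 * α := by linarith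
    have h1 := mul_le_mul_of_nonneg_left hτ h0
    have h2 : (1 - 7 / 10 * α) * ((1 + α / 4) * T) ≤ (1 - 4 / 10 * α) * T := by
      have : (1 - 7 / 10 * α) * (1 + α / 4) ≤ 1 - 4 / 10 * α := by
        linarith [mul_pos hα hα]
      rw [← mul_assoc]
      exact mul_le_mul_of_nonneg_right this hT0
    have h3 : (1 - 7 / 10 * α) * (5 / α * η ^ 2 * g + η ^ 2 * N)
        ≤ 1 * (5 / α * η ^ 2 * g + η ^ 2 * N) := by
      gcongr
      linarith
    linarith
  have hωα' : ω / α ≤ 1 / 54 := by rw [div_le_iff₀ hα]; linarith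
  have p1 : 2 * ω / α * (4 * γ * V) ≤ κ / 4 * V := by
    have : 2 * ω / α * (4 * γ) ≤ κ / 4 := by
      rw [show 2 * ω / α * (4 * γ) = 8 * (ω * γ) / α by ring, div_le_iff₀ hα]
      linarith [mul_pos hκ hα]
    calc 2 * ω / α * (4 * γ * V) = 2 * ω / α * (4 * γ) * V := by ring
      _ ≤ _ := by gcongr
  have hγ1 : γ ≤ 1 / 54 := by linarith
  have p2 : 2 * ω / α * (16 * γ ^ 2 * η ^ 2 * (g + N)) ≤ 1 / 100 * (η ^ 2 * g + η ^ 2 * N) := by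
    have h1 : γ ^ 2 ≤ (1 / 54) ^ 2 := by gcongr
    calc 2 * ω / α * (16 * γ ^ 2 * η ^ 2 * (g + N))
        = 32 * (ω / α) * γ ^ 2 * (η ^ 2 * g + η ^ 2 * N) := by ring
      _ ≤ 32 * (1 / 54) * (1 / 54) ^ 2 * (η ^ 2 * g + η ^ 2 * N) := by gcongr
      _ ≤ 1 / 100 * (η ^ 2 * g + η ^ 2 * N) := by gcongr; norm_num
  have p3 : 2 * ω / α * (4 * d) ≤ d := by
    calc 2 * ω / α * (4 * d) = 8 * (ω / α) * d := by ring
      _ ≤ 8 * (1 / 54) * d := by gcongr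
      _ ≤ d := by linarith
  have p4 : ω * (5 / α * η ^ 2 * g) ≤ 1 / 10 * (η ^ 2 * g) := by
    calc ω * (5 / α * η ^ 2 * g) = 5 * (ω / α) * (η ^ 2 * g) := by ring
      _ ≤ 5 * (1 / 54) * (η ^ 2 * g) := by gcongr
      _ ≤ 1 / 10 * (η ^ 2 * g) := by gcongr; norm_num
  have p5 : ω * (η ^ 2 * N) ≤ 1 / 10 * (η ^ 2 * N) := by gcongr; linarith
  have p6 : ω * ((1 - 4 / 10 * α) * T) ≤ (1 - κ / 4) * (ω * T) := by
    have h1 : (1 - 4 / 10 * α) * (ω * T) ≤ (1 - κ / 4) * (ω * T) := by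
      gcongr
      linarith
    linarith
  have hκ1 : κ ≤ 1 := by linarith
  have p7 : η ^ 2 * g ≤ 1 / κ * η ^ 2 * g := by
    rw [mul_assoc]
    exact le_mul_of_one_le_left (by positivity) (by rw [le_div_iff₀ hκ]; linarith)
  have p8 : d ≤ 1 / κ ^ 2 * d :=
    le_mul_of_one_le_left hd0 (by 
      rw [le_div_iff₀ (by positivity), one_mul]; exact pow_le_one₀ hκ.le hκ1)
  have h1 := mul_le_mul_of_nonneg_left hτ' hω0.le
  have r1 : 6 / κ * η ^ 2 * g = 5 / κ * η ^ 2 * g + 1 / κ * η ^ 2 * g := by ring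
  have r2 : 6 / κ ^ 2 * d = 5 / κ ^ 2 * d + 1 / κ ^ 2 * d := by ring
  have r3 : 0 ≤ η ^ 2 * g := by positivity
  have r4 : 0 ≤ η ^ 2 * N := by positivity
  rw [r1, r2]
  linarith

end CEDAS

end

/-! ### The averaged iterate and one full step from abstract orthogonality relations -/

noncomputable section

namespace CEDAS

variable {E : Type*} [NormedAddCommGroup E] [InnerProductSpace ℝ E] {n : ℕ}

/-- The average of a family of vectors. -/
def mean (X : Fin n → E) : E := (1 / (n : ℝ)) • ∑ i, X i

theorem mean_add (X Y : Fin n → E) : mean (X + Y) = mean X + mean Y := by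
  simp [mean, Finset.sum_add_distrib]

theorem mean_sub (X Y : Fin n → E) : mean (X - Y) = mean X - mean Y := by
  simp [mean, Finset.sum_sub_distrib, smul_sub]

theorem mean_smul (c : ℝ) (X : Fin n → E) : mean (c • X) = c • mean X := by
  simp only [mean, Pi.smul_apply, ← Finset.smul_sum]
  rw [smul_comm]

theorem mean_mem {X : Fin n → E} {K : Submodule ℝ E} (hX : ∀ i, X i ∈ K) : mean X ∈ K :=
  K.smul_mem _ (K.sum_mem fun i _ => hX i)

theorem norm_mean_sq_le (X : Fin n → E) (hn : 0 < n) : ‖mean X‖ ^ 2 ≤ sumSq X / n := by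
  have hn' : (0 : ℝ) < n := by exact_mod_cast hn
  have h1 : ‖∑ i, X i‖ ≤ ∑ i, ‖X i‖ := norm_sum_le _ _
  have h2 : (∑ i, ‖X i‖) ^ 2 ≤ n * sumSq X := by
    have := sq_sum_le_card_mul_sum_sq (s := Finset.univ) (f := fun i => ‖X i‖)
    simpa [sumSq] using this
  have h3 : ‖∑ i, X i‖ ^ 2 ≤ n * sumSq X :=
    (pow_le_pow_left₀ (norm_nonneg _) h1 2).trans h2
  rw [mean, norm_smul, mul_pow, Real.norm_eq_abs, sq_abs]
  calc (1 / (n : ℝ)) ^ 2 * ‖∑ i, X i‖ ^ 2 ≤ (1 / (n : ℝ)) ^ 2 * (n * sumSq X) := by gcongr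
    _ = sumSq X / n := by field_simp

/-- Pythagoras instead of Cauchy–Schwarz: this gains a further factor 1/n and is the source of the
linear speedup in the final rate. -/
theorem norm_mean_sq_of_pairwise {N : Fin n → E}
    (hN : ∀ i i', i ≠ i' → inner ℝ (N i) (N i') = 0) :
    ‖mean N‖ ^ 2 = sumSq N / (n : ℝ) ^ 2 := by
  have h : ‖∑ i, N i‖ ^ 2 = sumSq N := by
    rw [← real_inner_self_eq_norm_sq, sum_inner]
    refine Finset.sum_congr rfl fun i _ => ?_
    rw [inner_sum, Finset.sum_eq_single i (fun i' _ h => hN i i' h.symm) (by simp),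
      real_inner_self_eq_norm_sq]
  rw [mean, norm_smul, mul_pow, Real.norm_eq_abs, sq_abs, h]
  ring

/-- The relations between the error variables of one iteration: `X` is the error of the local
solutions, `S` that of the corrections, `T` that of the reference points; `Gr` and `Gb` are the
gradient differences at the local solutions and at their average, `N` the gradient noise, `e` the
compression noise, and `δ` the drift of the target of the corrections. -/
structure IsErrorIteration (L μ σ C η : ℝ) (X S T Gr Gb N e δ : Fin n → E)
    (K K' : Submodule ℝ E) : Prop where
  le : K ≤ K'
  X_mem : ∀ i, X i ∈ K
  S_mem : ∀ i, S i ∈ K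
  T_mem : ∀ i, T i ∈ K
  Gr_mem : ∀ i, Gr i ∈ K
  Gb_mem : ∀ i, Gb i ∈ K
  δ_mem : ∀ i, δ i ∈ K
  N_mem : ∀ i, N i ∈ K'
  N_orth : ∀ i, ∀ y ∈ K, inner ℝ (N i) y = 0
  N_pair : ∀ i i', i ≠ i' → inner ℝ (N i) (N i') = 0
  N_sq : ∀ i, ‖N i‖ ^ 2 ≤ σ ^ 2
  e_orth : ∀ i, ∀ y ∈ K', inner ℝ (e i) y = 0
  e_sq : sumSq e ≤ C * sumSq (T + η • (Gr + N))
  sum_S : ∑ i, S i = 0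
  sum_δ : ∑ i, δ i = 0
  Gr_le : ∀ i, ‖Gr i‖ ≤ L * ‖X i‖
  Gr_sub_Gb_le : ∀ i, ‖Gr i - Gb i‖ ≤ L * ‖X i - mean X‖
  inner_Gb : μ * ‖mean X‖ ^ 2 ≤ inner ℝ (mean Gb) (mean X)
  mean_Gb_le : ‖mean Gb‖ ≤ L * ‖mean X‖

namespace IsErrorIteration

variable {W : Matrix (Fin n) (Fin n) ℝ} {v : Fin n → Fin n → ℝ} {lam : Fin n → ℝ} {j₀ : Fin n}
  {l2 L μ σ C η : ℝ} {X S T Gr Gb N e δ Y : Fin n → E} {K K' : Submodule ℝ E}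

theorem sum_mixLap (hB : IsModeBasis W v lam j₀ l2) (γ : ℝ) (Z : Fin n → E) :
    ∑ i, mixLap W γ Z i = 0 := by
  have h := hB.modeCoord_mixLap γ j₀ Z
  rw [hB.modeRate_top, zero_smul, hB.modeCoord_top] at h
  have h0 : v j₀ j₀ ≠ 0 := fun h0 => by simpa [h0] using hB.const_mode_sq j₀
  exact (smul_eq_zero.1 h).resolve_left h0

theorem sumSq_N_le (h : IsErrorIteration L μ σ C η X S T Gr Gb N e δ K K') :
    sumSq N ≤ n * σ ^ 2 := by
  have := Finset.sum_le_sum fun i (_ : i ∈ Finset.univ) => h.N_sq i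
  simpa [sumSq] using this

theorem sumSq_Gr_le (h : IsErrorIteration L μ σ C η X S T Gr Gb N e δ K K') :
    sumSq Gr ≤ L ^ 2 * sumSq X := by
  rw [sumSq, sumSq, Finset.mul_sum]
  refine Finset.sum_le_sum fun i _ => ?_
  rw [← mul_pow]
  exact pow_le_pow_left₀ (norm_nonneg _) (h.Gr_le i) 2

/-- Mixing has mean zero and the corrections sum to zero, so compression drops out and the average
takes a gradient step on the average objective. The gradients are taken at the local points rather
than at their mean; this bias is bounded by the consensus error. -/
theorem mean_step (h : IsErrorIteration L μ σ C η X S T Gr Gb N e δ K K')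
    (hB : IsModeBasis W v lam j₀ l2) (hμ : 0 < μ) (hη : 0 < η) (hημ : η * μ ≤ 1) (hn : 0 < n)
    (γ : ℝ) (hY : Y = X - S - η • (Gr + N)) :
    ‖mean (Y - mixLap W γ (Y + e))‖ ^ 2 ≤
      (1 - 7 / 4 * (η * μ) + 2 * η ^ 2 * L ^ 2) * ‖mean X‖ ^ 2
        + 5 * η / μ * L ^ 2 * ((∑ j ∈ Finset.univ.erase j₀, ‖modeCoord v j X‖ ^ 2) / n)
        + η ^ 2 * σ ^ 2 / n := by
  have hn' : (0 : ℝ) < n := by exact_mod_cast hn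
  have e0 : mean (mixLap W γ (Y + e)) = 0 := by
    rw [mean, sum_mixLap hB, smul_zero]
  have eS : mean S = 0 := by rw [mean, h.sum_S, smul_zero]
  have e1 : mean (Y - mixLap W γ (Y + e))
      = (mean X - η • mean Gb - η • mean (Gr - Gb)) + (-η) • mean N := by
    rw [mean_sub, e0, hY, mean_sub, mean_sub, eS, mean_smul, mean_add, mean_sub]
    module
  have hmemX := mean_mem h.X_mem
  have hmemGb := mean_mem h.Gb_mem
  have hmemD : mean (Gr - Gb) ∈ K := mean_mem fun i => K.sub_mem (h.Gr_mem i) (h.Gb_mem i)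
  have hNorth : ∀ y ∈ K, inner ℝ (mean N) y = 0 := by
    intro y hy
    rw [mean, real_inner_smul_left, sum_inner, Finset.sum_eq_zero fun i _ => h.N_orth i y hy,
      mul_zero]
  rw [e1, norm_add_sq_of_inner_eq_zero]
  swap
  · rw [real_inner_smul_left, hNorth _ (K.sub_mem (K.sub_mem hmemX (K.smul_mem _ hmemGb))
      (K.smul_mem _ hmemD)), mul_zero]
  have hNm : ‖(-η) • mean N‖ ^ 2 ≤ η ^ 2 * σ ^ 2 / n := by
    rw [norm_smul, mul_pow, Real.norm_eq_abs, sq_abs, neg_sq, norm_mean_sq_of_pairwise h.N_pair]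
    calc η ^ 2 * (sumSq N / (n : ℝ) ^ 2) ≤ η ^ 2 * (n * σ ^ 2 / (n : ℝ) ^ 2) := by
          gcongr; exact h.sumSq_N_le
      _ = η ^ 2 * σ ^ 2 / n := by field_simp
  have hD : ‖mean (Gr - Gb)‖ ^ 2
      ≤ L ^ 2 * ((∑ j ∈ Finset.univ.erase j₀, ‖modeCoord v j X‖ ^ 2) / n) := by
    refine (norm_mean_sq_le _ hn).trans ?_
    rw [← mul_div_assoc]
    gcongr
    rw [← hB.sumSq_sub_mean, sumSq, sumSq, Finset.mul_sum]
    refine Finset.sum_le_sum fun i _ => ?_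
    rw [← mul_pow]
    exact pow_le_pow_left₀ (norm_nonneg _) (h.Gr_sub_Gb_le i) 2
  have hGD : ‖mean X - η • mean Gb‖ ^ 2 ≤ (1 - 2 * (η * μ) + η ^ 2 * L ^ 2) * ‖mean X‖ ^ 2 := by
    rw [norm_sub_sq_real, real_inner_smul_right, norm_smul, mul_pow, Real.norm_eq_abs, sq_abs,
      real_inner_comm]
    have h1 := mul_le_mul_of_nonneg_left h.inner_Gb hη.le
    have h2 : ‖mean Gb‖ ^ 2 ≤ L ^ 2 * ‖mean X‖ ^ 2 := by
      rw [← mul_pow]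
      exact pow_le_pow_left₀ (norm_nonneg _) h.mean_Gb_le 2
    have h3 := mul_le_mul_of_nonneg_left h2 (sq_nonneg η)
    linarith
  -- The parameter ημ/4 lowers the contraction rate from 2ημ only to 7/4 · ημ; the margin over 3/2 ·
  -- ημ is needed in the scalar recursion.
  have hYg := norm_sub_sq_le_young (mean X - η • mean Gb) (η • mean (Gr - Gb))
    (t := η * μ / 4) (by positivity)
  rw [norm_smul, mul_pow, Real.norm_eq_abs, sq_abs] at hYg
  have hημ0 : 0 < η * μ := by positivity
  have k1 : (1 + η * μ / 4) * ‖mean X - η • mean Gb‖ ^ 2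
      ≤ (1 - 7 / 4 * (η * μ) + 2 * η ^ 2 * L ^ 2) * ‖mean X‖ ^ 2 := by
    have h1 := mul_le_mul_of_nonneg_left hGD (show 0 ≤ 1 + η * μ / 4 by positivity)
    have h2 : (1 + η * μ / 4) * (1 - 2 * (η * μ) + η ^ 2 * L ^ 2)
        ≤ 1 - 7 / 4 * (η * μ) + 2 * η ^ 2 * L ^ 2 := by
      have h3 : η * μ / 4 * (η ^ 2 * L ^ 2) ≤ 1 * (η ^ 2 * L ^ 2) := by gcongr; linarith
      linarith [mul_pos hημ0 hημ0]
    have h3 := mul_le_mul_of_nonneg_right h2 (sq_nonneg ‖mean X‖)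
    linarith
  have k2 : (1 + 1 / (η * μ / 4)) * (η ^ 2 * ‖mean (Gr - Gb)‖ ^ 2)
      ≤ 5 * η / μ * L ^ 2 * ((∑ j ∈ Finset.univ.erase j₀, ‖modeCoord v j X‖ ^ 2) / n) := by
    have h1 : (1 + 1 / (η * μ / 4)) ≤ 5 / (η * μ) := by
      rw [show 1 + 1 / (η * μ / 4) = (η * μ + 4) / (η * μ) by field_simp]
      gcongr
      linarith
    calc (1 + 1 / (η * μ / 4)) * (η ^ 2 * ‖mean (Gr - Gb)‖ ^ 2)
        ≤ 5 / (η * μ) * (η ^ 2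
          * (L ^ 2 * ((∑ j ∈ Finset.univ.erase j₀, ‖modeCoord v j X‖ ^ 2) / n))) := by gcongr
      _ = _ := by field_simp
  linarith

theorem lyapunov_step (h : IsErrorIteration L μ σ C η X S T Gr Gb N e δ K K')
    (hB : IsModeBasis W v lam j₀ l2) {α γ κ : ℝ} (hκ : κ = γ / 2 * (1 - l2)) (hκ0 : 0 < κ)
    (hκγ : κ ≤ γ) (hα : 0 < α) (hα1 : α ≤ 1) (hαC : α * C = 1 / 12)
    (hγ : 648 * γ ^ 2 * C ≤ κ * α ^ 2) (hγ4 : γ ≤ 1 / 4) (hl : l2 < 1)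
    (hY : Y = X - S - η • (Gr + N)) :
    lyapunov γ α C v lam j₀ (Y - mixLap W γ (Y + e)) (S + mixLap W γ (Y + e) + δ)
        ((1 - α) • (T + η • (Gr + N)) + α • e + S + (2 : ℝ) • mixLap W γ (Y + e) + δ)
      ≤ (1 - κ / 4) * lyapunov γ α C v lam j₀ X S T + 6 / κ * η ^ 2 * sumSq Gr
        + 2 * η ^ 2 * sumSq N + 6 / κ ^ 2 * sumSq δ := by
  have hγ0 : 0 < γ := hκ0.trans_le hκγ
  have hC : 0 < C := by
    have : 0 < α * C := by rw [hαC]; norm_num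
    exact pos_of_mul_pos_right this hα.le
  have hV := hB.energy_step (η := η) (δ := δ) hκ hκ0 hγ0 (by linarith) hY
    (fun i i' => h.N_orth i _ (h.X_mem i')) (fun i i' => h.N_orth i _ (h.Gr_mem i'))
    (fun i i' => h.e_orth i _ (h.le (h.S_mem i')))
  have hT := hB.tracking_step (e := e) hκ hκ0 hγ0 hγ4 hα hα1 hY
    (fun i i' => h.N_orth i _ (h.Gr_mem i')) h.sum_S h.sum_δ h.e_orth (fun i => h.le (h.X_mem i))
    (fun i => h.le (h.S_mem i)) (fun i => h.le (h.T_mem i)) (fun i => h.le (h.Gr_mem i))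
    h.N_mem (fun i => h.le (h.δ_mem i))
  have hτ : sumSq (T + η • (Gr + N)) ≤ (1 + α / 4) * sumSq T + 5 / α * η ^ 2 * sumSq Gr
      + η ^ 2 * sumSq N := by
    -- The noise is split off by orthogonality before Young's inequality, so it enters with η² and
    -- without a factor 1/α.
    have e1 : T + η • (Gr + N) = (T + η • Gr) + η • N := by module
    rw [e1, sumSq_add_of_inner_eq_zero, sumSq_smul]
    · have h1 := sumSq_add_le_young T (η • Gr) (t := α / 4) (by positivity)
      rw [sumSq_smul] at h1
      have h2 : (1 + 1 / (α / 4)) ≤ 5 / α := by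
        rw [show 1 + 1 / (α / 4) = (α + 4) / α by field_simp]
        gcongr
        linarith
      have h3 := mul_le_mul_of_nonneg_right h2
        (mul_nonneg (sq_nonneg η) (sumSq_nonneg Gr))
      linarith
    · intro i
      rw [Pi.smul_apply, real_inner_smul_left, h.N_orth i ((T + η • Gr) i)
        (K.add_mem (h.T_mem i) (K.smul_mem _ (h.Gr_mem i))), mul_zero]
  exact lyapunov_arith hκ0 hκγ hα hα1 hαC hγ (hB.energy_nonneg hγ0 (by linarith) hl X S)
    (sumSq_nonneg T) (sumSq_nonneg Gr) (sumSq_nonneg N) (sumSq_nonneg δ) (sumSq_nonneg _)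
    hV hT h.e_sq hτ

end IsErrorIteration

end CEDAS

end

noncomputable section

namespace CEDAS

/-! ### Scalar recursions -/

/-- Comparison with a slowly decreasing sequence `Ψ`, where the contraction is perturbed by a
summable sequence `ε`. -/
theorem le_of_perturbed_recursion {Φ Ψ x y ε : ℕ → ℝ} {a b : ℝ} (hΦ : ∀ k, 0 ≤ Φ k)
    (hΨ : ∀ k, 0 ≤ Ψ k) (hy : ∀ k, 0 ≤ y k) (hε : ∀ k, 0 ≤ ε k) (hx : ∀ k, x k ≤ 1 / 2)
    (ha : 0 ≤ a) (hab : a ≤ b) (h0 : Φ 0 ≤ b * Ψ 0)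
    (h1 : ∀ k, Φ (k + 1) ≤ (1 - x k + ε k) * Φ k + a * y k * Ψ k)
    (h2 : ∀ k, (1 - x k + y k) * Ψ k ≤ Ψ (k + 1)) (k : ℕ) :
    Φ k ≤ b * (∏ j ∈ Finset.range k, (1 + 2 * ε j)) * Ψ k := by
  have hb : 0 ≤ b := ha.trans hab
  induction k with
  | zero => simpa using h0
  | succ k ih =>
    set p := ∏ j ∈ Finset.range k, (1 + 2 * ε j) with hp
    have hp1 : 1 ≤ p := by
      rw [hp]
      exact Finset.prod_induction _ (fun t : ℝ => 1 ≤ t) (fun _ _ => one_le_mul_of_one_le_of_one_le)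
        le_rfl fun j _ => by linarith [hε j]
    rw [Finset.prod_range_succ, ← hp]
    have hq : 1 ≤ p * (1 + 2 * ε k) := one_le_mul_of_one_le_of_one_le hp1 (by linarith [hε k])
    -- As the contraction rate is at most 1/2, an additive perturbation becomes a multiplicative
    -- one, which the product collects.
    have hc : 1 - x k + ε k ≤ (1 - x k) * (1 + 2 * ε k) := by nlinarith [hε k, hx k]
    have s1 : (1 - x k + ε k) * Φ k ≤ (1 - x k) * (1 + 2 * ε k) * (b * p * Ψ k) :=
      mul_le_mul hc ih (hΦ k) (mul_nonneg (by linarith [hx k]) (by linarith [hε k]))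
    have s2 : a * y k * Ψ k ≤ b * (p * (1 + 2 * ε k)) * (y k * Ψ k) := by
      have t1 : a ≤ b * (p * (1 + 2 * ε k)) :=
        hab.trans (le_mul_of_one_le_right hb hq)
      have := mul_le_mul_of_nonneg_right t1 (mul_nonneg (hy k) (hΨ k))
      linarith
    have s3 := mul_le_mul_of_nonneg_left (h2 k)
      (mul_nonneg hb (zero_le_one.trans hq))
    linarith [h1 k]

/-- The sum of the 1/(m + j)² telescopes to at most 2/m, and κm ≥ 4 makes the bound on the product
independent of `κ` and `m`. -/
theorem prod_one_add_le_exp {m A κ : ℝ} (hm : 2 ≤ m) (hA : 0 ≤ A) (hκ : 0 < κ)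
    (hκm : 4 ≤ κ * m) (k : ℕ) :
    ∏ j ∈ Finset.range k, (1 + 2 * (A / (κ * (m + j) ^ 2))) ≤ Real.exp A := by
  have hsum : ∀ k : ℕ, ∑ j ∈ Finset.range k, 1 / (m + j) ^ 2 ≤ 1 / (m - 1) - 1 / (m - 1 + k) := by
    intro k
    induction k with
    | zero => simp
    | succ k ih =>
      rw [Finset.sum_range_succ]
      have h1 : (0 : ℝ) < m - 1 + k := by linarith [k.cast_nonneg (α := ℝ)]
      have h2 : 1 / (m + k) ^ 2 ≤ 1 / (m - 1 + k) - 1 / (m - 1 + (k + 1 : ℕ)) := by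
        push_cast
        rw [div_sub_div _ _ h1.ne' (by linarith), div_le_div_iff₀ (by nlinarith) (by nlinarith)]
        nlinarith
      linarith
  have h1 : ∏ j ∈ Finset.range k, (1 + 2 * (A / (κ * (m + j) ^ 2)))
      ≤ ∏ j ∈ Finset.range k, Real.exp (2 * (A / (κ * (m + j) ^ 2))) := by
    refine Finset.prod_le_prod (fun j _ => by positivity) fun j _ => ?_
    rw [add_comm]
    exact Real.add_one_le_exp _
  refine h1.trans ?_
  rw [← Real.exp_sum, Real.exp_le_exp]
  have h2 : ∑ j ∈ Finset.range k, 2 * (A / (κ * (m + j) ^ 2))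
      = 2 * A / κ * ∑ j ∈ Finset.range k, 1 / (m + j) ^ 2 := by
    rw [Finset.mul_sum]
    refine Finset.sum_congr rfl fun j _ => ?_
    field_simp
  have h3 : ∑ j ∈ Finset.range k, 1 / (m + j) ^ 2 ≤ 2 / m := by
    refine (hsum k).trans ?_
    have : (0 : ℝ) ≤ 1 / (m - 1 + k) := by
      have : (0 : ℝ) ≤ k := k.cast_nonneg
      have : 0 ≤ m - 1 + k := by linarith
      positivity
    have h4 : 1 / (m - 1) ≤ 2 / m := by
      rw [div_le_div_iff₀ (by linarith) (by linarith)]; linarith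
    linarith
  rw [h2]
  calc 2 * A / κ * ∑ j ∈ Finset.range k, 1 / (m + j) ^ 2 ≤ 2 * A / κ * (2 / m) := by gcongr
    _ = 4 / (κ * m) * A := by ring
    _ ≤ 1 * A := by
        gcongr
        rw [div_le_one (by linarith)]
        exact hκm
    _ = A := one_mul A

/-- A power τ^(-p) decreases no faster than the factor 1 - p/τ allows, because (1 + 1/τ)^p ≤ e^(p/τ)
and 1 - p/τ ≤ e^(-p/τ). Smaller powers decrease more slowly still, so the envelope is compatible
with the rate ρ/τ whenever ρ ≥ 4. -/
theorem one_sub_mul_rpow_le {c τ p : ℝ} (hc : 0 ≤ c) (hτ : 0 < τ) (hp : 0 ≤ p) :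
    (1 - p / τ) * (c / τ) ^ p ≤ (c / (τ + 1)) ^ p := by
  have h1 : c / (τ + 1) = c / τ * (τ / (τ + 1)) := by field_simp
  rw [h1, Real.mul_rpow (by positivity) (by positivity), mul_comm]
  refine mul_le_mul_of_nonneg_left ?_ (by positivity)
  have h2 : (1 + 1 / τ) ^ p ≤ Real.exp (p / τ) := by
    calc (1 + 1 / τ) ^ p ≤ (Real.exp (1 / τ)) ^ p := by
          gcongr
          rw [add_comm]
          exact Real.add_one_le_exp _
      _ = Real.exp (p / τ) := by rw [← Real.exp_mul]; congr 1; ring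
  have h3 : τ / (τ + 1) = (1 + 1 / τ)⁻¹ := by field_simp
  rw [h3, Real.inv_rpow (by positivity)]
  have h4 : 1 - p / τ ≤ (Real.exp (p / τ))⁻¹ := by
    rw [← Real.exp_neg]
    linarith [Real.add_one_le_exp (-(p / τ))]
  exact h4.trans (inv_anti₀ (by positivity) h2)

theorem one_sub_mul_pow_le {c τ p : ℝ} (d : ℕ) (hc : 0 ≤ c) (hτ : 0 < τ) (hp : d ≤ p) :
    (1 - p / τ) * (c / τ) ^ d ≤ (c / (τ + 1)) ^ d := by
  have h := one_sub_mul_rpow_le hc hτ (Nat.cast_nonneg (α := ℝ) d)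
  rw [Real.rpow_natCast, Real.rpow_natCast] at h
  refine le_trans ?_ h
  gcongr

/-- The envelope of the errors at time `τ = m + k`. -/
def envelope (n κ m ρ Z τ : ℝ) : ℝ :=
  1 / n * (1 / τ) ^ 1 + 1 / κ * (1 / τ) ^ 2 + n ^ 2 / κ ^ 3 * (1 / τ) ^ 4 + Z * (m / τ) ^ ρ

theorem envelope_step {n κ m ρ Z τ : ℝ} (hn : 0 < n) (hκ : 0 < κ) (hm : 0 < m) (hρ : 4 ≤ ρ)
    (hZ : 0 ≤ Z) (hτ : 0 < τ) :
    (1 - ρ / τ) * envelope n κ m ρ Z τ ≤ envelope n κ m ρ Z (τ + 1) := by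
  have h1 := one_sub_mul_pow_le (p := ρ) 1 zero_le_one hτ (by push_cast; linarith)
  have h2 := one_sub_mul_pow_le (p := ρ) 2 zero_le_one hτ (by push_cast; linarith)
  have h3 := one_sub_mul_pow_le (p := ρ) 4 zero_le_one hτ (by push_cast; linarith)
  have h4 := one_sub_mul_rpow_le (p := ρ) hm.le hτ (by linarith)
  have k1 := mul_le_mul_of_nonneg_left h1 (show 0 ≤ 1 / n by positivity)
  have k2 := mul_le_mul_of_nonneg_left h2 (show 0 ≤ 1 / κ by positivity)
  have k3 := mul_le_mul_of_nonneg_left h3 (show 0 ≤ n ^ 2 / κ ^ 3 by positivity)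
  have k4 := mul_le_mul_of_nonneg_left h4 hZ
  unfold envelope
  linarith

theorem envelope_nonneg {n κ m ρ Z τ : ℝ} (hn : 0 < n) (hκ : 0 < κ) (hm : 0 < m)
    (hZ : 0 ≤ Z) (hτ : 0 < τ) : 0 ≤ envelope n κ m ρ Z τ := by
  unfold envelope
  positivity

/-- `V` decays at rate `κ`, much faster than `R`. The combination R + (B/(κτ))V therefore behaves
like `R` alone, with rate 7θ/(4τ) against 3θ/(2τ) for the envelope; the gap θ/(4τ) absorbs the
sources. Once `R` is bounded by the envelope, it acts in the recursion for `V` as one more source,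
and `V` is compared with the same envelope. -/
theorem coupled_recursion (θ a : ℝ) (hθ : 18 < θ) (ha : 0 ≤ a) :
    ∃ b : ℝ, 0 ≤ b ∧ ∀ (n κ m Z : ℝ) (R V : ℕ → ℝ), 0 < n → 0 < κ → κ ≤ 1 → 16 * θ ≤ κ * m →
      (∀ k, 0 ≤ R k) → (∀ k, 0 ≤ V k) → R 0 + V 0 ≤ Z →
      (∀ k : ℕ, R (k + 1) ≤ (1 - 7 / 4 * θ / (m + k) + a / (m + k) ^ 2) * R k
        + a / (m + k) * V k + a / (n * (m + k) ^ 2)) →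
      (∀ k : ℕ, V (k + 1) ≤ (1 - κ / 4 + a / (κ * (m + k) ^ 2)) * V k
        + a / (κ * (m + k) ^ 2) * R k + a / (m + k) ^ 2 + a * n ^ 2 / (κ ^ 2 * (m + k) ^ 4)) →
      ∀ k : ℕ, R k + V k ≤ b * envelope n κ m (3 / 2 * θ) Z (m + k) := by
  -- Chosen so that the coupling a/τ costs only κ/8 of the decay of the weighted `V`, since κ/8 ·
  -- B/(κτ) = B/(8τ) ≥ a/τ.
  set B : ℝ := 8 * a + 1 with hB
  set A₁ : ℝ := a + a * B with hA₁
  set a₁ : ℝ := 4 * a * (1 + B) with ha₁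
  set b₁ : ℝ := (a₁ + B + 1) * Real.exp A₁ with hb₁
  set a₂ : ℝ := 8 * a * (b₁ + 1) with ha₂
  set b₂ : ℝ := (a₂ + 1) * Real.exp a with hb₂
  have hB0 : 0 < B := by positivity
  have hb₁0 : 0 ≤ b₁ := by positivity
  refine ⟨b₁ + b₂, by positivity, ?_⟩
  intro n κ m Z R V hn hκ hκ1 hκm hR hV hZ hRs hVs k
  have hm : 16 * θ ≤ m := hκm.trans (mul_le_of_le_one_left (by
    by_contra hneg
    push Not at hneg
    nlinarith) hκ1)
  have hm0 : 0 < m := by linarith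
  have hτ : ∀ k : ℕ, 0 < m + (k : ℝ) := fun k => by positivity
  have hτm : ∀ k : ℕ, m ≤ m + (k : ℝ) := fun k => by linarith [k.cast_nonneg (α := ℝ)]
  have hκτ : ∀ k : ℕ, 16 * θ ≤ κ * (m + (k : ℝ)) := fun k =>
    hκm.trans (mul_le_mul_of_nonneg_left (hτm k) hκ.le)
  have hZ0 : 0 ≤ Z := by linarith [hR 0, hV 0]
  set Ψ : ℕ → ℝ := fun k => envelope n κ m (3 / 2 * θ) Z (m + k) with hΨ
  have hΨ0 : ∀ k, 0 ≤ Ψ k := fun k => envelope_nonneg hn hκ hm0 hZ0 (hτ k)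
  have hΨs : ∀ k : ℕ, (1 - 3 / 2 * θ / (m + k)) * Ψ k ≤ Ψ (k + 1) := fun k => by
    have := envelope_step (ρ := 3 / 2 * θ) hn hκ hm0 (by linarith) hZ0 (hτ k)
    simp only [hΨ]
    push_cast
    rwa [← add_assoc]
  have hΨZ : Z ≤ Ψ 0 := by
    simp only [hΨ, envelope, Nat.cast_zero, add_zero, div_self hm0.ne', Real.one_rpow, mul_one]
    have : 0 ≤ 1 / n * (1 / m) ^ 1 + 1 / κ * (1 / m) ^ 2 + n ^ 2 / κ ^ 3 * (1 / m) ^ 4 := by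
      positivity
    linarith
  have hΨp : ∀ k : ℕ, 1 / (n * (m + k)) + 1 / (κ * (m + k) ^ 2) + n ^ 2 / (κ ^ 3 * (m + k) ^ 4)
      ≤ Ψ k := fun k => by
    have h1 : 0 ≤ Z * (m / (m + k)) ^ (3 / 2 * θ) := by have := hτ k; positivity
    have h2 : Ψ k = 1 / (n * (m + k)) + 1 / (κ * (m + k) ^ 2) + n ^ 2 / (κ ^ 3 * (m + k) ^ 4)
        + Z * (m / (m + k)) ^ (3 / 2 * θ) := by
      have := (hτ k).ne'
      simp only [hΨ, envelope]
      field_simp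
    linarith
  -- the averaged iterate
  have first : ∀ k : ℕ, R k + B / (κ * (m + k)) * V k
      ≤ (a₁ + B + 1) * (∏ j ∈ Finset.range k, (1 + 2 * (A₁ / (κ * (m + j) ^ 2)))) * Ψ k := by
    refine le_of_perturbed_recursion (a := a₁) (x := fun k : ℕ => 7 / 4 * θ / (m + k))
      (y := fun k : ℕ => 1 / 4 * θ / (m + k)) (ε := fun k : ℕ => A₁ / (κ * (m + k) ^ 2))
      (fun k => ?_) hΨ0 (fun k => ?_) (fun k => ?_) (fun k => ?_) (by positivity) (by linarith)
      ?_ (fun k => ?_) (fun k => ?_)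
    · have := hτ k; have := hR k; have := hV k; positivity
    · have := hτ k; positivity
    · have := hτ k; positivity
    · show 7 / 4 * θ / (m + k) ≤ 1 / 2
      rw [div_le_iff₀ (hτ k)]; linarith [hτm k]
    · have h1 : B / (κ * (m + (0 : ℕ))) * V 0 ≤ B * V 0 := by
        refine mul_le_mul_of_nonneg_right ?_ (hV 0)
        exact div_le_self hB0.le (by linarith [hκτ 0])
      have h2 : R 0 + B * V 0 ≤ (B + 1) * Z := by nlinarith [hR 0, hV 0]
      have h3 : (B + 1) * Z ≤ (a₁ + B + 1) * Ψ 0 := by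
        have : 0 ≤ a₁ := by positivity
        gcongr
        linarith
      linarith
    · set τ : ℝ := m + k with hτd
      have ht : 0 < τ := hτ k
      have htt : m + ((k + 1 : ℕ) : ℝ) = τ + 1 := by push_cast; ring
      rw [htt]
      have hkt : 16 * θ ≤ κ * τ := hκτ k
      have g1 : B / (κ * (τ + 1)) ≤ B / (κ * τ) := by gcongr; linarith
      have h1 : B / (κ * (τ + 1)) * V (k + 1) ≤ B / (κ * τ) * ((1 - κ / 4 + a / (κ * τ ^ 2)) * V k
          + a / (κ * τ ^ 2) * R k + a / τ ^ 2 + a * n ^ 2 / (κ ^ 2 * τ ^ 4)) :=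
        mul_le_mul g1 (hVs k) (hV _) (by positivity)
      have cR : a / τ ^ 2 + B / (κ * τ) * (a / (κ * τ ^ 2)) ≤ A₁ / (κ * τ ^ 2) := by
        have t1 : a / τ ^ 2 ≤ a / (κ * τ ^ 2) := by
          gcongr
          exact mul_le_of_le_one_left (by positivity) hκ1
        have t2 : B / (κ * τ) * (a / (κ * τ ^ 2)) ≤ B * (a / (κ * τ ^ 2)) := by
          gcongr
          exact div_le_self hB0.le (by linarith)
        have t3 : A₁ / (κ * τ ^ 2) = a / (κ * τ ^ 2) + B * (a / (κ * τ ^ 2)) := by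
          rw [hA₁]; ring
        linarith
      have cV : B / (κ * τ) * (1 - κ / 4 + a / (κ * τ ^ 2)) + a / τ
          ≤ (1 - 7 / 4 * θ / τ + A₁ / (κ * τ ^ 2)) * (B / (κ * τ)) := by
        have t1 : a / τ ≤ κ / 8 * (B / (κ * τ)) := by
          rw [show κ / 8 * (B / (κ * τ)) = (B / 8) / τ by field_simp]
          gcongr
          linarith
        -- The other half of the decay κ/4 covers the slow rate, as κτ ≥ 16θ ≥ 14θ.
        have t2 : 7 / 4 * θ / τ ≤ κ / 8 := by
          rw [div_le_iff₀ ht]; linarith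
        have t3 : a / (κ * τ ^ 2) ≤ A₁ / (κ * τ ^ 2) := by
          gcongr
          rw [hA₁]
          linarith [mul_nonneg ha hB0.le]
        have t4 : (1 - κ / 4 + a / (κ * τ ^ 2)) + κ / 8
            ≤ 1 - 7 / 4 * θ / τ + A₁ / (κ * τ ^ 2) := by linarith
        have t5 := mul_le_mul_of_nonneg_right t4 (show 0 ≤ B / (κ * τ) by positivity)
        linarith
      have cN : a / (n * τ ^ 2) + B / (κ * τ) * (a / τ ^ 2 + a * n ^ 2 / (κ ^ 2 * τ ^ 4))
          ≤ a₁ * (1 / 4 * θ / τ) * Ψ k := by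
        have t1 : a / (n * τ ^ 2) + B / (κ * τ) * (a / τ ^ 2 + a * n ^ 2 / (κ ^ 2 * τ ^ 4))
            ≤ a * (1 + B) / τ * (1 / (n * τ) + 1 / (κ * τ ^ 2) + n ^ 2 / (κ ^ 3 * τ ^ 4)) := by
          have e1 : a * (1 + B) / τ * (1 / (n * τ) + 1 / (κ * τ ^ 2) + n ^ 2 / (κ ^ 3 * τ ^ 4))
            = (a / (n * τ ^ 2) + B / (κ * τ) * (a / τ ^ 2 + a * n ^ 2 / (κ ^ 2 * τ ^ 4)))
              + (a * B / (n * τ ^ 2) + a / (κ * τ ^ 3) + a * n ^ 2 / (κ ^ 3 * τ ^ 5)) := by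
            field_simp
            ring
          rw [e1]
          have : 0 ≤ a * B / (n * τ ^ 2) + a / (κ * τ ^ 3) + a * n ^ 2 / (κ ^ 3 * τ ^ 5) := by
            positivity
          linarith
        have t2 : a * (1 + B) / τ ≤ a₁ * (1 / 4 * θ / τ) := by
          rw [show a₁ * (1 / 4 * θ / τ) = a * (1 + B) * θ / τ by rw [ha₁]; ring]
          refine div_le_div_of_nonneg_right ?_ ht.le
          exact le_mul_of_one_le_right (by positivity) (by linarith)
        exact t1.trans (mul_le_mul t2 (hΨp k) (by positivity) (by positivity))
      have fR := mul_le_mul_of_nonneg_right cR (hR k)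
      have fV := mul_le_mul_of_nonneg_right cV (hV k)
      have := hRs k
      simp only [← hτd] at this
      linarith
    · refine le_trans (le_of_eq ?_) (hΨs k)
      ring
  have hR' : ∀ k, R k ≤ b₁ * Ψ k := by
    intro k
    have h1 := prod_one_add_le_exp (A := A₁) (by linarith : 2 ≤ m) (by positivity) hκ
      (by linarith) k
    have h2 : 0 ≤ B / (κ * (m + k)) * V k := by have := hτ k; have := hV k; positivity
    have h3 : (a₁ + B + 1) * (∏ j ∈ Finset.range k, (1 + 2 * (A₁ / (κ * (m + j) ^ 2)))) * Ψ k
        ≤ b₁ * Ψ k := by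
      rw [hb₁]
      have := hΨ0 k
      gcongr
    linarith [first k]
  have hV' : V k ≤ b₂ * Ψ k := by
    have h : V k ≤ (a₂ + 1) * (∏ j ∈ Finset.range k, (1 + 2 * (a / (κ * (m + j) ^ 2)))) * Ψ k := by
      refine le_of_perturbed_recursion (a := a₂) (x := fun _ => κ / 4) (y := fun _ => κ / 8)
        (ε := fun k : ℕ => a / (κ * (m + k) ^ 2)) hV hΨ0 (fun k => by positivity) (fun k => ?_)
        (fun k => by linarith) (by positivity) (by linarith) ?_ (fun k => ?_) (fun k => ?_) k
      · have := hτ k; positivity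
      · have h3 : 0 ≤ a₂ * Ψ 0 := mul_nonneg (by positivity) (hΨ0 0)
        linarith [hR 0]
      · set τ : ℝ := m + k with hτd
        have ht : 0 < τ := hτ k
        have hkt : 1 ≤ κ * τ := by linarith [hκτ k]
        have h1 := hVs k
        simp only [← hτd] at h1
        -- Since κτ ≥ 1, the coupling from `R` is of the order of the contraction gap κ/8, which is
        -- what the comparison demands.
        have t0 : 1 / (κ * τ ^ 2) ≤ κ := by
          rw [div_le_iff₀ (by positivity), show κ * (κ * τ ^ 2) = (κ * τ) ^ 2 by ring]
          exact one_le_pow₀ hkt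
        have t1 : a / (κ * τ ^ 2) * R k ≤ a * b₁ * κ * Ψ k := by
          calc a / (κ * τ ^ 2) * R k = a * (1 / (κ * τ ^ 2)) * R k := by ring
            _ ≤ a * κ * (b₁ * Ψ k) := by
              have := hR' k
              have := hR k
              gcongr
            _ = _ := by ring
        have t2 : a / τ ^ 2 + a * n ^ 2 / (κ ^ 2 * τ ^ 4) ≤ a * κ * Ψ k := by
          have e1 : a / τ ^ 2 + a * n ^ 2 / (κ ^ 2 * τ ^ 4)
              = a * κ * (1 / (κ * τ ^ 2) + n ^ 2 / (κ ^ 3 * τ ^ 4)) := by field_simp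
          rw [e1]
          have := hΨp k
          have : 0 ≤ 1 / (n * τ) := by positivity
          gcongr
          linarith
        have e2 : a₂ * (κ / 8) * Ψ k = a * b₁ * κ * Ψ k + a * κ * Ψ k := by rw [ha₂]; ring
        rw [e2]
        linarith
      · have h1 : 3 / 2 * θ / (m + k) ≤ κ / 8 := by
          rw [div_le_iff₀ (hτ k)]; linarith [hκτ k]
        refine le_trans ?_ (hΨs k)
        exact mul_le_mul_of_nonneg_right (by linarith) (hΨ0 k)
    refine h.trans ?_
    have h1 := prod_one_add_le_exp (A := a) (by linarith : 2 ≤ m) ha hκ (by linarith) k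
    rw [hb₂]
    have := hΨ0 k
    gcongr
  linarith [hR' k]

end CEDAS

end

noncomputable section

namespace CEDAS

/-! ### Probabilistic tools -/

section Probability

variable {Ω : Type*} {m mΩ : MeasurableSpace Ω} {P : Measure Ω} [IsProbabilityMeasure P]

theorem generateFrom_inter_preimage {Ω Ξ : Type*} [mΞ : MeasurableSpace Ξ] (m : MeasurableSpace Ω)
    (a : Ω → Ξ) :
    m ⊔ mΞ.comap a = MeasurableSpace.generateFrom
      {B | ∃ F S, MeasurableSet[m] F ∧ MeasurableSet S ∧ B = F ∩ a ⁻¹' S} := by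
  apply le_antisymm
  · refine sup_le (fun F hF => ?_) ?_
    · exact MeasurableSpace.measurableSet_generateFrom
        ⟨F, Set.univ, hF, MeasurableSet.univ, by simp⟩
    · rintro _ ⟨S, hS, rfl⟩
      exact MeasurableSpace.measurableSet_generateFrom
        ⟨Set.univ, S, @MeasurableSet.univ _ m, hS, by simp⟩
  · refine MeasurableSpace.generateFrom_le ?_
    rintro _ ⟨F, S, hF, hS, rfl⟩
    exact MeasurableSet.inter ((le_sup_left : m ≤ m ⊔ mΞ.comap a) _ hF)
      ((le_sup_right : mΞ.comap a ≤ m ⊔ mΞ.comap a) _ ⟨S, hS, rfl⟩)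

/-- A π-λ argument: the sets F ∩ a⁻¹(S) are stable under intersection and generate the joined
σ-algebra. -/
theorem setIntegral_eq_zero_of_sup_comap {Ξ G : Type*} [mΞ : MeasurableSpace Ξ]
    [NormedAddCommGroup G] [NormedSpace ℝ G] (hm : m ≤ mΩ) {a : Ω → Ξ}
    (ha : Measurable a) {f : Ω → G} (hf : Integrable f P)
    (h : ∀ F S, MeasurableSet[m] F → MeasurableSet S → ∫ ω in F ∩ a ⁻¹' S, f ω ∂P = 0)
    (A : Set Ω) (hA : MeasurableSet[m ⊔ mΞ.comap a] A) : ∫ ω in A, f ω ∂P = 0 := by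
  have hle : m ⊔ mΞ.comap a ≤ mΩ := sup_le hm ha.comap_le
  have htot : ∫ ω, f ω ∂P = 0 := by
    have := h Set.univ Set.univ (@MeasurableSet.univ _ m) MeasurableSet.univ
    simpa using this
  induction A, hA using MeasurableSpace.induction_on_inter (generateFrom_inter_preimage m a) with
  | h_inter =>
    rintro _ ⟨F, S, hF, hS, rfl⟩ _ ⟨F', S', hF', hS', rfl⟩ -
    refine ⟨F ∩ F', S ∩ S', @MeasurableSet.inter _ m _ _ hF hF', hS.inter hS', ?_⟩
    rw [Set.preimage_inter]
    exact Set.inter_inter_inter_comm _ _ _ _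
  | empty => simp
  | basic t ht =>
    obtain ⟨F, S, hF, hS, rfl⟩ := ht
    exact h F S hF hS
  | compl t ht ih =>
    have := integral_add_compl (hle _ ht) hf
    rw [ih, htot, zero_add] at this
    exact this
  | iUnion t hd ht ih =>
    rw [integral_iUnion (fun i => hle _ (ht i)) hd hf.integrableOn]
    simp [ih]

variable {V : Type*} [NormedAddCommGroup V] [InnerProductSpace ℝ V]

theorem integrable_inner_of_memLp {f g : Ω → V} (hf : MemLp f 2 P) (hg : MemLp g 2 P) :
    Integrable (fun ω => inner ℝ (f ω) (g ω)) P := by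
  have := L2.integrable_inner (𝕜 := ℝ) (hf.toLp f) (hg.toLp g)
  refine this.congr ?_
  filter_upwards [hf.coeFn_toLp, hg.coeFn_toLp] with ω h1 h2
  rw [h1, h2]

/-- The `m`-measurable factor is pulled out of the conditional expectation of the inner product. -/
theorem integral_inner_eq_zero_of_condExp_eq_zero [CompleteSpace V]
    (hm : m ≤ mΩ) {f g : Ω → V} (hf : MemLp f 2 P) (hg : MemLp g 2 P)
    (hgm : AEStronglyMeasurable[m] g P)
    (h0 : P[f | m] =ᵐ[P] 0) : ∫ ω, inner ℝ (f ω) (g ω) ∂P = 0 := by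
  have hi := integrable_inner_of_memLp hf hg
  have h1 := condExp_bilin_of_aestronglyMeasurable_right (innerSL ℝ) hgm hi
    (hf.integrable one_le_two)
  rw [← integral_condExp hm]
  have h2 : P[fun ω => inner ℝ (f ω) (g ω) | m] =ᵐ[P] 0 := by
    refine h1.trans ?_
    filter_upwards [h0] with ω hω
    rw [hω]
    simp
  rw [integral_congr_ae h2]
  simp

/-- Functions of conditionally independent samples are orthogonal as soon as one of them is
conditionally centered. -/
theorem integral_inner_eq_zero_of_condIndep [CompleteSpace V] {Ξ : Type*} [mΞ : MeasurableSpace Ξ]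
    (hm : m ≤ mΩ) {a b : Ω → Ξ} (ha : Measurable a) (hb : Measurable b)
    (hab : ∀ S T, MeasurableSet S → MeasurableSet T →
      P[(a ⁻¹' S ∩ b ⁻¹' T).indicator (fun _ => (1 : ℝ)) | m] =ᵐ[P]
        P[(a ⁻¹' S).indicator (fun _ => (1 : ℝ)) | m]
          * P[(b ⁻¹' T).indicator (fun _ => (1 : ℝ)) | m])
    {f g : Ω → V} (hf : MemLp f 2 P) (hg : MemLp g 2 P)
    (hfm : AEStronglyMeasurable[m ⊔ mΞ.comap a] f P)
    (hgm : AEStronglyMeasurable[m ⊔ mΞ.comap b] g P)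
    (h0 : P[g | m] =ᵐ[P] 0) : ∫ ω, inner ℝ (f ω) (g ω) ∂P = 0 := by
  have hla : m ⊔ mΞ.comap a ≤ mΩ := sup_le hm ha.comap_le
  have hlb : m ⊔ mΞ.comap b ≤ mΩ := sup_le hm hb.comap_le
  have hind : ∀ {A : Set Ω}, MeasurableSet A → Integrable (A.indicator fun _ => (1 : ℝ)) P :=
    fun hA => (integrable_const 1).indicator hA
  have hgi : Integrable g P := hg.integrable one_le_two
  -- conditioning `a` on more than `m` has no effect
  have hcond : ∀ S, MeasurableSet S →
      P[(a ⁻¹' S).indicator (fun _ => (1 : ℝ)) | m ⊔ mΞ.comap b] =ᵐ[P]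
        P[(a ⁻¹' S).indicator (fun _ => (1 : ℝ)) | m] := by
    intro S hS
    set u : Ω → ℝ := (a ⁻¹' S).indicator fun _ => (1 : ℝ) with hu
    have hui : Integrable u P := hind (ha hS)
    set w : Ω → ℝ := P[u | m] with hw
    have hwi : Integrable w P := integrable_condExp
    have hwm : AEStronglyMeasurable[m] w P := stronglyMeasurable_condExp.aestronglyMeasurable
    have hz := setIntegral_eq_zero_of_sup_comap (P := P) hm hb (hui.sub hwi) (by
      intro F T hF hT
      set t : Ω → ℝ := (b ⁻¹' T).indicator fun _ => (1 : ℝ) with ht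
      have hti : Integrable t P := hind (hb hT)
      have e1 : ∫ ω in F ∩ b ⁻¹' T, u ω ∂P = ∫ ω in F, (w * P[t | m]) ω ∂P := by
        rw [← setIntegral_congr_ae (hm _ hF) ((hab S T hS hT).mono fun ω h _ => h),
          setIntegral_condExp hm (hind ((ha hS).inter (hb hT))) hF, ← setIntegral_indicator (hb hT)]
        congr 1
        funext ω
        simp only [hu, Set.indicator]
        by_cases h1 : ω ∈ a ⁻¹' S <;> by_cases h2 : ω ∈ b ⁻¹' T <;> simp [h1, h2]
      have hwt : Integrable (w * t) P := by
        have : w * t = (b ⁻¹' T).indicator w := by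
          funext ω
          simp only [ht, Set.indicator, Pi.mul_apply]
          split_ifs <;> simp
        rw [this]
        exact hwi.indicator (hb hT)
      have e2 : ∫ ω in F ∩ b ⁻¹' T, w ω ∂P = ∫ ω in F, (w * P[t | m]) ω ∂P := by
        rw [← setIntegral_congr_ae (hm _ hF)
          ((condExp_mul_of_aestronglyMeasurable_left hwm hwt hti).mono fun ω h _ => h),
          setIntegral_condExp hm hwt hF, ← setIntegral_indicator (hb hT)]
        congr 1
        funext ω
        simp only [ht, Set.indicator, Pi.mul_apply]
        split_ifs <;> simp
      simp only [Pi.sub_apply]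
      rw [integral_sub hui.integrableOn hwi.integrableOn, e1, e2, sub_self])
    refine (ae_eq_condExp_of_forall_setIntegral_eq hlb hui (fun A _ _ => hwi.integrableOn)
      (fun A hA _ => ?_) (hwm.mono le_sup_left)).symm
    have := hz A hA
    simp only [Pi.sub_apply] at this
    rw [integral_sub hui.integrableOn hwi.integrableOn] at this
    linarith
  -- The independent sample `a` must not destroy the centering of `g`. On generating sets,
  -- conditioning first on `m` and `b` replaces the indicator of `a` by its `m`-conditional
  -- probability `w`; conditioning then on `m` leaves `w` times the conditional mean of `g`, which
  -- is zero. No regular conditional distribution is involved.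
  have hcentered : P[g | m ⊔ mΞ.comap a] =ᵐ[P] 0 := by
    refine (ae_eq_condExp_of_forall_setIntegral_eq hla hgi
      (fun A _ _ => (integrable_zero Ω V P).integrableOn) (fun A hA _ => ?_)
      aestronglyMeasurable_zero).symm
    rw [setIntegral_eq_zero_of_sup_comap hm ha hgi _ A hA]
    · simp
    intro F S hF hS
    set u : Ω → ℝ := (a ⁻¹' S).indicator fun _ => (1 : ℝ) with hu
    have hui : Integrable u P := hind (ha hS)
    set w : Ω → ℝ := P[u | m] with hw
    have hwm : AEStronglyMeasurable[m] w P := stronglyMeasurable_condExp.aestronglyMeasurable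
    have hug : Integrable (u • g) P := by
      have : u • g = (a ⁻¹' S).indicator g := by
        funext ω
        simp only [hu, Set.indicator, Pi.smul_apply']
        split_ifs <;> simp
      rw [this]
      exact hgi.indicator (ha hS)
    have hbd : ∀ᵐ ω ∂P, ‖w ω‖ ≤ 1 := by
      have h1 : 0 ≤ᵐ[P] w := condExp_nonneg (ae_of_all _ fun ω => by
        simp only [hu, Pi.zero_apply]; exact Set.indicator_nonneg (fun _ _ => zero_le_one) ω)
      have h2 : w ≤ᵐ[P] P[fun _ => (1 : ℝ) | m] := condExp_mono hui (integrable_const 1)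
        (ae_of_all _ fun ω => Set.indicator_le_self' (fun _ _ => zero_le_one) ω)
      rw [condExp_const hm] at h2
      filter_upwards [h1, h2] with ω h1 h2
      rw [Real.norm_eq_abs, abs_of_nonneg h1]
      exact h2
    have hwg : Integrable (w • g) P := hgi.bdd_smul 1 (hwm.mono hm) hbd
    have k1 : ∫ ω in F ∩ a ⁻¹' S, g ω ∂P = ∫ ω in F, (u • g) ω ∂P := by
      rw [← setIntegral_indicator (ha hS)]
      congr 1
      funext ω
      simp only [hu, Set.indicator, Pi.smul_apply']
      split_ifs <;> simp
    have k2 : P[u • g | m ⊔ mΞ.comap b] =ᵐ[P] w • g := by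
      refine (condExp_smul_of_aestronglyMeasurable_right hui hug hgm).trans ?_
      filter_upwards [hcond S hS] with ω hω
      have hω' : (P[u | m ⊔ mΞ.comap b]) ω = w ω := hω
      show (P[u | m ⊔ mΞ.comap b]) ω • g ω = w ω • g ω
      rw [hω']
    have k3 : P[w • g | m] =ᵐ[P] 0 := by
      refine (condExp_smul_of_aestronglyMeasurable_left hwm hwg hgi).trans ?_
      filter_upwards [h0] with ω hω
      show w ω • (P[g | m]) ω = 0
      rw [hω, Pi.zero_apply, smul_zero]
    rw [k1, ← setIntegral_condExp hlb hug (le_sup_left (a := m) _ hF),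
      setIntegral_congr_ae (hm _ hF) (k2.mono fun ω h _ => h),
      ← setIntegral_condExp hm hwg hF, setIntegral_congr_ae (hm _ hF) (k3.mono fun ω h _ => h)]
    simp
  have h := integral_inner_eq_zero_of_condExp_eq_zero hla hg hf hfm hcentered
  simpa only [real_inner_comm] using h

theorem lintegral_enorm_sq_eq {f : Ω → V} (hf : MemLp f 2 P) :
    ∫⁻ ω, ‖f ω‖ₑ ^ 2 ∂P = ENNReal.ofReal (‖hf.toLp f‖ ^ 2) := by
  have h1 : ‖hf.toLp f‖ ^ 2 = ∫ ω, ‖f ω‖ ^ 2 ∂P := by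
    rw [← real_inner_self_eq_norm_sq, L2.inner_def]
    refine integral_congr_ae ?_
    filter_upwards [hf.coeFn_toLp] with ω h
    rw [h, real_inner_self_eq_norm_sq]
  rw [h1, ofReal_integral_eq_lintegral_ofReal
    ((memLp_two_iff_integrable_sq_norm hf.1).1 hf) (ae_of_all _ fun _ => by positivity)]
  refine lintegral_congr fun ω => ?_
  rw [ENNReal.ofReal_pow (norm_nonneg _), ofReal_norm_eq_enorm]

theorem memLp_two_of_lintegral_lt_top {f : Ω → V} (hf : AEStronglyMeasurable f P)
    (h : ∫⁻ ω, ‖f ω‖ₑ ^ 2 ∂P < ∞) : MemLp f 2 P := by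
  rw [memLp_two_iff_integrable_sq_norm hf]
  refine ⟨(hf.norm.pow 2), ?_⟩
  unfold HasFiniteIntegral
  refine lt_of_le_of_lt (le_of_eq (lintegral_congr fun ω => ?_)) h
  simp

theorem inner_toLp_eq {f g : Ω → V} (hf : MemLp f 2 P) (hg : MemLp g 2 P) :
    inner ℝ (hf.toLp f) (hg.toLp g) = ∫ ω, inner ℝ (f ω) (g ω) ∂P := by
  rw [L2.inner_def]
  refine integral_congr_ae ?_
  filter_upwards [hf.coeFn_toLp, hg.coeFn_toLp] with ω h1 h2
  rw [h1, h2]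

end Probability

section Compression

variable {Ω Z : Type*} {m mΩ : MeasurableSpace Ω} [mZ : MeasurableSpace Z] {P : Measure Ω}
  [IsProbabilityMeasure P] {ν : Measure Z} [IsProbabilityMeasure ν] {p : ℕ} {C : ℝ}
  {Q : Vec p → Z → Vec p} {z : Ω → Z}

/-- Freezing: by independence the joint law of argument and compressor sample is a product, so the
variance bound for deterministic arguments is integrated over the law of `w`. -/
theorem IsUnbiasedCompressor.lintegral_error_le (hQ : IsUnbiasedCompressor C Q ν) (hC : 0 ≤ C)
    (hm : m ≤ mΩ) (hz : Measurable z) (hlaw : P.map z = ν) (hind : Indep (mZ.comap z) m P)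
    {w : Ω → Vec p} (hw : Measurable[m] w) :
    ∫⁻ ω, ‖Q (w ω) (z ω) - w ω‖ₑ ^ 2 ∂P ≤ ENNReal.ofReal C * ∫⁻ ω, ‖w ω‖ₑ ^ 2 ∂P := by
  have hw' : Measurable w := hw.mono hm le_rfl
  have hIF : IndepFun w z P := by
    rw [IndepFun_iff_Indep]
    exact indep_of_indep_of_le_left hind.symm hw.comap_le
  have hmap := (indepFun_iff_map_prod_eq_prod_map_map hw'.aemeasurable hz.aemeasurable).1 hIF
  rw [hlaw] at hmap
  have hF : Measurable fun x : Vec p × Z => ‖Q x.1 x.2 - x.1‖ₑ ^ 2 :=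
    ((hQ.measurable.sub measurable_fst).enorm).pow_const 2
  have h1 : ∫⁻ ω, ‖Q (w ω) (z ω) - w ω‖ₑ ^ 2 ∂P
      = ∫⁻ y, ∫⁻ c, ‖Q y c - y‖ₑ ^ 2 ∂ν ∂(P.map w) := by
    rw [← lintegral_prod _ hF.aemeasurable, ← hmap, lintegral_map hF (hw'.prodMk hz)]
  rw [h1, ← lintegral_map (f := fun y : Vec p => ‖y‖ₑ ^ 2) (measurable_enorm.pow_const 2) hw',
    ← lintegral_const_mul _ (measurable_enorm.pow_const 2)]
  refine lintegral_mono fun y => ?_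
  have hy : MemLp (fun c => Q y c - y) 2 ν := (hQ.square_integrable y).sub (memLp_const y)
  have h2 : ∫⁻ c, ‖Q y c - y‖ₑ ^ 2 ∂ν = ENNReal.ofReal (∫ c, ‖Q y c - y‖ ^ 2 ∂ν) := by
    rw [ofReal_integral_eq_lintegral_ofReal
      ((memLp_two_iff_integrable_sq_norm hy.1).1 hy) (ae_of_all _ fun _ => by positivity)]
    refine lintegral_congr fun c => ?_
    rw [ENNReal.ofReal_pow (norm_nonneg _), ofReal_norm_eq_enorm]
  rw [h2]
  refine (ENNReal.ofReal_le_ofReal (hQ.variance_le y)).trans (le_of_eq ?_)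
  rw [ENNReal.ofReal_mul hC, ENNReal.ofReal_pow (norm_nonneg _), ofReal_norm_eq_enorm]

theorem IsUnbiasedCompressor.memLp_error (hQ : IsUnbiasedCompressor C Q ν) (hC : 0 ≤ C)
    (hm : m ≤ mΩ) (hz : Measurable z) (hlaw : P.map z = ν) (hind : Indep (mZ.comap z) m P)
    {w : Ω → Vec p} (hw : Measurable[m] w) (hw2 : MemLp w 2 P) :
    MemLp (fun ω => Q (w ω) (z ω) - w ω) 2 P := by
  have hw' : Measurable w := hw.mono hm le_rfl
  refine memLp_two_of_lintegral_lt_top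
    (((hQ.measurable.comp (hw'.prodMk hz)).sub hw').aestronglyMeasurable) ?_
  refine (hQ.lintegral_error_le hC hm hz hlaw hind hw).trans_lt ?_
  rw [lintegral_enorm_sq_eq hw2, ← ENNReal.ofReal_mul hC]
  exact ENNReal.ofReal_lt_top

/-- Freezing again, now of the pair `(w, u)`: for fixed values the error integrates to zero against
a constant vector. -/
theorem IsUnbiasedCompressor.integral_inner_error (hQ : IsUnbiasedCompressor C Q ν)
    (hC : 0 ≤ C) (hm : m ≤ mΩ) (hz : Measurable z) (hlaw : P.map z = ν)
    (hind : Indep (mZ.comap z) m P) {w u : Ω → Vec p} (hw : Measurable[m] w) (hw2 : MemLp w 2 P)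
    (hu : Measurable[m] u) (hu2 : MemLp u 2 P) :
    ∫ ω, inner ℝ (Q (w ω) (z ω) - w ω) (u ω) ∂P = 0 := by
  have hw' : Measurable w := hw.mono hm le_rfl
  have hu' : Measurable u := hu.mono hm le_rfl
  have hwu : Measurable[m] fun ω => (w ω, u ω) := hw.prodMk hu
  have hwu' : Measurable fun ω => (w ω, u ω) := hw'.prodMk hu'
  have hIF : IndepFun (fun ω => (w ω, u ω)) z P := by
    rw [IndepFun_iff_Indep]
    exact indep_of_indep_of_le_left hind.symm hwu.comap_le
  have hmap := (indepFun_iff_map_prod_eq_prod_map_map hwu'.aemeasurable hz.aemeasurable).1 hIF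
  rw [hlaw] at hmap
  set F : (Vec p × Vec p) × Z → ℝ := fun x => inner ℝ (Q x.1.1 x.2 - x.1.1) x.1.2 with hFdef
  have hF : Measurable F :=
    ((hQ.measurable.comp ((measurable_fst.comp measurable_fst).prodMk measurable_snd)).sub
      (measurable_fst.comp measurable_fst)).inner (measurable_snd.comp measurable_fst)
  have hint : Integrable (fun ω => inner ℝ (Q (w ω) (z ω) - w ω) (u ω)) P :=
    integrable_inner_of_memLp (hQ.memLp_error hC hm hz hlaw hind hw hw2) hu2
  have hpair : Measurable fun ω => ((w ω, u ω), z ω) := hwu'.prodMk hz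
  have hFi : Integrable F ((P.map fun ω => (w ω, u ω)).prod ν) := by
    rw [← hmap, integrable_map_measure hF.aestronglyMeasurable hpair.aemeasurable]
    exact hint
  have h1 : ∫ ω, inner ℝ (Q (w ω) (z ω) - w ω) (u ω) ∂P
      = ∫ x, F x ∂((P.map fun ω => (w ω, u ω)).prod ν) := by
    rw [← hmap, integral_map hpair.aemeasurable hF.aestronglyMeasurable]
  rw [h1, integral_prod _ hFi]
  have h2 : ∀ x, ∫ c, F (x, c) ∂ν = 0 := by
    intro x
    have hi : Integrable (Q x.1) ν := (hQ.square_integrable x.1).integrable one_le_two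
    show ∫ c, inner ℝ (Q x.1 c - x.1) x.2 ∂ν = 0
    simp only [real_inner_comm x.2]
    rw [integral_inner (f := fun c => Q x.1 c - x.1) (hi.sub (integrable_const _)), integral_sub hi (integrable_const _),
      hQ.unbiased]
    simp
  simp [h2]

end Compression

end CEDAS

end

noncomputable section

namespace CEDAS

/-! ### Error variables of the algorithm -/

section Step

variable {n p : ℕ} {Z : Type*} {W : Matrix (Fin n) (Fin n) ℝ} {γ α : ℝ} {Q : Vec p → Z → Vec p}

/-- Error form of one iteration: `Y` and `e` are the error of the compressed vectors and the
compression error, `a` is the target direction of the corrections. -/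
theorem step_errors (hrow : ∀ i, ∑ j, W i j = 1) (η η' : ℝ) (g : Fin n → Vec p) (z : Fin n → Z)
    {S : State n p} (hhw : ∀ i, S.hw i = ∑ j, W i j • S.h j) (xs : Vec p) (a : Fin n → Vec p)
    {X S' T Δ Y e : Fin n → Vec p} (hX : X = fun i => S.x i - xs)
    (hS : S' = fun i => S.d i + η • a i) (hT : T = fun i => S.h i - S.x i + S' i)
    (hΔ : Δ = fun i => g i - a i) (hY : Y = X - S' - η • Δ)
    (he : e = fun i => Q ((-(T + η • Δ)) i) (z i) - (-(T + η • Δ)) i) :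
    (fun i => (step W γ α η g Q z S).x i - xs) = Y - mixLap W γ (Y + e) ∧
    (fun i => (step W γ α η g Q z S).d i + η' • a i)
      = S' + mixLap W γ (Y + e) + (fun i => (η' - η) • a i) ∧
    (fun i => (step W γ α η g Q z S).h i - (step W γ α η g Q z S).x i
        + ((step W γ α η g Q z S).d i + η' • a i))
      = (1 - α) • (T + η • Δ) + α • e + S' + (2 : ℝ) • mixLap W γ (Y + e)
        + (fun i => (η' - η) • a i) ∧
    ∀ i, (step W γ α η g Q z S).hw i = ∑ j, W i j • (step W γ α η g Q z S).h j := by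
  have hy : ∀ i, S.x i - η • g i - S.d i = Y i + xs := by
    intro i
    simp only [hY, hX, hS, hΔ, Pi.sub_apply, Pi.smul_apply]
    module
  -- The stepsize multiples of the target in `S'` and `Δ` cancel, so the compressed vector is
  -- expressed through quantities that tend to zero.
  have hyh : ∀ i, S.x i - η • g i - S.d i - S.h i = (-(T + η • Δ)) i := by
    intro i
    simp only [hT, hS, hΔ, Pi.neg_apply, Pi.add_apply, Pi.smul_apply]
    module
  have hyhat : ∀ i, S.h i + Q (S.x i - η • g i - S.d i - S.h i) (z i) = Y i + e i + xs := by
    intro i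
    have h1 := hy i
    have h2 := hyh i
    rw [h2, he]
    rw [h1] at h2
    simp only
    rw [← h2]
    abel
  have hmix : ∀ i, (γ / 2) • (S.h i + Q (S.x i - η • g i - S.d i - S.h i) (z i)
      - (S.hw i + ∑ j, W i j • Q (S.x j - η • g j - S.d j - S.h j) (z j)))
      = mixLap W γ (Y + e) i := by
    intro i
    -- The invariant `hhw` turns the locally updated sum into a true `W`-average; the reference
    -- point `xs` survives averaging because rows sum to one, and then cancels in the difference.
    have h1 : S.hw i + ∑ j, W i j • Q (S.x j - η • g j - S.d j - S.h j) (z j)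
        = ∑ j, W i j • (Y + e) j + xs := by
      rw [hhw, ← Finset.sum_add_distrib]
      have : ∀ j, W i j • S.h j + W i j • Q (S.x j - η • g j - S.d j - S.h j) (z j)
          = W i j • (Y + e) j + W i j • xs := by
        intro j
        rw [← smul_add, hyhat, ← smul_add]
        rfl
      simp only [this, Finset.sum_add_distrib, ← Finset.sum_smul, hrow, one_smul]
    rw [h1, hyhat, mixLap_apply, Pi.add_apply]
    congr 1
    abel
  have hd : ∀ i, (step W γ α η g Q z S).d i = S.d i + mixLap W γ (Y + e) i := by
    intro i
    rw [← hmix]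
    rfl
  have hx : ∀ i, (step W γ α η g Q z S).x i = Y i + xs - mixLap W γ (Y + e) i := by
    intro i
    have : (step W γ α η g Q z S).x i = S.x i - η • g i - (step W γ α η g Q z S).d i := rfl
    rw [this, hd, ← hy]
    abel
  have hh : ∀ i, (step W γ α η g Q z S).h i = (1 - α) • S.h i + α • (Y i + e i + xs) := by
    intro i
    rw [← hyhat]
    rfl
  refine ⟨?_, ?_, ?_, ?_⟩
  · funext i
    rw [hx, Pi.sub_apply]
    abel
  · funext i
    rw [hd, Pi.add_apply, Pi.add_apply, hS]
    module
  · funext i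
    rw [hh, hx, hd]
    simp only [hT, hY, hX, hS, Pi.add_apply, Pi.sub_apply, Pi.smul_apply]
    module
  · intro i
    have h1 : (step W γ α η g Q z S).hw i = (1 - α) • S.hw i
      + α • (S.hw i + ∑ j, W i j • Q (S.x j - η • g j - S.d j - S.h j) (z j)) := rfl
    have h2 : ∀ j, (step W γ α η g Q z S).h j = (1 - α) • S.h j
      + α • (S.h j + Q (S.x j - η • g j - S.d j - S.h j) (z j)) := fun j => rfl
    rw [h1, hhw]
    simp only [h2, smul_add, Finset.sum_add_distrib, Finset.smul_sum, smul_comm (W i _)]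

/-- Columns of `W` sum to one, so mixing adds nothing to the total correction; this is why
corrections never disturb the average. -/
theorem sum_step_d (hW : ∀ j, ∑ i, W i j = 1) (hrow : ∀ i, ∑ j, W i j = 1) (η : ℝ)
    (g : Fin n → Vec p) (z : Fin n → Z) {S : State n p}
    (hhw : ∀ i, S.hw i = ∑ j, W i j • S.h j) (hd : ∑ i, S.d i = 0) :
    ∑ i, (step W γ α η g Q z S).d i = 0 := by
  have h := (step_errors (γ := γ) (α := α) (Q := Q) hrow η 0 g z hhw 0 (fun _ => 0) rfl rfl rfl rfl
    rfl rfl).2.1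
  have h1 : ∀ (Y : Fin n → Vec p), ∑ i, mixLap W γ Y i = 0 := by
    intro Y
    simp only [mixLap_apply, ← Finset.smul_sum, Finset.sum_sub_distrib]
    rw [Finset.sum_comm]
    simp only [← Finset.sum_smul, hW, one_smul, sub_self, smul_zero]
  obtain ⟨V, hV⟩ : ∃ V : Fin n → Vec p,
      ∀ i, (step W γ α η g Q z S).d i = S.d i + mixLap W γ V i :=
    ⟨_, fun i => by simpa only [smul_zero, add_zero, Pi.add_apply] using congrFun h i⟩
  simp only [hV, Finset.sum_add_distrib, h1, hd, add_zero]

end Step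

section Gradient

variable {n p : ℕ} {f : Fin n → Vec p → ℝ} {L μ : ℝ}

theorem IsSmoothStronglyConvex.gradient_avg (hf : IsSmoothStronglyConvex L μ f) (x : Vec p) :
    gradient (avgObjective f) x = mean fun i => gradient (f i) x := by
  have h : fderiv ℝ (avgObjective f) x = (1 / (n : ℝ)) • ∑ i, fderiv ℝ (f i) x := by
    have h1 : avgObjective f = fun y => (1 / (n : ℝ)) * ∑ i, f i y := rfl
    rw [h1, fderiv_const_mul (DifferentiableAt.fun_sum fun i _ => hf.differentiable i x),
      fderiv_fun_sum fun i _ => hf.differentiable i x]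
  simp only [gradient, mean, h, map_smul, map_sum]

theorem IsSmoothStronglyConvex.sum_gradient_eq_zero (hf : IsSmoothStronglyConvex L μ f)
    (hn : 0 < n) {xs : Vec p} (hxs : IsMinOn (avgObjective f) Set.univ xs) :
    ∑ i, gradient (f i) xs = 0 := by
  have h1 : fderiv ℝ (avgObjective f) xs = 0 :=
    (hxs.isLocalMin Filter.univ_mem).fderiv_eq_zero
  have h2 := hf.gradient_avg xs
  rw [gradient, h1, map_zero, mean] at h2
  have hn' : (1 / (n : ℝ)) ≠ 0 := by positivity
  exact (smul_eq_zero.1 h2.symm).resolve_left hn'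

theorem IsSmoothStronglyConvex.continuous_gradient (hf : IsSmoothStronglyConvex L μ f)
    (i : Fin n) : Continuous (gradient (f i)) := by
  have h : LipschitzWith (Real.toNNReal L) (gradient (f i)) := by
    refine LipschitzWith.of_dist_le_mul fun x y => ?_
    rw [dist_eq_norm, dist_eq_norm]
    refine (hf.lipschitz i x y).trans ?_
    gcongr
    exact Real.le_coe_toNNReal L
  exact h.continuous

end Gradient

end CEDAS

end

noncomputable section

namespace CEDAS

/-! ### Measurability and integrability of the error variables -/

section History

variable {n : ℕ} {Ω Ξ Z : Type*} [mΞ : MeasurableSpace Ξ] [mZ : MeasurableSpace Z]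
  {ξ : Fin n → ℕ → Ω → Ξ} {z : Fin n → ℕ → Ω → Z}

theorem history_mono {a a' b b' : ℕ} (ha : a ≤ a') (hb : b ≤ b') :
    history ξ z a b ≤ history ξ z a' b' := by
  refine sup_le_sup ?_ ?_
  · exact iSup_mono fun i => iSup_mono fun s => iSup_le fun h =>
      le_iSup (fun _ : s < a' => mΞ.comap (ξ i s)) (h.trans_le ha)
  · exact iSup_mono fun i => iSup_mono fun s => iSup_le fun h =>
      le_iSup (fun _ : s < b' => mZ.comap (z i s)) (h.trans_le hb)

theorem history_le [mΩ : MeasurableSpace Ω] (hξ : ∀ i s, Measurable (ξ i s))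
    (hz : ∀ i k, Measurable (z i k)) (a b : ℕ) : history ξ z a b ≤ mΩ :=
  sup_le (iSup_le fun i => iSup_le fun s => iSup_le fun _ => (hξ i s).comap_le)
    (iSup_le fun i => iSup_le fun k => iSup_le fun _ => (hz i k).comap_le)

theorem measurable_grad_sample {i : Fin n} {s a b : ℕ} (h : s < a) :
    Measurable[history ξ z a b] (ξ i s) := by
  refine Measurable.of_comap_le (le_trans ?_ le_sup_left)
  exact le_iSup_of_le i (le_iSup_of_le s (le_iSup (fun _ : s < a => mΞ.comap (ξ i s)) h))

theorem measurable_comp_sample {i : Fin n} {s a b : ℕ} (h : s < b) :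
    Measurable[history ξ z a b] (z i s) := by
  refine Measurable.of_comap_le (le_trans ?_ le_sup_right)
  exact le_iSup_of_le i (le_iSup_of_le s (le_iSup (fun _ : s < b => mZ.comap (z i s)) h))

end History

/-- `F` is `m`-measurable and square integrable. -/
def IsSq {p : ℕ} {Ω : Type*} (m : MeasurableSpace Ω) {mΩ : MeasurableSpace Ω} (P : Measure Ω)
    (F : Ω → Vec p) : Prop :=
  Measurable[m] F ∧ MemLp F 2 P

namespace IsSq

variable {n p : ℕ} {Ω : Type*} {m m' mΩ : MeasurableSpace Ω} {P : Measure Ω}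
  {F F' : Ω → Vec p}

theorem add (h : IsSq m P F) (h' : IsSq m P F') : IsSq m P (fun ω => F ω + F' ω) :=
  ⟨h.1.add h'.1, h.2.add h'.2⟩

theorem sub (h : IsSq m P F) (h' : IsSq m P F') : IsSq m P (fun ω => F ω - F' ω) :=
  ⟨h.1.sub h'.1, h.2.sub h'.2⟩

theorem smul (c : ℝ) (h : IsSq m P F) : IsSq m P (fun ω => c • F ω) :=
  ⟨h.1.const_smul c, h.2.const_smul c⟩

theorem sum {F : Fin n → Ω → Vec p} (h : ∀ i, IsSq m P (F i)) :
    IsSq m P (fun ω => ∑ i, F i ω) :=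
  ⟨Finset.measurable_fun_sum _ fun i _ => (h i).1, memLp_finsetSum _ fun i _ => (h i).2⟩

theorem const [IsFiniteMeasure P] (c : Vec p) : IsSq m P (fun _ => c) :=
  ⟨measurable_const, memLp_const c⟩

theorem mono (hm : m ≤ m') (h : IsSq m P F) : IsSq m' P F := ⟨h.1.mono hm le_rfl, h.2⟩

theorem mixLap (W : Matrix (Fin n) (Fin n) ℝ) (γ : ℝ) {F : Fin n → Ω → Vec p}
    (h : ∀ i, IsSq m P (F i)) (i : Fin n) :
    IsSq m P (fun ω => mixLap W γ (fun l => F l ω) i) := by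
  simp only [mixLap_apply]
  exact ((h i).sub (sum fun l => (h l).smul (W i l))).smul (γ / 2)

theorem mean {F : Fin n → Ω → Vec p} (h : ∀ i, IsSq m P (F i)) :
    IsSq m P (fun ω => mean fun l => F l ω) :=
  (sum h).smul _

end IsSq

/-- The data of a run of the algorithm, together with a reference point `xs`. -/
structure Setup (n p : ℕ) (Ω Ξ Z : Type*) where
  W : Matrix (Fin n) (Fin n) ℝ
  γ : ℝ
  α : ℝ
  η : ℕ → ℝ
  f : Fin n → Vec p → ℝ
  g : Fin n → Vec p → Ξ → Vec p
  Q : Vec p → Z → Vec p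
  ξ : Fin n → ℕ → Ω → Ξ
  z : Fin n → ℕ → Ω → Z
  xinit : Fin n → Vec p
  xs : Vec p

namespace Setup

variable {n p : ℕ} {Ω Ξ Z : Type*} (D : Setup n p Ω Ξ Z)

/-- The local solutions. -/
abbrev sol : Fin n → ℕ → Ω → Vec p := iterate D.W D.γ D.α D.η D.g D.Q D.xinit D.xinit D.ξ D.z

/-- The state at the beginning of iteration `k`. -/
def state (k : ℕ) (ω : Ω) : State n p :=
  run D.W D.γ D.α D.η D.g D.Q D.xinit D.xinit (fun i s => D.ξ i s ω) (fun i k => D.z i k ω) k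

/-- The gradient of `fᵢ` at the reference point. -/
def target (i : Fin n) : Vec p := gradient (D.f i) D.xs

/-- Error of the local solutions. -/
def errX (k : ℕ) (i : Fin n) (ω : Ω) : Vec p := (D.state k ω).x i - D.xs

/-- Error of the corrections. -/
def errS (k : ℕ) (i : Fin n) (ω : Ω) : Vec p := (D.state k ω).d i + D.η (k + 1) • D.target i

/-- Error of the reference points. -/
def errT (k : ℕ) (i : Fin n) (ω : Ω) : Vec p :=
  (D.state k ω).h i - (D.state k ω).x i + D.errS k i ω

/-- Gradient difference at the local solution. -/
def gradDiff (k : ℕ) (i : Fin n) (ω : Ω) : Vec p :=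
  gradient (D.f i) ((D.state k ω).x i) - D.target i

/-- Gradient difference at the averaged solution. -/
def gradBar (k : ℕ) (i : Fin n) (ω : Ω) : Vec p :=
  gradient (D.f i) (D.xs + mean fun l => D.errX k l ω) - D.target i

/-- Gradient noise in iteration `k`. -/
def noise (k : ℕ) (i : Fin n) (ω : Ω) : Vec p :=
  gradNoise D.f D.g D.ξ (queryPoint D.xinit D.sol) i (k + 1) ω

/-- The vector compressed in iteration `k`. -/
def gap (k : ℕ) (i : Fin n) (ω : Ω) : Vec p :=
  -(D.errT k i ω + D.η (k + 1) • (D.gradDiff k i ω + D.noise k i ω))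

/-- The compression error in iteration `k`. -/
def compErr (k : ℕ) (i : Fin n) (ω : Ω) : Vec p :=
  D.Q (D.gap k i ω) (D.z i k ω) - D.gap k i ω

/-- Error of the vectors sent to the mixing step. -/
def errY (k : ℕ) (i : Fin n) (ω : Ω) : Vec p :=
  D.errX k i ω - D.errS k i ω - D.η (k + 1) • (D.gradDiff k i ω + D.noise k i ω)

/-- Drift of the target of the corrections. -/
def drift (k : ℕ) (i : Fin n) : Vec p := (D.η (k + 2) - D.η (k + 1)) • D.target i

theorem state_succ (k : ℕ) (ω : Ω) : D.state (k + 1) ω =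
    step D.W D.γ D.α (D.η (k + 1)) (fun i => D.g i ((D.state k ω).x i) (D.ξ i (k + 1) ω)) D.Q
      (fun i => D.z i k ω) (D.state k ω) := rfl

theorem state_hw (hrow : ∀ i, ∑ j, D.W i j = 1) (k : ℕ) (ω : Ω) (i : Fin n) :
    (D.state k ω).hw i = ∑ j, D.W i j • (D.state k ω).h j := by
  induction k generalizing i with
  | zero => rfl
  | succ k ih =>
    rw [state_succ]
    exact (step_errors hrow (D.η (k + 1)) (D.η (k + 2)) _ _ ih D.xs D.target rfl rfl rfl rfl rfl
      rfl).2.2.2 i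

theorem state_sum_d (hrow : ∀ i, ∑ j, D.W i j = 1) (hcol : ∀ j, ∑ i, D.W i j = 1) (k : ℕ)
    (ω : Ω) : ∑ i, (D.state k ω).d i = 0 := by
  induction k with
  | zero => exact Finset.sum_const_zero
  | succ k ih =>
    rw [state_succ]
    exact sum_step_d hcol hrow _ _ _ (D.state_hw hrow k ω) ih

theorem err_succ (hrow : ∀ i, ∑ j, D.W i j = 1) (k : ℕ) (i : Fin n) (ω : Ω) :
    D.errX (k + 1) i ω
      = D.errY k i ω - mixLap D.W D.γ (fun l => D.errY k l ω + D.compErr k l ω) i ∧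
    D.errS (k + 1) i ω
      = D.errS k i ω + mixLap D.W D.γ (fun l => D.errY k l ω + D.compErr k l ω) i
        + D.drift k i ∧
    D.errT (k + 1) i ω
      = (1 - D.α) • (D.errT k i ω + D.η (k + 1) • (D.gradDiff k i ω + D.noise k i ω))
        + D.α • D.compErr k i ω + D.errS k i ω
        + (2 : ℝ) • mixLap D.W D.γ (fun l => D.errY k l ω + D.compErr k l ω) i
        + D.drift k i := by
  have hΔ : (fun i => D.gradDiff k i ω + D.noise k i ω)
      = fun i => D.g i ((D.state k ω).x i) (D.ξ i (k + 1) ω) - D.target i := by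
    funext i
    have h : D.noise k i ω = D.g i ((D.state k ω).x i) (D.ξ i (k + 1) ω)
        - gradient (D.f i) ((D.state k ω).x i) := rfl
    rw [h, gradDiff]
    abel
  have h := step_errors (γ := D.γ) (α := D.α) (Q := D.Q) hrow (D.η (k + 1)) (D.η (k + 2))
    (fun i => D.g i ((D.state k ω).x i) (D.ξ i (k + 1) ω)) (fun i => D.z i k ω)
    (D.state_hw hrow k ω) D.xs D.target (X := fun i => D.errX k i ω)
    (S' := fun i => D.errS k i ω) (T := fun i => D.errT k i ω)
    (Y := fun i => D.errY k i ω) (e := fun i => D.compErr k i ω) rfl rfl rfl hΔ rfl rfl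
  exact ⟨congrFun h.1 i, congrFun h.2.1 i, congrFun h.2.2.1 i⟩

/-- The standing assumptions on a run. -/
structure IsValid [MeasurableSpace Ω] [MeasurableSpace Ξ] [MeasurableSpace Z] (P : Measure Ω)
    (ν : Measure Z) (L μ σ C : ℝ) : Prop where
  n_pos : 0 < n
  row_sum : ∀ i, ∑ j, D.W i j = 1
  col_sum : ∀ j, ∑ i, D.W i j = 1
  smooth : IsSmoothStronglyConvex L μ D.f
  isMin : IsMinOn (avgObjective D.f) Set.univ D.xs
  oracle : IsGradientOracle P σ D.f D.g D.ξ D.z (queryPoint D.xinit D.sol)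
  comp : IsUnbiasedCompressor C D.Q ν
  fresh : IsFreshCompressorSample P ν D.ξ D.z
  C_nonneg : 0 ≤ C

namespace IsValid

variable {D} {m : MeasurableSpace Ω} [mΩ : MeasurableSpace Ω] [mΞ : MeasurableSpace Ξ] [mZ : MeasurableSpace Z]
  {P : Measure Ω} [IsProbabilityMeasure P] {ν : Measure Z} [IsProbabilityMeasure ν] {L μ σ C : ℝ}

theorem history_le' (h : D.IsValid P ν L μ σ C) (a b : ℕ) : history D.ξ D.z a b ≤ mΩ :=
  history_le h.oracle.measurable_sample h.fresh.measurable a b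

theorem norm_gradDiff_le (h : D.IsValid P ν L μ σ C) (k : ℕ) (i : Fin n) (ω : Ω) :
    ‖D.gradDiff k i ω‖ ≤ L * ‖D.errX k i ω‖ := h.smooth.lipschitz i _ _

theorem norm_gradBar_le (h : D.IsValid P ν L μ σ C) (k : ℕ) (i : Fin n) (ω : Ω) :
    ‖D.gradBar k i ω‖ ≤ L * ‖mean fun l => D.errX k l ω‖ := by
  refine (h.smooth.lipschitz i _ _).trans (le_of_eq ?_)
  rw [add_sub_cancel_left]

theorem norm_gradDiff_sub_gradBar_le (h : D.IsValid P ν L μ σ C) (k : ℕ) (i : Fin n) (ω : Ω) :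
    ‖D.gradDiff k i ω - D.gradBar k i ω‖
      ≤ L * ‖D.errX k i ω - mean fun l => D.errX k l ω‖ := by
  rw [gradDiff, gradBar, sub_sub_sub_cancel_right]
  refine (h.smooth.lipschitz i _ _).trans (le_of_eq ?_)
  rw [errX, sub_sub]

theorem isSq_gradDiff (h : D.IsValid P ν L μ σ C) (hm : m ≤ mΩ) {k : ℕ}
    {i : Fin n} (hX : IsSq m P (D.errX k i)) : IsSq m P (D.gradDiff k i) := by
  have hx : Measurable[m] fun ω => (D.state k ω).x i := by
    have := hX.1.add_const D.xs
    simpa [errX] using this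
  have hmeas : Measurable[m] (D.gradDiff k i) :=
    ((h.smooth.continuous_gradient i).measurable.comp hx).sub_const _
  exact ⟨hmeas, hX.2.of_le_mul (hmeas.mono hm le_rfl).aestronglyMeasurable
    (ae_of_all _ fun ω => h.norm_gradDiff_le k i ω)⟩

theorem isSq_gradBar (h : D.IsValid P ν L μ σ C) (hm : m ≤ mΩ) {k : ℕ}
    (hX : ∀ i, IsSq m P (D.errX k i)) (i : Fin n) : IsSq m P (D.gradBar k i) := by
  have hmean := IsSq.mean hX
  have hmeas : Measurable[m] (D.gradBar k i) :=
    ((h.smooth.continuous_gradient i).measurable.comp (hmean.1.const_add D.xs)).sub_const _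
  exact ⟨hmeas, hmean.2.of_le_mul (hmeas.mono hm le_rfl).aestronglyMeasurable
    (ae_of_all _ fun ω => h.norm_gradBar_le k i ω)⟩

theorem measurable_noise (h : D.IsValid P ν L μ σ C) {k : ℕ}
    {i : Fin n} (hX : Measurable[m] (D.errX k i)) (hξ : Measurable[m] (D.ξ i (k + 1))) :
    Measurable[m] (D.noise k i) := by
  have hx : Measurable[m] fun ω => (D.state k ω).x i := by
    have := hX.add_const D.xs
    simpa [errX] using this
  exact ((h.oracle.measurable_oracle i).comp (hx.prodMk hξ)).sub
    ((h.smooth.continuous_gradient i).measurable.comp hx)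

theorem isSq_noise (h : D.IsValid P ν L μ σ C) {k : ℕ} {i : Fin n}
    (hX : IsSq (history D.ξ D.z (k + 1) k) P (D.errX k i)) :
    IsSq (history D.ξ D.z (k + 2) k) P (D.noise k i) :=
  ⟨h.measurable_noise (hX.1.mono (history_mono (by omega) le_rfl) le_rfl)
    (measurable_grad_sample (by omega)), h.oracle.square_integrable i (k + 1)⟩

theorem isSq_gap (h : D.IsValid P ν L μ σ C) {k : ℕ} {i : Fin n}
    (hX : IsSq (history D.ξ D.z (k + 1) k) P (D.errX k i))
    (hT : IsSq (history D.ξ D.z (k + 1) k) P (D.errT k i)) :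
    IsSq (history D.ξ D.z (k + 2) k) P (D.gap k i) := by
  have hle : history D.ξ D.z (k + 1) k ≤ history D.ξ D.z (k + 2) k :=
    history_mono (by omega) le_rfl
  have h1 := (hT.mono hle).add
    ((((h.isSq_gradDiff (h.history_le' _ _) hX).mono hle).add (h.isSq_noise hX)).smul
      (D.η (k + 1)))
  rw [show D.gap k i = _ from funext fun ω => (neg_one_smul ℝ _).symm]
  exact h1.smul (-1)

theorem isSq_compErr (h : D.IsValid P ν L μ σ C) {k : ℕ} {i : Fin n}
    (hX : IsSq (history D.ξ D.z (k + 1) k) P (D.errX k i))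
    (hT : IsSq (history D.ξ D.z (k + 1) k) P (D.errT k i)) :
    IsSq (history D.ξ D.z (k + 2) (k + 1)) P (D.compErr k i) := by
  have hg := h.isSq_gap hX hT
  have hg' := hg.mono (history_mono le_rfl (Nat.le_succ k))
  refine ⟨?_, h.comp.memLp_error h.C_nonneg (h.history_le' _ _) (h.fresh.measurable i k)
    (h.fresh.law i k) (h.fresh.indep i k) hg.1 hg.2⟩
  exact (h.comp.measurable.comp (hg'.1.prodMk (measurable_comp_sample (by omega)))).sub hg'.1

/-- Adaptedness: the state at iteration `k` has seen the gradient samples of times 0 to `k`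
(iterations -1 to k - 1) and the compressor samples before `k`, hence the indices `k + 1` and `k` of
the history. -/
theorem isSq_err (h : D.IsValid P ν L μ σ C) (k : ℕ) (i : Fin n) :
    IsSq (history D.ξ D.z (k + 1) k) P (D.errX k i) ∧
    IsSq (history D.ξ D.z (k + 1) k) P (D.errS k i) ∧
    IsSq (history D.ξ D.z (k + 1) k) P (D.errT k i) := by
  induction k generalizing i with
  | zero =>
    have hS : IsSq (history D.ξ D.z (0 + 1) 0) P (D.errS 0 i) := by
      have : D.errS 0 i = fun _ => (0 : Vec p) + D.η (0 + 1) • D.target i := rfl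
      rw [this]
      exact IsSq.const _
    have hx : IsSq (history D.ξ D.z (0 + 1) 0) P (fun ω => (D.state 0 ω).x i) := by
      have hN := h.oracle.square_integrable i 0
      have e1 : (fun ω => (D.state 0 ω).x i) = fun ω => D.xinit i - D.η 0 • (gradient (D.f i)
          (D.xinit i) + gradNoise D.f D.g D.ξ (queryPoint D.xinit D.sol) i 0 ω) := by
        funext ω
        have : (D.state 0 ω).x i = D.xinit i - D.η 0 • D.g i (D.xinit i) (D.ξ i 0 ω) := rfl
        rw [this]
        simp [gradNoise, queryPoint]
      rw [e1]
      refine (IsSq.const _).sub (((IsSq.const _).add ⟨?_, hN⟩).smul _)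
      have hξ : Measurable[history D.ξ D.z (0 + 1) 0] (D.ξ i 0) :=
        measurable_grad_sample (by omega)
      exact ((h.oracle.measurable_oracle i).comp (measurable_const.prodMk hξ)).sub
        (measurable_const (a := gradient (D.f i) (D.xinit i)))
    exact ⟨hx.sub (IsSq.const _), hS, ((IsSq.const (D.xinit i)).sub hx).add hS⟩
  | succ k ih =>
    have hle : history D.ξ D.z (k + 1) k ≤ history D.ξ D.z (k + 1 + 1) (k + 1) :=
      history_mono (by omega) (by omega)
    have hle' : history D.ξ D.z (k + 2) k ≤ history D.ξ D.z (k + 1 + 1) (k + 1) :=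
      history_mono (by omega) (by omega)
    have hX := fun i => (ih i).1.mono hle
    have hS := fun i => (ih i).2.1.mono hle
    have hT := fun i => (ih i).2.2.mono hle
    have hΔ := fun i => ((h.isSq_gradDiff (h.history_le' _ _) (ih i).1).mono hle).add
      ((h.isSq_noise (ih i).1).mono hle')
    have he := fun i => h.isSq_compErr (ih i).1 (ih i).2.2
    have hY : ∀ i, IsSq (history D.ξ D.z (k + 1 + 1) (k + 1)) P (D.errY k i) :=
      fun i => ((hX i).sub (hS i)).sub ((hΔ i).smul _)
    have hM := IsSq.mixLap D.W D.γ (fun l => (hY l).add (he l)) i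
    have hd : IsSq (history D.ξ D.z (k + 1 + 1) (k + 1)) P fun _ => D.drift k i := IsSq.const _
    have e := fun ω => D.err_succ h.row_sum k i ω
    refine ⟨?_, ?_, ?_⟩
    · rw [show D.errX (k + 1) i = _ from funext fun ω => (e ω).1]
      exact (hY i).sub hM
    · rw [show D.errS (k + 1) i = _ from funext fun ω => (e ω).2.1]
      exact ((hS i).add hM).add hd
    · rw [show D.errT (k + 1) i = _ from funext fun ω => (e ω).2.2]
      exact ((((((hT i).add ((hΔ i).smul _)).smul _).add ((he i).smul _)).add (hS i)).add
        (hM.smul 2)).add hd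

end IsValid

end Setup

end CEDAS

end

noncomputable section

namespace CEDAS

/-! ### The error variables as elements of `L²` -/

section Lift

variable {n p : ℕ} {Ω : Type*} {m mΩ : MeasurableSpace Ω} {P : Measure Ω}

/-- A family of square integrable random vectors as elements of `L²`. -/
def liftL2 (F : Fin n → Ω → Vec p) (hF : ∀ i, MemLp (F i) 2 P) : Fin n → Lp (Vec p) 2 P :=
  fun i => (hF i).toLp (F i)

theorem toLp_sum {F : Fin n → Ω → Vec p} (hF : ∀ i, MemLp (F i) 2 P)
    (h : MemLp (fun ω => ∑ i, F i ω) 2 P) : h.toLp _ = ∑ i, (hF i).toLp (F i) := by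
  have key : ∀ s : Finset (Fin n), ∀ hs : MemLp (fun ω => ∑ i ∈ s, F i ω) 2 P,
      hs.toLp _ = ∑ i ∈ s, (hF i).toLp (F i) := by
    intro s
    induction s using Finset.induction_on with
    | empty =>
      intro hs
      exact (MemLp.toLp_congr hs MemLp.zero (ae_of_all _ fun ω => by simp)).trans
        (by simp only [Finset.sum_empty]; exact MemLp.toLp_zero _)
    | insert a s ha ih =>
      intro hs
      have h' : MemLp (fun ω => ∑ i ∈ s, F i ω) 2 P := memLp_finsetSum _ fun i _ => hF i
      rw [Finset.sum_insert ha, ← ih h', ← MemLp.toLp_add]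
      exact MemLp.toLp_congr _ _ (ae_of_all _ fun ω => by simp [Finset.sum_insert ha])
  exact key Finset.univ h

theorem toLp_mixLap (W : Matrix (Fin n) (Fin n) ℝ) (γ : ℝ) {F : Fin n → Ω → Vec p}
    (hF : ∀ i, MemLp (F i) 2 P) (i : Fin n)
    (h : MemLp (fun ω => mixLap W γ (fun l => F l ω) i) 2 P) :
    h.toLp _ = mixLap W γ (liftL2 F hF) i := by
  have hs : MemLp (fun ω => ∑ l, W i l • F l ω) 2 P :=
    memLp_finsetSum _ fun l _ => (hF l).const_smul (W i l)
  rw [mixLap_apply]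
  have e1 : ∑ l, W i l • liftL2 F hF l = hs.toLp _ :=
    (toLp_sum (F := fun l => W i l • F l) (fun l => (hF l).const_smul (W i l)) hs).symm
  rw [e1, liftL2, ← MemLp.toLp_sub, ← MemLp.toLp_const_smul]
  exact MemLp.toLp_congr _ _ (ae_of_all _ fun ω => by simp [mixLap_apply])

theorem toLp_mean {F : Fin n → Ω → Vec p} (hF : ∀ i, MemLp (F i) 2 P)
    (h : MemLp (fun ω => mean fun l => F l ω) 2 P) : h.toLp _ = mean (liftL2 F hF) := by
  have hs : MemLp (fun ω => ∑ l, F l ω) 2 P := memLp_finsetSum _ fun l _ => hF l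
  have e1 : ∑ l, liftL2 F hF l = hs.toLp _ := (toLp_sum hF hs).symm
  rw [mean, e1, ← MemLp.toLp_const_smul]
  rfl

theorem norm_toLp_le {f g : Ω → Vec p} (hf : MemLp f 2 P) (hg : MemLp g 2 P) {c : ℝ}
    (h : ∀ ω, ‖f ω‖ ≤ c * ‖g ω‖) : ‖hf.toLp f‖ ≤ c * ‖hg.toLp g‖ := by
  refine Lp.norm_le_mul_norm_of_ae_le_mul ?_
  filter_upwards [hf.coeFn_toLp, hg.coeFn_toLp] with ω h1 h2
  rw [h1, h2]
  exact h ω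

/-- The bridge from measurability with respect to the past to membership in the subspaces of
`IsErrorIteration`. -/
theorem toLp_mem_lpMeas {f : Ω → Vec p} (h : IsSq m P f) :
    h.2.toLp f ∈ lpMeas (Vec p) ℝ m 2 P :=
  mem_lpMeas_iff_aestronglyMeasurable.2
    (h.1.aestronglyMeasurable.congr h.2.coeFn_toLp.symm)

theorem norm_toLp_sq [IsProbabilityMeasure P] {f : Ω → Vec p} (hf : MemLp f 2 P) :
    ‖hf.toLp f‖ ^ 2 = ∫ ω, ‖f ω‖ ^ 2 ∂P := by
  rw [← real_inner_self_eq_norm_sq, inner_toLp_eq]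
  exact integral_congr_ae (ae_of_all _ fun ω => real_inner_self_eq_norm_sq _)

theorem norm_toLp_const_sq [IsProbabilityMeasure P] (c : Vec p)
    (hf : MemLp (fun _ : Ω => c) 2 P) : ‖hf.toLp _‖ ^ 2 = ‖c‖ ^ 2 := by
  rw [norm_toLp_sq]
  simp

theorem norm_sq_le_of_condExp_le [IsProbabilityMeasure P] (hm : m ≤ mΩ) {f : Ω → Vec p} {c : ℝ}
    (hf : MemLp f 2 P) (h : P[fun ω => ‖f ω‖ ^ 2 | m] ≤ᵐ[P] fun _ => c) :
    ‖hf.toLp f‖ ^ 2 ≤ c := by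
  rw [norm_toLp_sq, ← integral_condExp hm]
  refine (integral_mono_ae integrable_condExp (integrable_const c) h).trans (le_of_eq ?_)
  simp

end Lift

namespace Setup

variable {n p : ℕ} {Ω Ξ Z : Type*} {D : Setup n p Ω Ξ Z}

namespace IsValid

variable {m : MeasurableSpace Ω} [mΩ : MeasurableSpace Ω] [mΞ : MeasurableSpace Ξ]
  [mZ : MeasurableSpace Z] {P : Measure Ω} [IsProbabilityMeasure P] {ν : Measure Z}
  [IsProbabilityMeasure ν] {L μ σ C : ℝ}

theorem memLp_errX (h : D.IsValid P ν L μ σ C) (k : ℕ) (i : Fin n) : MemLp (D.errX k i) 2 P :=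
  (h.isSq_err k i).1.2

theorem memLp_errS (h : D.IsValid P ν L μ σ C) (k : ℕ) (i : Fin n) : MemLp (D.errS k i) 2 P :=
  (h.isSq_err k i).2.1.2

theorem memLp_errT (h : D.IsValid P ν L μ σ C) (k : ℕ) (i : Fin n) : MemLp (D.errT k i) 2 P :=
  (h.isSq_err k i).2.2.2

theorem memLp_gradDiff (h : D.IsValid P ν L μ σ C) (k : ℕ) (i : Fin n) :
    MemLp (D.gradDiff k i) 2 P :=
  (h.isSq_gradDiff (h.history_le' _ _) (h.isSq_err k i).1).2

theorem memLp_gradBar (h : D.IsValid P ν L μ σ C) (k : ℕ) (i : Fin n) :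
    MemLp (D.gradBar k i) 2 P :=
  (h.isSq_gradBar (h.history_le' _ _) (fun l => (h.isSq_err k l).1) i).2

theorem memLp_noise (h : D.IsValid P ν L μ σ C) (k : ℕ) (i : Fin n) : MemLp (D.noise k i) 2 P :=
  (h.isSq_noise (h.isSq_err k i).1).2

theorem memLp_compErr (h : D.IsValid P ν L μ σ C) (k : ℕ) (i : Fin n) :
    MemLp (D.compErr k i) 2 P :=
  (h.isSq_compErr (h.isSq_err k i).1 (h.isSq_err k i).2.2).2

theorem memLp_drift (k : ℕ) (i : Fin n) : MemLp (fun _ : Ω => D.drift k i) 2 P :=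
  memLp_const _

theorem noise_inner_eq_zero (h : D.IsValid P ν L μ σ C) (k : ℕ) (i : Fin n)
    (y : Lp (Vec p) 2 P) (hy : y ∈ lpMeas (Vec p) ℝ (history D.ξ D.z (k + 1) k) 2 P) :
    inner ℝ ((h.memLp_noise k i).toLp _) y = 0 := by
  rw [← Lp.toLp_coeFn y (Lp.memLp y), inner_toLp_eq]
  exact integral_inner_eq_zero_of_condExp_eq_zero (h.history_le' _ _) (h.memLp_noise k i)
    (Lp.memLp y) (mem_lpMeas_iff_aestronglyMeasurable.1 hy) (h.oracle.unbiased i (k + 1))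

theorem noise_pair (h : D.IsValid P ν L μ σ C) (k : ℕ) {i i' : Fin n} (hii : i ≠ i') :
    inner ℝ ((h.memLp_noise k i).toLp _) ((h.memLp_noise k i').toLp _) = 0 := by
  rw [inner_toLp_eq]
  have hm := h.history_le' (k + 1) k
  have hmeas : ∀ i, Measurable[history D.ξ D.z (k + 1) k ⊔ mΞ.comap (D.ξ i (k + 1))]
      (D.noise k i) := fun i =>
    h.measurable_noise ((h.isSq_err k i).1.1.mono le_sup_left le_rfl)
      (Measurable.of_comap_le le_sup_right)
  refine integral_inner_eq_zero_of_condIndep hm (h.oracle.measurable_sample i (k + 1))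
    (h.oracle.measurable_sample i' (k + 1)) (fun S T hS hT => ?_) (h.memLp_noise k i)
    (h.memLp_noise k i') (hmeas i).aestronglyMeasurable (hmeas i').aestronglyMeasurable
    (h.oracle.unbiased i' (k + 1))
  -- Joint conditional independence gives the pairwise one by leaving all other samples
  -- unrestricted: their conditional probabilities are 1.
  set A : Fin n → Set Ξ := fun l => if l = i then S else if l = i' then T else Set.univ with hA
  have hAm : ∀ l, MeasurableSet (A l) := by
    intro l
    simp only [hA]
    split_ifs
    exacts [hS, hT, MeasurableSet.univ]
  have hAi : A i = S := by simp [hA]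
  have hAi' : A i' = T := by simp [hA, hii.symm]
  have hAu : ∀ l, l ≠ i → l ≠ i' → A l = Set.univ := fun l h1 h2 => by simp [hA, h1, h2]
  have hind := h.oracle.indep (k + 1) A hAm
  have hinter : ⋂ l, D.ξ l (k + 1) ⁻¹' A l = D.ξ i (k + 1) ⁻¹' S ∩ D.ξ i' (k + 1) ⁻¹' T := by
    ext ω
    simp only [Set.mem_iInter, Set.mem_preimage, Set.mem_inter_iff]
    constructor
    · intro hω
      exact ⟨hAi ▸ hω i, hAi' ▸ hω i'⟩
    · rintro ⟨h1, h2⟩ l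
      by_cases hl : l = i
      · subst hl; rwa [hAi]
      · by_cases hl' : l = i'
        · subst hl'; rwa [hAi']
        · rw [hAu l hl hl']; trivial
  rw [hinter] at hind
  refine hind.trans (ae_of_all _ fun ω => ?_)
  have h1 : ∀ l, l ≠ i → l ≠ i' →
      (P[(D.ξ l (k + 1) ⁻¹' A l).indicator (fun _ => (1 : ℝ)) | gradHistory D.ξ D.z (k + 1)]) ω
        = 1 := by
    intro l h1 h2
    rw [hAu l h1 h2, Set.preimage_univ, Set.indicator_univ, condExp_const (h.history_le' _ _)]
  show ∏ l, (P[(D.ξ l (k + 1) ⁻¹' A l).indicator (fun _ => (1 : ℝ)) |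
    gradHistory D.ξ D.z (k + 1)]) ω = _
  rw [← Finset.mul_prod_erase _ _ (Finset.mem_univ i),
    ← Finset.mul_prod_erase _ _ (Finset.mem_erase.2 ⟨hii.symm, Finset.mem_univ i'⟩),
    Finset.prod_eq_one, mul_one, hAi, hAi']
  · rfl
  · intro l hl
    simp only [Finset.mem_erase, Finset.mem_univ, and_true, ne_eq] at hl
    exact h1 l hl.2 hl.1

theorem compErr_inner_eq_zero (h : D.IsValid P ν L μ σ C) (k : ℕ) (i : Fin n)
    (y : Lp (Vec p) 2 P) (hy : y ∈ lpMeas (Vec p) ℝ (history D.ξ D.z (k + 2) k) 2 P) :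
    inner ℝ ((h.memLp_compErr k i).toLp _) y = 0 := by
  have hy' := mem_lpMeas_iff_aestronglyMeasurable.1 hy
  -- Freezing needs a function that is genuinely measurable for the past, so a representative
  -- replaces the almost-everywhere class.
  have hmk : MemLp (hy'.mk y) 2 P := (memLp_congr_ae hy'.ae_eq_mk).1 (Lp.memLp y)
  have e1 : y = hmk.toLp _ :=
    (Lp.toLp_coeFn y (Lp.memLp y)).symm.trans (MemLp.toLp_congr _ _ hy'.ae_eq_mk)
  have hg := h.isSq_gap (h.isSq_err k i).1 (h.isSq_err k i).2.2
  rw [e1, inner_toLp_eq]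
  exact h.comp.integral_inner_error h.C_nonneg (h.history_le' _ _) (h.fresh.measurable i k)
    (h.fresh.law i k) (h.fresh.indep i k) hg.1 hg.2 hy'.stronglyMeasurable_mk.measurable hmk

theorem norm_compErr_sq_le (h : D.IsValid P ν L μ σ C) (k : ℕ) (i : Fin n) :
    ‖(h.memLp_compErr k i).toLp _‖ ^ 2 ≤ C * ‖(h.memLp_errT k i).toLp _
      + D.η (k + 1) • ((h.memLp_gradDiff k i).toLp _ + (h.memLp_noise k i).toLp _)‖ ^ 2 := by
  have hg := h.isSq_gap (h.isSq_err k i).1 (h.isSq_err k i).2.2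
  have h1 := h.comp.lintegral_error_le h.C_nonneg (h.history_le' _ _) (h.fresh.measurable i k)
    (h.fresh.law i k) (h.fresh.indep i k) hg.1
  have h2 := lintegral_enorm_sq_eq (h.memLp_compErr k i)
  simp only [compErr] at h2
  rw [h2, lintegral_enorm_sq_eq hg.2, ← ENNReal.ofReal_mul h.C_nonneg,
    ENNReal.ofReal_le_ofReal_iff (mul_nonneg h.C_nonneg (sq_nonneg _))] at h1
  have e1 : hg.2.toLp _ = -((h.memLp_errT k i).toLp _
      + D.η (k + 1) • ((h.memLp_gradDiff k i).toLp _ + (h.memLp_noise k i).toLp _)) := by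
    rw [← MemLp.toLp_add, ← MemLp.toLp_const_smul, ← MemLp.toLp_add, ← MemLp.toLp_neg]
    exact MemLp.toLp_congr _ _ (ae_of_all _ fun ω => rfl)
  rw [e1, norm_neg] at h1
  exact h1

theorem mean_gradBar (h : D.IsValid P ν L μ σ C) (k : ℕ) (ω : Ω) :
    (mean fun i => D.gradBar k i ω)
      = gradient (avgObjective D.f) (D.xs + mean fun l => D.errX k l ω)
        - gradient (avgObjective D.f) D.xs := by
  rw [h.smooth.gradient_avg, h.smooth.gradient_avg, ← mean_sub]
  rfl

/-- The smaller subspace is the past before the gradients of iteration `k` are drawn, the larger one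
also knows these gradients. Pointwise Lipschitz and convexity inequalities pass to L² by
integration. -/
theorem isErrorIteration (h : D.IsValid P ν L μ σ C) (k : ℕ) :
    IsErrorIteration L μ σ C (D.η (k + 1)) (liftL2 (D.errX k) (h.memLp_errX k))
      (liftL2 (D.errS k) (h.memLp_errS k)) (liftL2 (D.errT k) (h.memLp_errT k))
      (liftL2 (D.gradDiff k) (h.memLp_gradDiff k)) (liftL2 (D.gradBar k) (h.memLp_gradBar k))
      (liftL2 (D.noise k) (h.memLp_noise k)) (liftL2 (D.compErr k) (h.memLp_compErr k))
      (liftL2 (fun i _ => D.drift k i) (memLp_drift (P := P) k))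
      (lpMeas (Vec p) ℝ (history D.ξ D.z (k + 1) k) 2 P)
      (lpMeas (Vec p) ℝ (history D.ξ D.z (k + 2) k) 2 P) := by
  have hX := fun i => (h.isSq_err k i).1
  have hmean := IsSq.mean hX
  have hbar := IsSq.mean (h.isSq_gradBar (h.history_le' (k + 1) k) hX)
  have eX := toLp_mean (h.memLp_errX k) hmean.2
  have eB := toLp_mean (h.memLp_gradBar k) hbar.2
  have zero_sum : ∀ {F : Fin n → Ω → Vec p} (hF : ∀ i, MemLp (F i) 2 P),
      (∀ ω, ∑ i, F i ω = 0) → ∑ i, liftL2 F hF i = 0 := by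
    intro F hF h0
    have hs : MemLp (fun ω => ∑ i, F i ω) 2 P := memLp_finsetSum _ fun i _ => hF i
    refine (toLp_sum hF hs).symm.trans ?_
    exact (MemLp.toLp_congr hs MemLp.zero (ae_of_all _ fun ω => by simp [h0])).trans
      (MemLp.toLp_zero _)
  have htarget : ∑ i, D.target i = 0 := h.smooth.sum_gradient_eq_zero h.n_pos h.isMin
  constructor
  · intro y hy
    exact mem_lpMeas_iff_aestronglyMeasurable.2
      ((mem_lpMeas_iff_aestronglyMeasurable.1 hy).mono (history_mono (by omega) le_rfl))
  · exact fun i => toLp_mem_lpMeas (hX i)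
  · exact fun i => toLp_mem_lpMeas (h.isSq_err k i).2.1
  · exact fun i => toLp_mem_lpMeas (h.isSq_err k i).2.2
  · exact fun i => toLp_mem_lpMeas (h.isSq_gradDiff (h.history_le' _ _) (hX i))
  · exact fun i => toLp_mem_lpMeas (h.isSq_gradBar (h.history_le' _ _) hX i)
  · exact fun i => toLp_mem_lpMeas (IsSq.const _)
  · exact fun i => toLp_mem_lpMeas (h.isSq_noise (hX i))
  · exact fun i y hy => h.noise_inner_eq_zero k i y hy
  · exact fun i i' hii => h.noise_pair k hii
  · exact fun i => norm_sq_le_of_condExp_le (h.history_le' _ _) (h.memLp_noise k i)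
      (h.oracle.variance_le i (k + 1))
  · exact fun i y hy => h.compErr_inner_eq_zero k i y hy
  · rw [sumSq, sumSq, Finset.mul_sum]
    exact Finset.sum_le_sum fun i _ => h.norm_compErr_sq_le k i
  · refine zero_sum _ fun ω => ?_
    simp only [errS, Finset.sum_add_distrib, ← Finset.smul_sum, htarget, smul_zero, add_zero]
    exact D.state_sum_d h.row_sum h.col_sum k ω
  · refine zero_sum _ fun ω => ?_
    simp only [drift, ← Finset.smul_sum, htarget, smul_zero]
  · exact fun i => norm_toLp_le _ _ fun ω => h.norm_gradDiff_le k i ω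
  · intro i
    rw [← eX]
    simp only [liftL2]
    rw [← MemLp.toLp_sub, ← MemLp.toLp_sub]
    exact norm_toLp_le _ _ fun ω => h.norm_gradDiff_sub_gradBar_le k i ω
  · rw [← eX, ← eB, inner_toLp_eq, norm_toLp_sq, ← integral_const_mul]
    refine integral_mono (((memLp_two_iff_integrable_sq_norm hmean.2.1).1 hmean.2).const_mul μ)
      (integrable_inner_of_memLp hbar.2 hmean.2) fun ω => ?_
    show μ * ‖mean fun l => D.errX k l ω‖ ^ 2
      ≤ inner ℝ (mean fun i => D.gradBar k i ω) (mean fun l => D.errX k l ω)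
    rw [h.mean_gradBar]
    have := h.smooth.stronglyConvex (D.xs + mean fun l => D.errX k l ω) D.xs
    rwa [add_sub_cancel_left] at this
  · rw [← eX, ← eB]
    refine norm_toLp_le _ _ fun ω => ?_
    have hn : (0 : ℝ) < n := by exact_mod_cast h.n_pos
    show ‖mean fun i => D.gradBar k i ω‖ ≤ L * ‖mean fun l => D.errX k l ω‖
    rw [mean, norm_smul, Real.norm_eq_abs, abs_of_pos (by positivity : 0 < 1 / (n : ℝ))]
    calc 1 / (n : ℝ) * ‖∑ i, D.gradBar k i ω‖
        ≤ 1 / (n : ℝ) * ∑ i, ‖D.gradBar k i ω‖ := by gcongr; exact norm_sum_le _ _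
      _ ≤ 1 / (n : ℝ) * ∑ _i : Fin n, L * ‖mean fun l => D.errX k l ω‖ := by
          gcongr with i _
          exact h.norm_gradBar_le k i ω
      _ = L * ‖mean fun l => D.errX k l ω‖ := by
          rw [Finset.sum_const, Finset.card_univ, Fintype.card_fin, nsmul_eq_mul]
          field_simp

end IsValid

end Setup

end CEDAS

end

/-! ### Recursion and initial values of the error variables in L² -/

noncomputable section

namespace CEDAS

namespace Setup

variable {n p : ℕ} {Ω Ξ Z : Type*} {D : Setup n p Ω Ξ Z}

namespace IsValid

variable [mΩ : MeasurableSpace Ω] [mΞ : MeasurableSpace Ξ]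
  [mZ : MeasurableSpace Z] {P : Measure Ω} [IsProbabilityMeasure P] {ν : Measure Z}
  [IsProbabilityMeasure ν] {L μ σ C : ℝ}

/-- The error of the local solutions in `L²`. -/
abbrev lX (h : D.IsValid P ν L μ σ C) (k : ℕ) := liftL2 (D.errX k) (h.memLp_errX k)

/-- The error of the corrections in `L²`. -/
abbrev lS (h : D.IsValid P ν L μ σ C) (k : ℕ) := liftL2 (D.errS k) (h.memLp_errS k)

/-- The error of the reference points in `L²`. -/
abbrev lT (h : D.IsValid P ν L μ σ C) (k : ℕ) := liftL2 (D.errT k) (h.memLp_errT k)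

theorem memLp_mixLap (W : Matrix (Fin n) (Fin n) ℝ) (γ : ℝ) {F : Fin n → Ω → Vec p}
    (hF : ∀ i, MemLp (F i) 2 P) (i : Fin n) :
    MemLp (fun ω => mixLap W γ (fun l => F l ω) i) 2 P := by
  simp only [mixLap_apply]
  exact ((hF i).sub (memLp_finsetSum _ fun l _ => (hF l).const_smul (W i l))).const_smul (γ / 2)

theorem memLp_noisyGrad (h : D.IsValid P ν L μ σ C) (k : ℕ) (i : Fin n) :
    MemLp (fun ω => D.gradDiff k i ω + D.noise k i ω) 2 P :=
  (h.memLp_gradDiff k i).add (h.memLp_noise k i)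

theorem memLp_errY (h : D.IsValid P ν L μ σ C) (k : ℕ) (i : Fin n) : MemLp (D.errY k i) 2 P :=
  ((h.memLp_errX k i).sub (h.memLp_errS k i)).sub ((h.memLp_noisyGrad k i).const_smul (D.η (k + 1)))

theorem memLp_sent (h : D.IsValid P ν L μ σ C) (k : ℕ) (i : Fin n) :
    MemLp (fun ω => D.errY k i ω + D.compErr k i ω) 2 P :=
  (h.memLp_errY k i).add (h.memLp_compErr k i)

/-- The gradient differences with noise in `L²`. -/
abbrev lΔ (h : D.IsValid P ν L μ σ C) (k : ℕ) :=
  liftL2 (D.gradDiff k) (h.memLp_gradDiff k) + liftL2 (D.noise k) (h.memLp_noise k)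

/-- The compression errors in `L²`. -/
abbrev le (h : D.IsValid P ν L μ σ C) (k : ℕ) := liftL2 (D.compErr k) (h.memLp_compErr k)

/-- The errors of the vectors sent to the mixing step in `L²`. -/
abbrev lY (h : D.IsValid P ν L μ σ C) (k : ℕ) := h.lX k - h.lS k - D.η (k + 1) • h.lΔ k

/-- The drift in `L²`. -/
abbrev lδ (_ : D.IsValid P ν L μ σ C) (k : ℕ) :=
  liftL2 (fun i _ => D.drift k i) (memLp_drift (P := P) k)

theorem mixLap_sent (h : D.IsValid P ν L μ σ C) (k : ℕ) (i : Fin n) :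
    mixLap D.W D.γ (h.lY k + h.le k) i = (memLp_mixLap D.W D.γ (h.memLp_sent k) i).toLp _ := by
  rw [toLp_mixLap D.W D.γ (h.memLp_sent k) i]
  congr 1

theorem lX_succ (h : D.IsValid P ν L μ σ C) (k : ℕ) :
    h.lX (k + 1) = h.lY k - mixLap D.W D.γ (h.lY k + h.le k) := by
  funext i
  rw [Pi.sub_apply, h.mixLap_sent]
  have e1 : h.lY k i = (h.memLp_errY k i).toLp _ := rfl
  rw [e1, ← MemLp.toLp_sub]
  exact MemLp.toLp_congr _ _ (ae_of_all _ fun ω => (D.err_succ h.row_sum k i ω).1)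

theorem lS_succ (h : D.IsValid P ν L μ σ C) (k : ℕ) :
    h.lS (k + 1) = h.lS k + mixLap D.W D.γ (h.lY k + h.le k) + h.lδ k := by
  funext i
  rw [Pi.add_apply, Pi.add_apply, h.mixLap_sent]
  simp only [liftL2]
  rw [← MemLp.toLp_add, ← MemLp.toLp_add]
  exact MemLp.toLp_congr _ _ (ae_of_all _ fun ω => (D.err_succ h.row_sum k i ω).2.1)

theorem lT_succ (h : D.IsValid P ν L μ σ C) (k : ℕ) :
    h.lT (k + 1) = (1 - D.α) • (h.lT k + D.η (k + 1) • h.lΔ k) + D.α • h.le k + h.lS k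
      + (2 : ℝ) • mixLap D.W D.γ (h.lY k + h.le k) + h.lδ k := by
  funext i
  have e1 : h.lΔ k i = (h.memLp_noisyGrad k i).toLp _ := rfl
  simp only [Pi.add_apply _ _ i, Pi.smul_apply _ _ i] at e1 ⊢
  rw [e1, h.mixLap_sent]
  simp only [liftL2]
  rw [← MemLp.toLp_const_smul, ← MemLp.toLp_const_smul, ← MemLp.toLp_add, ← MemLp.toLp_const_smul,
    ← MemLp.toLp_const_smul, ← MemLp.toLp_add, ← MemLp.toLp_add, ← MemLp.toLp_add,
    ← MemLp.toLp_add]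
  exact MemLp.toLp_congr _ _ (ae_of_all _ fun ω => (D.err_succ h.row_sum k i ω).2.2)

theorem sumSq_drift (h : D.IsValid P ν L μ σ C) (k : ℕ) :
    sumSq (h.lδ k)
      = (D.η (k + 2) - D.η (k + 1)) ^ 2 * ∑ i, ‖D.target i‖ ^ 2 := by
  rw [sumSq, Finset.mul_sum]
  refine Finset.sum_congr rfl fun i _ => ?_
  rw [lδ, liftL2, norm_toLp_const_sq, drift, norm_smul, mul_pow, Real.norm_eq_abs, sq_abs]

theorem sumSq_lS_zero (h : D.IsValid P ν L μ σ C) :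
    sumSq (h.lS 0) = D.η 1 ^ 2 * ∑ i, ‖D.target i‖ ^ 2 := by
  rw [sumSq, Finset.mul_sum]
  refine Finset.sum_congr rfl fun i _ => ?_
  have e1 : h.lS 0 i = (memLp_const (D.η 1 • D.target i) : MemLp (fun _ : Ω => _) 2 P).toLp _ := by
    refine MemLp.toLp_congr _ _ (ae_of_all _ fun ω => ?_)
    show (0 : Vec p) + D.η (0 + 1) • D.target i = D.η 1 • D.target i
    rw [zero_add, zero_add]
  rw [e1, norm_toLp_const_sq, norm_smul, mul_pow, Real.norm_eq_abs, sq_abs]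

theorem sumSq_lX_zero_le (h : D.IsValid P ν L μ σ C) :
    sumSq (h.lX 0) ≤ 4 * ((1 + D.η 0 ^ 2 * L ^ 2) * ∑ i, ‖D.xinit i - D.xs‖ ^ 2
      + D.η 0 ^ 2 * ∑ i, ‖D.target i‖ ^ 2 + D.η 0 ^ 2 * (n * σ ^ 2)) := by
  have key : ∀ i, ‖h.lX 0 i‖ ^ 2 ≤ 4 * ((1 + D.η 0 ^ 2 * L ^ 2) * ‖D.xinit i - D.xs‖ ^ 2
      + D.η 0 ^ 2 * ‖D.target i‖ ^ 2 + D.η 0 ^ 2 * σ ^ 2) := by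
    intro i
    have mN := h.oracle.square_integrable i 0
    have mc : ∀ c : Vec p, MemLp (fun _ : Ω => c) 2 P := fun c => memLp_const c
    -- The initial step splits into initial distance, gradient difference, gradient at the minimiser
    -- and noise.
    have e1 : h.lX 0 i = (mc (D.xinit i - D.xs)).toLp _
        + (mc (-(D.η 0 • (gradient (D.f i) (D.xinit i) - D.target i)))).toLp _
        + (mc (-(D.η 0 • D.target i))).toLp _ + (-(D.η 0)) • mN.toLp _ := by
      rw [← MemLp.toLp_add, ← MemLp.toLp_add, ← MemLp.toLp_const_smul, ← MemLp.toLp_add]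
      refine MemLp.toLp_congr _ _ (ae_of_all _ fun ω => ?_)
      have e2 : D.errX 0 i ω = D.xinit i - D.η 0 • D.g i (D.xinit i) (D.ξ i 0 ω) - D.xs := rfl
      have e3 : gradNoise D.f D.g D.ξ (queryPoint D.xinit D.sol) i 0 ω
        = D.g i (D.xinit i) (D.ξ i 0 ω) - gradient (D.f i) (D.xinit i) := rfl
      simp only [Pi.add_apply, Pi.smul_apply, e2, e3]
      module
    rw [e1]
    refine (norm_sq_sum_four_le _ _ _ _).trans ?_
    rw [norm_toLp_const_sq, norm_toLp_const_sq, norm_toLp_const_sq, norm_neg, norm_neg, norm_smul,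
      norm_smul, norm_smul, norm_neg]
    simp only [mul_pow, Real.norm_eq_abs, sq_abs]
    have h1 : ‖gradient (D.f i) (D.xinit i) - D.target i‖ ^ 2
        ≤ L ^ 2 * ‖D.xinit i - D.xs‖ ^ 2 := by
      rw [← mul_pow]
      exact pow_le_pow_left₀ (norm_nonneg _) (h.smooth.lipschitz i _ _) 2
    have h2 := norm_sq_le_of_condExp_le (h.history_le' _ _) mN (h.oracle.variance_le i 0)
    have h3 := mul_le_mul_of_nonneg_left h1 (sq_nonneg (D.η 0))
    have h4 := mul_le_mul_of_nonneg_left h2 (sq_nonneg (D.η 0))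
    linarith
  refine (Finset.sum_le_sum fun i _ => key i).trans (le_of_eq ?_)
  rw [← Finset.mul_sum, Finset.sum_add_distrib, Finset.sum_add_distrib, ← Finset.mul_sum,
    ← Finset.mul_sum, Finset.sum_const, Finset.card_univ, Fintype.card_fin, nsmul_eq_mul]
  ring

theorem sumSq_lT_zero_le (h : D.IsValid P ν L μ σ C) :
    sumSq (h.lT 0) ≤ 4 * (∑ i, ‖D.xinit i - D.xs‖ ^ 2 + sumSq (h.lX 0) + sumSq (h.lS 0)) := by
  simp only [sumSq]
  rw [← Finset.sum_add_distrib, ← Finset.sum_add_distrib, Finset.mul_sum]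
  refine Finset.sum_le_sum fun i _ => ?_
  have mc : MemLp (fun _ : Ω => D.xinit i - D.xs) 2 P := memLp_const _
  -- The reference point starts at the initial value itself; the zero only pads the sum to four
  -- terms.
  have e1 : h.lT 0 i = mc.toLp _ + (-1 : ℝ) • h.lX 0 i + h.lS 0 i + 0 := by
    simp only [liftL2]
    rw [add_zero, ← MemLp.toLp_const_smul, ← MemLp.toLp_add, ← MemLp.toLp_add]
    refine MemLp.toLp_congr _ _ (ae_of_all _ fun ω => ?_)
    have e2 : D.errT 0 i ω = D.xinit i - (D.state 0 ω).x i + D.errS 0 i ω := rfl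
    simp only [Pi.add_apply, Pi.smul_apply, e2, errX]
    module
  rw [e1]
  refine (norm_sq_sum_four_le _ _ _ _).trans ?_
  rw [norm_toLp_const_sq, norm_smul]
  simp

theorem expectedError_eq (h : D.IsValid P ν L μ σ C) (k : ℕ) :
    expectedError P D.sol D.xs k = ENNReal.ofReal (sumSq (h.lX k) / n) := by
  have hn : (0 : ℝ) < n := by exact_mod_cast h.n_pos
  have e1 : ∀ i, ∫⁻ ω, ‖D.sol i k ω - D.xs‖ₑ ^ 2 ∂P = ENNReal.ofReal (‖h.lX k i‖ ^ 2) :=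
    fun i => lintegral_enorm_sq_eq (h.memLp_errX k i)
  rw [expectedError]
  simp only [e1]
  rw [← ENNReal.ofReal_sum_of_nonneg fun i _ => by positivity, div_eq_inv_mul,
    ENNReal.ofReal_mul (by positivity), ENNReal.ofReal_inv_of_pos hn, ENNReal.ofReal_natCast]
  rfl

end IsValid

end Setup

end CEDAS

end

noncomputable section

namespace CEDAS

/-! ### The parameters -/

/-- A bound on `κ m`, where `κ = γ (1 - λ₂) / 2`. -/
def offsetConst (θ L μ : ℝ) : ℝ := 16 * θ + 4 * √2 * L / μ + 3 * θ * L * √6 / (2 * μ)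

/-- The relations between the parameters that the analysis uses, where `κ = γ (1 - λ₂) / 2`. -/
structure IsTuned (θ L μ cγ C α γ l κ m : ℝ) : Prop where
  κ_eq : κ = γ / 2 * (1 - l)
  κ_pos : 0 < κ
  κ_le : κ ≤ γ
  γ_le : γ ≤ 1 / 4
  α_pos : 0 < α
  α_le : α ≤ 1
  α_mul : α * C = 1 / 12
  quad_le : 648 * γ ^ 2 * C ≤ κ * α ^ 2
  weight_nonneg : 0 ≤ 12 * γ * C / α
  weight_le : 12 * γ * C / α ≤ 1
  le_offset : 16 * θ ≤ κ * m
  offset_le : κ * m ≤ offsetConst θ L μ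
  le_κ : cγ * ((1 - l) ^ 2 / (373248 * C ^ 3)) ≤ κ

/-- Given αC = 1/12, the third entry of the minimum is always the smallest, since it is at most
α/54. -/
theorem gammaBound_eq {α C l : ℝ} (hα : 0 < α) (hα1 : α ≤ 1) (hαC : α * C = 1 / 12) (hl : -1 ≤ l)
    (hl1 : l < 1) : gammaBound α C l = (1 - l) * α ^ 3 / 108 := by
  have hC : 0 < C := by
    by_contra! h
    nlinarith
  have e : (1 - l) * α ^ 2 / (1296 * C) = (1 - l) * α ^ 3 / 108 := by
    rw [div_eq_div_iff (by positivity) (by norm_num)]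
    linear_combination (-1296 * (1 - l) * α ^ 2) * hαC
  have hl' : 0 < 1 - l := by linarith
  have hα3 : α ^ 3 ≤ α := by
    calc α ^ 3 ≤ α ^ 1 := pow_le_pow_of_le_one hα.le hα1 (by norm_num)
      _ = α := pow_one α
  have ht : (1 - l) * α ^ 3 / 108 ≤ α / 54 := by
    have : (1 - l) * α ^ 3 ≤ 2 * α := by gcongr; linarith
    linarith
  rw [gammaBound, e, min_eq_left (a := (1 - l) * α ^ 3 / 108), min_eq_right]
  · refine le_min ?_ (by linarith)
    have hs : √α * √C ≤ 1 := by
      rw [← Real.sqrt_mul hα.le, hαC]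
      exact Real.sqrt_le_one.2 (by norm_num)
    have hsα : √α * √α = α := Real.mul_self_sqrt hα.le
    have h0 : 0 < √α := Real.sqrt_pos.2 hα
    have h1 : 0 < √C := Real.sqrt_pos.2 hC
    rw [le_div_iff₀ (by positivity)]
    have h2 : α / 54 * (2 * √C) ≤ √α := by
      calc α / 54 * (2 * √C) = √α / 27 * (√α * √C) := by
            linear_combination (-(√C / 27)) * hsα
        _ ≤ √α / 27 * 1 := by gcongr
        _ ≤ √α := by linarith
    refine le_trans ?_ h2
    gcongr
  · refine ht.trans ?_
    gcongr
    linarith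

theorem isTuned {θ L μ cγ C α γ l m : ℝ} (hθ : 0 < θ) (hL : 0 < L) (hμ : 0 < μ) (hcγ : 0 < cγ)
    (hl : -1 ≤ l) (hl1 : l < 1) (hC : 1 / 12 ≤ C) (hα : α = 1 / (12 * C))
    (hγ : γ ≤ gammaBound α C l) (hγ' : cγ * gammaBound α C l ≤ γ) (hm : m = offset θ L μ α γ l) :
    IsTuned θ L μ cγ C α γ l (γ / 2 * (1 - l)) m := by
  have hC0 : 0 < C := by linarith
  have hα0 : 0 < α := by rw [hα]; positivity
  have hα1 : α ≤ 1 := by rw [hα, div_le_one (by positivity)]; linarith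
  have hαC : α * C = 1 / 12 := by rw [hα]; field_simp
  have hl' : 0 < 1 - l := by linarith
  rw [gammaBound_eq hα0 hα1 hαC hl hl1] at hγ hγ'
  have hγ0 : 0 < γ := lt_of_lt_of_le (by positivity) hγ'
  have hα3 : α ^ 3 ≤ α ^ 2 := pow_le_pow_of_le_one hα0.le hα1 (by norm_num)
  have hα2 : α ^ 2 ≤ α := by
    calc α ^ 2 ≤ α ^ 1 := pow_le_pow_of_le_one hα0.le hα1 (by norm_num)
      _ = α := pow_one α
  have hγα : γ ≤ α ^ 2 / 54 := by
    have : (1 - l) * α ^ 3 ≤ 2 * α ^ 2 := by gcongr; linarith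
    linarith
  have hκγ : γ / 2 * (1 - l) ≤ γ := by nlinarith
  have hκ0 : 0 < γ / 2 * (1 - l) := by positivity
  have hα_inv : C = 1 / (12 * α) := by field_simp; linarith
  refine ⟨rfl, hκ0, hκγ, by linarith, hα0, hα1, hαC, ?_, by positivity, ?_, ?_, ?_, ?_⟩
  · have h1 : 648 * γ ^ 2 * C * (2 * α) = 108 * γ ^ 2 := by linear_combination 1296 * γ ^ 2 * hαC
    have h2 : 108 * γ ^ 2 ≤ γ * ((1 - l) * α ^ 3) := by nlinarith
    have h3 : (648 * γ ^ 2 * C) * (2 * α) ≤ (γ / 2 * (1 - l) * α ^ 2) * (2 * α) := by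
      rw [h1]; linarith
    exact le_of_mul_le_mul_right h3 (by positivity)
  · rw [div_le_one hα0, hα_inv]
    have : 12 * γ * (1 / (12 * α)) = γ / α := by field_simp
    rw [this, div_le_iff₀ hα0]
    nlinarith
  · have h1 : 32 * θ / (γ * (1 - l)) ≤ m := by
      rw [hm]; exact (le_max_left _ _).trans (le_max_left _ _)
    rw [div_le_iff₀ (by positivity)] at h1
    linarith
  · have ha : 0 ≤ 4 * √2 * L / μ := by positivity
    have hb : 0 ≤ 3 * θ * L * √6 / (2 * μ) := by positivity
    rw [hm, offset, ← le_div_iff₀' hκ0, offsetConst]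
    refine max_le (max_le ?_ ?_) (max_le ?_ ?_) <;> rw [le_div_iff₀ hκ0]
    · have : 32 * θ / (γ * (1 - l)) * (γ / 2 * (1 - l)) = 16 * θ := by field_simp; norm_num
      linarith
    · have : 8 * √2 * L / (μ * γ * (1 - l)) * (γ / 2 * (1 - l)) = 4 * √2 * L / μ := by
        field_simp; norm_num
      linarith
    · have hs0 : 0 < √α := Real.sqrt_pos.2 hα0
      have hsα : √α * √α = α := Real.mul_self_sqrt hα0.le
      have hs1 : √α ≤ 1 := Real.sqrt_le_one.2 hα1
      have h1 : γ / 2 * (1 - l) ≤ √α := by nlinarith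
      have : 3 * θ * L * √6 / (2 * √α * μ) * (γ / 2 * (1 - l))
          ≤ 3 * θ * L * √6 / (2 * √α * μ) * √α := by gcongr
      have h2 : 3 * θ * L * √6 / (2 * √α * μ) * √α = 3 * θ * L * √6 / (2 * μ) := by field_simp
      linarith
    · have : 8 * θ / α * (γ / 2 * (1 - l)) ≤ 8 * θ / α * α := by gcongr; linarith
      have h2 : 8 * θ / α * α = 8 * θ := by field_simp
      linarith
  · have h1 : (1 - l) ^ 2 / (373248 * C ^ 3) = (1 - l) * α ^ 3 / 108 / 2 * (1 - l) := by
      rw [hα]; field_simp; norm_num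
    rw [h1]
    calc cγ * ((1 - l) * α ^ 3 / 108 / 2 * (1 - l))
        = cγ * ((1 - l) * α ^ 3 / 108) / 2 * (1 - l) := by ring
      _ ≤ γ / 2 * (1 - l) := by gcongr

theorem stepsize_succ (θ μ m : ℝ) (k : ℕ) : stepsize θ μ m (k + 1) = θ / (μ * (m + k)) := by
  rw [stepsize]; push_cast; ring_nf

/-- Consecutive stepsizes differ by O(1/τ²), so the squared drift is O(1/τ⁴), small enough to
tolerate gradients at the minimiser of order n³. -/
theorem stepsize_sub_sq_le {θ μ m : ℝ} (hμ : 0 < μ) (hm : 0 < m) (k : ℕ) :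
    (stepsize θ μ m (k + 2) - stepsize θ μ m (k + 1)) ^ 2 ≤ θ ^ 2 / μ ^ 2 / (m + k) ^ 4 := by
  have hτ : 0 < m + k := by positivity
  have e : stepsize θ μ m (k + 2) - stepsize θ μ m (k + 1)
      = -(θ / (μ * ((m + k) * (m + k + 1)))) := by
    rw [stepsize_succ θ μ m (k + 1), stepsize_succ]
    push_cast
    field_simp
    ring
  rw [e, neg_sq, div_pow, div_div]
  have : μ ^ 2 * (m + k) ^ 4 ≤ (μ * ((m + k) * (m + k + 1))) ^ 2 := by
    have h : (m + k) ^ 2 ≤ (m + k) * (m + k + 1) := by nlinarith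
    calc μ ^ 2 * (m + k) ^ 4 = μ ^ 2 * ((m + k) ^ 2) ^ 2 := by ring
      _ ≤ μ ^ 2 * ((m + k) * (m + k + 1)) ^ 2 := by gcongr
      _ = _ := by ring
  gcongr

/-- The envelope after the transient time. -/
theorem envelope_le {n κ m ρ c H s M k : ℝ} (hn : 1 ≤ n) (hκ : 0 < κ) (hm : 0 < m) (hc : 0 ≤ c)
    (hM : κ * m ≤ M) (hH : m ≤ H * n ^ s) (hs : 4 + s ≤ ρ) (hρ : 1 ≤ ρ)
    (hk : (1 + M) * (n / κ) ≤ k) :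
    envelope n κ m ρ (c * n ^ 2) (m + k) ≤ (3 + c * H) / (n * k) := by
  have hn0 : 0 < n := by linarith
  have hM0 : 0 < M := (mul_pos hκ hm).trans_le hM
  have hnk : 0 < n / κ := by positivity
  have hk1 : n ≤ κ * k := by
    have : n / κ ≤ k := by nlinarith
    rwa [div_le_iff₀' hκ] at this
  -- Since κm ≤ M, the threshold also makes m/k ≤ 1/n, so every further power of m/k gains a factor
  -- 1/n.
  have hk2 : n * m ≤ k := by
    have h1 : m ≤ M / κ := by rw [le_div_iff₀ hκ]; linarith
    have h2 : n * m ≤ n * (M / κ) := by gcongr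
    have h3 : n * (M / κ) = M * (n / κ) := by ring
    nlinarith
  have hk0 : 0 < k := by nlinarith
  have hτ : k ≤ m + k := by linarith
  have t1 : 1 / n * (1 / (m + k)) ^ 1 ≤ 1 / (n * k) := by
    rw [pow_one, ← one_div_mul_one_div]; gcongr
  have hr : n / (κ * k) ≤ 1 := by rw [div_le_one (by positivity)]; exact hk1
  have t2 : 1 / κ * (1 / (m + k)) ^ 2 ≤ 1 / (n * k) := by
    calc 1 / κ * (1 / (m + k)) ^ 2 ≤ 1 / κ * (1 / k) ^ 2 := by gcongr
      _ = 1 / (n * k) * (n / (κ * k)) := by field_simp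
      _ ≤ 1 / (n * k) * 1 := by gcongr
      _ = _ := mul_one _
  have t3 : n ^ 2 / κ ^ 3 * (1 / (m + k)) ^ 4 ≤ 1 / (n * k) := by
    calc n ^ 2 / κ ^ 3 * (1 / (m + k)) ^ 4 ≤ n ^ 2 / κ ^ 3 * (1 / k) ^ 4 := by gcongr
      _ = 1 / (n * k) * (n / (κ * k)) ^ 3 := by field_simp
      _ ≤ 1 / (n * k) * 1 ^ 3 := by gcongr
      _ = _ := by ring
  have t4 : c * n ^ 2 * (m / (m + k)) ^ ρ ≤ c * H / (n * k) := by
    have h1 : (m / (m + k)) ^ ρ ≤ m / k * n ^ (1 - ρ) := by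
      have h2 : (m / (m + k)) ^ ρ ≤ (m / k) ^ ρ :=
        Real.rpow_le_rpow (by positivity) (by gcongr) (by linarith)
      have h3 : (m / k) ^ ρ = m / k * (m / k) ^ (ρ - 1) := by
        rw [Real.rpow_sub_one (by positivity)]; field_simp
      have h4 : (m / k) ^ (ρ - 1) ≤ (1 / n) ^ (ρ - 1) := by
        refine Real.rpow_le_rpow (by positivity) ?_ (by linarith)
        rw [div_le_div_iff₀ hk0 hn0]; linarith
      have h5 : (1 / n) ^ (ρ - 1) = n ^ (1 - ρ) := by
        rw [one_div, Real.inv_rpow hn0.le, ← Real.rpow_neg hn0.le, neg_sub]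
      rw [h3] at h2
      rw [h5] at h4
      exact h2.trans (by gcongr)
    -- One factor m/k is kept for the rate 1/k and costs n^s; n² is the initial error, one more `n`
    -- the target 1/(nk), and the remaining power ρ - 1 pays for all of them.
    have h6 : n ^ 3 * n ^ s * n ^ (1 - ρ) ≤ 1 := by
      rw [← Real.rpow_natCast n 3, ← Real.rpow_add hn0, ← Real.rpow_add hn0]
      exact Real.rpow_le_one_of_one_le_of_nonpos hn (by push_cast; linarith)
    have hH0 : 0 ≤ H := by
      by_contra! h
      have : H * n ^ s ≤ 0 := mul_nonpos_of_nonpos_of_nonneg h.le (by positivity)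
      linarith
    calc c * n ^ 2 * (m / (m + k)) ^ ρ ≤ c * n ^ 2 * (H * n ^ s / k * n ^ (1 - ρ)) := by
          refine mul_le_mul_of_nonneg_left (h1.trans ?_) (by positivity)
          gcongr
      _ = c * H / (n * k) * (n ^ 3 * n ^ s * n ^ (1 - ρ)) := by field_simp
      _ ≤ c * H / (n * k) * 1 := by gcongr
      _ = _ := mul_one _
  have e : (3 + c * H) / (n * k) = 1 / (n * k) + 1 / (n * k) + 1 / (n * k) + c * H / (n * k) := by
    ring
  rw [envelope, e]
  linarith

end CEDAS

end

/-! ### The coupled recursion for the averaged and the network error -/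

noncomputable section

namespace CEDAS

/-- A bound for the coefficients of the error recursion. -/
def recursionConst (θ L μ σ c₁ : ℝ) : ℝ :=
  θ ^ 2 / μ ^ 2 * (6 * L ^ 2 + 2 * σ ^ 2 + 6 * c₁) + 5 * θ * L ^ 2 / μ ^ 2

/-- A bound for the initial error of the local solutions. -/
def initialConst (L μ σ c₁ c₂ : ℝ) : ℝ :=
  4 * ((1 + L ^ 2 / μ ^ 2) * c₂ + c₁ / μ ^ 2 + σ ^ 2 / μ ^ 2)

/-- A bound for all initial errors. -/
def startConst (L μ σ c₁ c₂ : ℝ) : ℝ :=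
  6 * initialConst L μ σ c₁ c₂ + 5 * (c₁ / μ ^ 2) + 4 * c₂

theorem meanErr_arith {θ L μ σ c₁ η n τ R Q V : ℝ} (hθ : 0 ≤ θ) (hμ : 0 < μ) (hc₁ : 0 ≤ c₁)
    (hn : 0 < n) (hτ : 0 < τ) (hR : 0 ≤ R) (hV : 0 ≤ V) (hQ : Q ≤ V) (hη : η = θ / (μ * τ)) :
    (1 - 7 / 4 * (η * μ) + 2 * η ^ 2 * L ^ 2) * R + 5 * η / μ * L ^ 2 * Q + η ^ 2 * σ ^ 2 / n
      ≤ (1 - 7 / 4 * θ / τ + recursionConst θ L μ σ c₁ / τ ^ 2) * R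
        + recursionConst θ L μ σ c₁ / τ * V + recursionConst θ L μ σ c₁ / (n * τ ^ 2) := by
  have e1 : 7 / 4 * (η * μ) = 7 / 4 * θ / τ := by rw [hη]; field_simp
  have e2 : 2 * η ^ 2 * L ^ 2 = θ ^ 2 / μ ^ 2 * (2 * L ^ 2) / τ ^ 2 := by rw [hη]; field_simp
  have e3 : 5 * η / μ * L ^ 2 = 5 * θ * L ^ 2 / μ ^ 2 / τ := by rw [hη]; field_simp
  have e4 : η ^ 2 * σ ^ 2 / n = θ ^ 2 / μ ^ 2 * σ ^ 2 / (n * τ ^ 2) := by rw [hη]; field_simp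
  have p1 : 0 ≤ 5 * θ * L ^ 2 / μ ^ 2 := by positivity
  have a1 : θ ^ 2 / μ ^ 2 * (2 * L ^ 2) ≤ recursionConst θ L μ σ c₁ := by
    refine le_add_of_le_of_nonneg (mul_le_mul_of_nonneg_left ?_ (by positivity)) p1
    nlinarith [sq_nonneg L, sq_nonneg σ]
  have a2 : 5 * θ * L ^ 2 / μ ^ 2 ≤ recursionConst θ L μ σ c₁ :=
    le_add_of_nonneg_left (by positivity)
  have a3 : θ ^ 2 / μ ^ 2 * σ ^ 2 ≤ recursionConst θ L μ σ c₁ := by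
    refine le_add_of_le_of_nonneg (mul_le_mul_of_nonneg_left ?_ (by positivity)) p1
    nlinarith [sq_nonneg L, sq_nonneg σ]
  rw [e1, e2, e3, e4]
  have h3 : 5 * θ * L ^ 2 / μ ^ 2 / τ * Q ≤ 5 * θ * L ^ 2 / μ ^ 2 / τ * V := by gcongr
  refine add_le_add (add_le_add ?_ (h3.trans ?_)) ?_ <;> gcongr

theorem netErr_arith {θ L μ σ c₁ η κ n τ R V Gr N δ V' : ℝ} (hθ : 0 ≤ θ) (hμ : 0 < μ)
    (hc₁ : 0 ≤ c₁) (hκ : 0 < κ) (hτ : 0 < τ) (hR : 0 ≤ R) (hV : 0 ≤ V)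
    (hη : η = θ / (μ * τ)) (hGr : Gr ≤ L ^ 2 * (R + V)) (hN : N ≤ σ ^ 2)
    (hδ : δ ≤ θ ^ 2 / μ ^ 2 / τ ^ 4 * (c₁ * n ^ 2))
    (hV' : V' ≤ (1 - κ / 4) * V + 6 / κ * η ^ 2 * Gr + 2 * η ^ 2 * N + 6 / κ ^ 2 * δ) :
    V' ≤ (1 - κ / 4 + recursionConst θ L μ σ c₁ / (κ * τ ^ 2)) * V
        + recursionConst θ L μ σ c₁ / (κ * τ ^ 2) * R + recursionConst θ L μ σ c₁ / τ ^ 2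
        + recursionConst θ L μ σ c₁ * n ^ 2 / (κ ^ 2 * τ ^ 4) := by
  have p1 : 0 ≤ 5 * θ * L ^ 2 / μ ^ 2 := by positivity
  have a1 : θ ^ 2 / μ ^ 2 * (6 * L ^ 2) ≤ recursionConst θ L μ σ c₁ := by
    refine le_add_of_le_of_nonneg (mul_le_mul_of_nonneg_left ?_ (by positivity)) p1
    nlinarith [sq_nonneg L, sq_nonneg σ]
  have a2 : θ ^ 2 / μ ^ 2 * (2 * σ ^ 2) ≤ recursionConst θ L μ σ c₁ := by
    refine le_add_of_le_of_nonneg (mul_le_mul_of_nonneg_left ?_ (by positivity)) p1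
    nlinarith [sq_nonneg L, sq_nonneg σ]
  have a3 : θ ^ 2 / μ ^ 2 * (6 * c₁) ≤ recursionConst θ L μ σ c₁ := by
    refine le_add_of_le_of_nonneg (mul_le_mul_of_nonneg_left ?_ (by positivity)) p1
    nlinarith [sq_nonneg L, sq_nonneg σ]
  have h1 : 6 / κ * η ^ 2 * Gr ≤ recursionConst θ L μ σ c₁ / (κ * τ ^ 2) * (R + V) := by
    calc 6 / κ * η ^ 2 * Gr ≤ 6 / κ * η ^ 2 * (L ^ 2 * (R + V)) := by gcongr
      _ = θ ^ 2 / μ ^ 2 * (6 * L ^ 2) / (κ * τ ^ 2) * (R + V) := by rw [hη]; field_simp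
      _ ≤ _ := by gcongr
  have h2 : 2 * η ^ 2 * N ≤ recursionConst θ L μ σ c₁ / τ ^ 2 := by
    calc 2 * η ^ 2 * N ≤ 2 * η ^ 2 * σ ^ 2 := by gcongr
      _ = θ ^ 2 / μ ^ 2 * (2 * σ ^ 2) / τ ^ 2 := by rw [hη]; field_simp
      _ ≤ _ := by gcongr
  have h3 : 6 / κ ^ 2 * δ ≤ recursionConst θ L μ σ c₁ * n ^ 2 / (κ ^ 2 * τ ^ 4) := by
    calc 6 / κ ^ 2 * δ ≤ 6 / κ ^ 2 * (θ ^ 2 / μ ^ 2 / τ ^ 4 * (c₁ * n ^ 2)) := by gcongr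
      _ = θ ^ 2 / μ ^ 2 * (6 * c₁) * n ^ 2 / (κ ^ 2 * τ ^ 4) := by field_simp
      _ ≤ _ := by gcongr
  linarith

namespace Setup

variable {n p : ℕ} {Ω Ξ Z : Type*} {D : Setup n p Ω Ξ Z}

namespace IsValid

variable [mΩ : MeasurableSpace Ω] [mΞ : MeasurableSpace Ξ]
  [mZ : MeasurableSpace Z] {P : Measure Ω} [IsProbabilityMeasure P] {ν : Measure Z}
  [IsProbabilityMeasure ν] {L μ σ C : ℝ} {v : Fin n → Fin n → ℝ} {lam : Fin n → ℝ} {j₀ : Fin n}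
  {l θ cγ κ m c₁ c₂ : ℝ}

/-- The squared error of the averaged solution. -/
def meanErr (h : D.IsValid P ν L μ σ C) (k : ℕ) : ℝ := ‖mean (h.lX k)‖ ^ 2

/-- The averaged Lyapunov function. -/
def netErr (h : D.IsValid P ν L μ σ C) (v : Fin n → Fin n → ℝ) (lam : Fin n → ℝ) (j₀ : Fin n)
    (k : ℕ) : ℝ := lyapunov D.γ D.α C v lam j₀ (h.lX k) (h.lS k) (h.lT k) / n

theorem cast_n_pos (h : D.IsValid P ν L μ σ C) : (0 : ℝ) < n := by exact_mod_cast h.n_pos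

theorem meanErr_nonneg (h : D.IsValid P ν L μ σ C) (k : ℕ) : 0 ≤ h.meanErr k := sq_nonneg _

theorem consensus_le (h : D.IsValid P ν L μ σ C) (hB : IsModeBasis D.W v lam j₀ l)
    (ht : IsTuned θ L μ cγ C D.α D.γ l κ m) (hl : l < 1) (k : ℕ) :
    (∑ j ∈ Finset.univ.erase j₀, ‖modeCoord v j (h.lX k)‖ ^ 2) / n ≤ h.netErr v lam j₀ k := by
  have hγ0 : 0 < D.γ := ht.κ_pos.trans_le ht.κ_le
  have h1 := hB.consensus_le_energy hγ0 (ht.γ_le.trans (by norm_num)) hl (h.lX k) (h.lS k)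
  have h2 := mul_nonneg ht.weight_nonneg (sumSq_nonneg (h.lT k))
  rw [netErr, lyapunov]
  exact div_le_div_of_nonneg_right (by linarith) h.cast_n_pos.le

theorem netErr_nonneg (h : D.IsValid P ν L μ σ C) (hB : IsModeBasis D.W v lam j₀ l)
    (ht : IsTuned θ L μ cγ C D.α D.γ l κ m) (hl : l < 1) (k : ℕ) : 0 ≤ h.netErr v lam j₀ k :=
  le_trans (by positivity) (h.consensus_le hB ht hl k)

theorem sumSq_lX_le (h : D.IsValid P ν L μ σ C) (hB : IsModeBasis D.W v lam j₀ l)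
    (ht : IsTuned θ L μ cγ C D.α D.γ l κ m) (hl : l < 1) (k : ℕ) :
    sumSq (h.lX k) / n ≤ h.meanErr k + h.netErr v lam j₀ k := by
  have hn := h.cast_n_pos
  have h1 := h.consensus_le hB ht hl k
  rw [hB.sumSq_eq (h.lX k), add_div, mul_div_cancel_left₀ _ hn.ne']
  exact add_le_add le_rfl h1

theorem offset_pos (hθ : 18 < θ) {α γ : ℝ} (ht : IsTuned θ L μ cγ C α γ l κ m) : 288 ≤ m := by
  have h1 := ht.le_offset
  have h2 : κ ≤ 1 := (ht.κ_le.trans ht.γ_le).trans (by norm_num)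
  have h3 := ht.κ_pos
  have hm : 0 < m := pos_of_mul_pos_right (a := κ) (by linarith) h3.le
  nlinarith

theorem meanErr_succ_le (h : D.IsValid P ν L μ σ C) (hB : IsModeBasis D.W v lam j₀ l)
    (ht : IsTuned θ L μ cγ C D.α D.γ l κ m) (hl : l < 1) (hμ : 0 < μ) (hθ : 18 < θ)
    (hη : D.η = stepsize θ μ m) (hc₁ : 0 ≤ c₁) (k : ℕ) :
    h.meanErr (k + 1)
      ≤ (1 - 7 / 4 * θ / (m + k) + recursionConst θ L μ σ c₁ / (m + k) ^ 2) * h.meanErr k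
        + recursionConst θ L μ σ c₁ / (m + k) * h.netErr v lam j₀ k
        + recursionConst θ L μ σ c₁ / (n * (m + k) ^ 2) := by
  have hn := h.cast_n_pos
  have hm := offset_pos hθ ht
  have hτ : 0 < m + k := by positivity
  have hκ1 : κ ≤ 1 := (ht.κ_le.trans ht.γ_le).trans (by norm_num)
  have hmθ : θ ≤ m := by nlinarith [ht.le_offset, ht.κ_pos]
  have e : D.η (k + 1) = θ / (μ * (m + k)) := by rw [hη, stepsize_succ]
  have hη0 : 0 < D.η (k + 1) := by rw [e]; positivity
  have hημ' : D.η (k + 1) * μ = θ / (m + k) := by rw [e]; field_simp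
  have hημ : D.η (k + 1) * μ ≤ 1 := by
    rw [hημ', div_le_one hτ]
    have : (0 : ℝ) ≤ k := by positivity
    linarith
  rw [meanErr, h.lX_succ k]
  exact ((h.isErrorIteration k).mean_step hB hμ hη0 hημ h.n_pos D.γ (Y := h.lY k) rfl).trans
    (meanErr_arith (by linarith) hμ hc₁ hn hτ (h.meanErr_nonneg k) (h.netErr_nonneg hB ht hl k)
      (h.consensus_le hB ht hl k) e)

theorem netErr_succ_le (h : D.IsValid P ν L μ σ C) (hB : IsModeBasis D.W v lam j₀ l)
    (ht : IsTuned θ L μ cγ C D.α D.γ l κ m) (hl : l < 1) (hμ : 0 < μ) (hθ : 18 < θ)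
    (hη : D.η = stepsize θ μ m) (hc₁ : 0 ≤ c₁)
    (hT : ∑ i, ‖D.target i‖ ^ 2 ≤ c₁ * (n : ℝ) ^ 3) (k : ℕ) :
    h.netErr v lam j₀ (k + 1)
      ≤ (1 - κ / 4 + recursionConst θ L μ σ c₁ / (κ * (m + k) ^ 2)) * h.netErr v lam j₀ k
        + recursionConst θ L μ σ c₁ / (κ * (m + k) ^ 2) * h.meanErr k
        + recursionConst θ L μ σ c₁ / (m + k) ^ 2
        + recursionConst θ L μ σ c₁ * (n : ℝ) ^ 2 / (κ ^ 2 * (m + k) ^ 4) := by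
  have hn := h.cast_n_pos
  have hm := offset_pos hθ ht
  have hτ : 0 < m + k := by positivity
  have e : D.η (k + 1) = θ / (μ * (m + k)) := by rw [hη, stepsize_succ]
  have it := h.isErrorIteration k
  have hX := h.sumSq_lX_le hB ht hl k
  have hGr := it.sumSq_Gr_le
  have hN := it.sumSq_N_le
  have hs := it.lyapunov_step hB ht.κ_eq ht.κ_pos ht.κ_le ht.α_pos ht.α_le ht.α_mul ht.quad_le
    ht.γ_le hl (Y := h.lY k) rfl
  have hs' := div_le_div_of_nonneg_right hs hn.le
  refine netErr_arith (Gr := sumSq (liftL2 (D.gradDiff k) (h.memLp_gradDiff k)) / n)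
    (N := sumSq (liftL2 (D.noise k) (h.memLp_noise k)) / n) (δ := sumSq (h.lδ k) / n) (η := D.η (k + 1))
    (by linarith) hμ hc₁ ht.κ_pos hτ (h.meanErr_nonneg k) (h.netErr_nonneg hB ht hl k) e ?_ ?_ ?_ ?_
  · rw [div_le_iff₀ hn]
    rw [div_le_iff₀ hn] at hX
    calc _ ≤ L ^ 2 * sumSq (h.lX k) := hGr
      _ ≤ L ^ 2 * ((h.meanErr k + h.netErr v lam j₀ k) * n) := by gcongr
      _ = _ := by ring
  · rw [div_le_iff₀ hn, mul_comm]
    exact hN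
  · rw [h.sumSq_drift, hη, div_le_iff₀ hn]
    calc _ ≤ θ ^ 2 / μ ^ 2 / (m + k) ^ 4 * (c₁ * (n : ℝ) ^ 3) :=
          mul_le_mul (stepsize_sub_sq_le hμ (by linarith) k) hT (by positivity) (by positivity)
      _ = _ := by ring
  · rw [netErr, netErr, h.lX_succ k, h.lS_succ k, h.lT_succ k]
    refine hs'.trans (le_of_eq ?_)
    ring

theorem start_le (h : D.IsValid P ν L μ σ C) (hB : IsModeBasis D.W v lam j₀ l)
    (ht : IsTuned θ L μ cγ C D.α D.γ l κ m) (hl : l < 1) (hμ : 0 < μ) (hθ : 18 < θ)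
    (hη : D.η = stepsize θ μ m) (hc₁ : 0 ≤ c₁) (hc₂ : 0 ≤ c₂)
    (hT : ∑ i, ‖D.target i‖ ^ 2 ≤ c₁ * (n : ℝ) ^ 3)
    (hx : ∑ i, ‖D.xinit i - D.xs‖ ^ 2 ≤ c₂ * (n : ℝ) ^ 2) :
    h.meanErr 0 + h.netErr v lam j₀ 0 ≤ startConst L μ σ c₁ c₂ * (n : ℝ) ^ 2 := by
  have hn := h.cast_n_pos
  have hn1 : (1 : ℝ) ≤ n := by exact_mod_cast h.n_pos
  have hm := offset_pos hθ ht
  have hγ0 : 0 < D.γ := ht.κ_pos.trans_le ht.κ_le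
  have hκ := ht.κ_pos
  have hκ1 : κ ≤ 1 := (ht.κ_le.trans ht.γ_le).trans (by norm_num)
  have hmθ : 2 * θ ≤ m := by nlinarith [ht.le_offset]
  have h0 : D.η 0 ^ 2 ≤ 1 / μ ^ 2 := by
    have e : D.η 0 = θ / (m - 1) / μ := by rw [hη, stepsize]; push_cast; field_simp; ring
    have : θ / (m - 1) ≤ 1 := by rw [div_le_one (by linarith)]; linarith
    rw [e, div_pow]
    gcongr
    exact pow_le_one₀ (div_nonneg (by linarith) (by linarith)) this
  -- The energy weighs the initial correction error by up to 1/κ; the offset makes the first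
  -- stepsize small enough to compensate.
  have h1 : D.η 1 ^ 2 ≤ κ * (1 / μ ^ 2) := by
    have e : D.η 1 = θ / m / μ := by rw [hη, stepsize]; push_cast; field_simp; ring
    have h2 : θ / m ≤ κ := by rw [div_le_iff₀ (by linarith)]; linarith [ht.le_offset]
    have h3 : (θ / m) ^ 2 ≤ κ := by
      have : 0 ≤ θ / m := div_nonneg (by linarith) (by linarith)
      nlinarith
    rw [e, div_pow, mul_one_div]
    gcongr
  have hn2 : (n : ℝ) ^ 2 ≤ (n : ℝ) ^ 3 := pow_le_pow_right₀ hn1 (by norm_num)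
  have hn3 : (n : ℝ) ≤ (n : ℝ) ^ 3 := le_self_pow₀ hn1 (by norm_num)
  have hx3 : ∑ i, ‖D.xinit i - D.xs‖ ^ 2 ≤ c₂ * (n : ℝ) ^ 3 := hx.trans (by gcongr)
  have sX : sumSq (h.lX 0) ≤ initialConst L μ σ c₁ c₂ * (n : ℝ) ^ 3 := by
    refine h.sumSq_lX_zero_le.trans ?_
    calc _ ≤ 4 * ((1 + 1 / μ ^ 2 * L ^ 2) * (c₂ * (n : ℝ) ^ 3) + 1 / μ ^ 2 * (c₁ * (n : ℝ) ^ 3)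
          + 1 / μ ^ 2 * ((n : ℝ) ^ 3 * σ ^ 2)) := by gcongr
      _ = _ := by rw [initialConst]; ring
  have sS : sumSq (h.lS 0) ≤ κ * (c₁ / μ ^ 2 * (n : ℝ) ^ 3) := by
    rw [h.sumSq_lS_zero]
    calc _ ≤ κ * (1 / μ ^ 2) * (c₁ * (n : ℝ) ^ 3) := by gcongr
      _ = _ := by ring
  have sS' : 1 / κ * sumSq (h.lS 0) ≤ c₁ / μ ^ 2 * (n : ℝ) ^ 3 := by
    rw [one_div, inv_mul_le_iff₀ hκ]; exact sS
  have sS1 : sumSq (h.lS 0) ≤ c₁ / μ ^ 2 * (n : ℝ) ^ 3 :=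
    sS.trans (mul_le_of_le_one_left (by positivity) hκ1)
  have sT := h.sumSq_lT_zero_le
  have hE := hB.energy_le hγ0 hl (h.lX 0) (h.lS 0)
  rw [← ht.κ_eq] at hE
  have hM : h.meanErr 0 ≤ sumSq (h.lX 0) / n := norm_mean_sq_le _ h.n_pos
  have hW := mul_le_of_le_one_left (sumSq_nonneg (h.lT 0)) ht.weight_le
  calc h.meanErr 0 + h.netErr v lam j₀ 0
      ≤ sumSq (h.lX 0) / n + (sumSq (h.lX 0) + 1 / κ * sumSq (h.lS 0) + sumSq (h.lT 0)) / n := by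
        refine add_le_add hM (div_le_div_of_nonneg_right ?_ hn.le)
        rw [lyapunov]
        linarith
    _ = (sumSq (h.lX 0) + (sumSq (h.lX 0) + 1 / κ * sumSq (h.lS 0) + sumSq (h.lT 0))) / n := by
        ring
    _ ≤ startConst L μ σ c₁ c₂ * (n : ℝ) ^ 3 / n := by
        refine div_le_div_of_nonneg_right ?_ hn.le
        rw [startConst]
        linarith
    _ = _ := by field_simp

end IsValid

end Setup

/-- The squared error is bounded by the envelope, uniformly over all instances. -/
theorem exists_sumSq_le_envelope (L μ σ θ c₁ c₂ : ℝ) (hθ : 18 < θ) (hμ : 0 < μ) (hc₁ : 0 ≤ c₁)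
    (hc₂ : 0 ≤ c₂) : ∃ b : ℝ, 0 ≤ b ∧ ∀ {n p : ℕ} {Ω : Type*} {Ξ : Type*} {Z : Type*}
      [MeasurableSpace Ω] [MeasurableSpace Ξ] [MeasurableSpace Z] {P : Measure Ω}
      [IsProbabilityMeasure P] {ν : Measure Z} [IsProbabilityMeasure ν] {D : Setup n p Ω Ξ Z}
      {C cγ κ m l : ℝ} {v : Fin n → Fin n → ℝ} {lam : Fin n → ℝ} {j₀ : Fin n}
      (h : D.IsValid P ν L μ σ C), IsModeBasis D.W v lam j₀ l →
      IsTuned θ L μ cγ C D.α D.γ l κ m → l < 1 → D.η = stepsize θ μ m →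
      ∑ i, ‖D.target i‖ ^ 2 ≤ c₁ * (n : ℝ) ^ 3 →
      ∑ i, ‖D.xinit i - D.xs‖ ^ 2 ≤ c₂ * (n : ℝ) ^ 2 → ∀ k : ℕ,
      sumSq (h.lX k) / n
        ≤ b * envelope n κ m (3 / 2 * θ) (startConst L μ σ c₁ c₂ * (n : ℝ) ^ 2) (m + k) := by
  obtain ⟨b, hb, H⟩ := coupled_recursion θ (recursionConst θ L μ σ c₁) hθ (by
    have : 0 ≤ θ := by linarith
    rw [recursionConst]
    positivity)
  refine ⟨b, hb, ?_⟩
  intro n p Ω Ξ Z _ _ _ P _ ν _ D C cγ κ m l v lam j₀ h hB ht hl hη hT hx k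
  exact (h.sumSq_lX_le hB ht hl k).trans <| H n κ m _ h.meanErr (h.netErr v lam j₀) h.cast_n_pos
    ht.κ_pos ((ht.κ_le.trans ht.γ_le).trans (by norm_num)) ht.le_offset h.meanErr_nonneg
    (h.netErr_nonneg hB ht hl) (h.start_le hB ht hl hμ hθ hη hc₁ hc₂ hT hx)
    (h.meanErr_succ_le hB ht hl hμ hθ hη hc₁) (h.netErr_succ_le hB ht hl hμ hθ hη hc₁ hT) k

end CEDAS

end

/-! ### From the envelope to the transient time -/

namespace CEDAS

theorem transientTime_le {n : ℕ} {B T : ℝ} {err : ℕ → ℝ≥0∞} (hT : 1 ≤ T)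
    (h : ∀ k : ℕ, T ≤ k → err k ≤ ENNReal.ofReal (B / (n * k))) :
    ((transientTime n B err : ℕ∞) : ℝ≥0∞) ≤ ENNReal.ofReal (2 * T) := by
  have h1 : transientTime n B err ≤ (⌈T⌉₊ : ℕ∞) :=
    iInf₂_le ⌈T⌉₊ ⟨Nat.one_le_ceil_iff.2 (by linarith), fun k hk => h k (Nat.ceil_le.1 hk)⟩
  have h2 : ((⌈T⌉₊ : ℕ) : ℝ) ≤ 2 * T := by
    -- Rounding the real threshold up to an integer costs at most a factor 2, because T ≥ 1.
    have := Nat.ceil_lt_add_one (show 0 ≤ T by linarith)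
    linarith
  calc ((transientTime n B err : ℕ∞) : ℝ≥0∞) ≤ (((⌈T⌉₊ : ℕ) : ℕ∞) : ℝ≥0∞) :=
        ENat.toENNReal_mono h1
    _ = ENNReal.ofReal ((⌈T⌉₊ : ℕ) : ℝ) := by simp
    _ ≤ _ := ENNReal.ofReal_le_ofReal h2

/-- The offset `m` is at most of polynomial order in `n`. -/
theorem IsTuned.offset_le_rpow {θ L μ cγ C α γ l κ m n c₃ c₄ q r : ℝ}
    (ht : IsTuned θ L μ cγ C α γ l κ m) (hcγ : 0 < cγ) (hl : l < 1) (hC : 0 < C) (hn : 0 < n)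
    (hM : 0 ≤ offsetConst θ L μ) (h3 : 1 / (1 - l) ≤ c₃ * n ^ q) (h4 : C ≤ c₄ * n ^ r) :
    m ≤ offsetConst θ L μ * (373248 / cγ) * |c₄| ^ 3 * c₃ ^ 2 * n ^ (3 * r + 2 * q) := by
  have hl' : 0 < 1 - l := by linarith
  have hκ := ht.κ_pos
  have h5 : 1 / κ ≤ 373248 / cγ * (C ^ 3 * (1 / (1 - l)) ^ 2) := by
    calc 1 / κ ≤ 1 / (cγ * ((1 - l) ^ 2 / (373248 * C ^ 3))) :=
          one_div_le_one_div_of_le (by positivity) ht.le_κ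
      _ = _ := by field_simp
  have h4' : C ≤ |c₄| * n ^ r := h4.trans (by gcongr; exact le_abs_self _)
  have e : (n ^ r) ^ 3 * (n ^ q) ^ 2 = n ^ (3 * r + 2 * q) := by
    rw [← Real.rpow_natCast, ← Real.rpow_natCast, ← Real.rpow_mul hn.le, ← Real.rpow_mul hn.le,
      ← Real.rpow_add hn]
    congr 1
    push_cast
    ring
  calc m ≤ offsetConst θ L μ * (1 / κ) := by
        rw [mul_one_div, le_div_iff₀ hκ, mul_comm]; exact ht.offset_le
    _ ≤ offsetConst θ L μ * (373248 / cγ * (C ^ 3 * (1 / (1 - l)) ^ 2)) := by gcongr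
    _ ≤ offsetConst θ L μ * (373248 / cγ * ((|c₄| * n ^ r) ^ 3 * (c₃ * n ^ q) ^ 2)) := by gcongr
    _ = offsetConst θ L μ * (373248 / cγ) * |c₄| ^ 3 * c₃ ^ 2 * ((n ^ r) ^ 3 * (n ^ q) ^ 2) := by
        ring
    _ = _ := by rw [e]

end CEDAS

open CEDAS

theorem corollary1
    -- constants that do not depend on the instance
    (L μ σ θ q r c₁ c₂ c₃ c₄ cγ : ℝ) (hL : 0 < L) (hμ : 0 < μ) (hσ : 0 < σ)
    (hq : 0 < q) (hr : 0 ≤ r) (hθ : 18 < θ) (hθqr : 3 / 2 * (1 + q + 2 * r) ≤ θ)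
    (hcγ : 0 < cγ) (hcγ' : cγ ≤ 1) :
    ∃ A B : ℝ, 0 < A ∧ 0 < B ∧
      ∀ (n p : ℕ) (hn : 2 ≤ n)
        -- network
        (G : SimpleGraph (Fin n)) (W : Matrix (Fin n) (Fin n) ℝ)
        (hW : CEDAS.IsMixingMatrix G W)
        -- objective functions and their solution
        (f : Fin n → CEDAS.Vec p → ℝ) (_ : CEDAS.IsSmoothStronglyConvex L μ f)
        (xstar : CEDAS.Vec p) (_ : IsMinOn (CEDAS.avgObjective f) Set.univ xstar)
        -- parameters
        (C α γ m : ℝ) (_ : 1 / 12 ≤ C) (_ : α = 1 / (12 * C))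
        (_ : γ ≤ CEDAS.gammaBound α C (CEDAS.lambda2 hW.isHermitian hn))
        (_ : cγ * CEDAS.gammaBound α C (CEDAS.lambda2 hW.isHermitian hn) ≤ γ)
        (_ : m = CEDAS.offset θ L μ α γ (CEDAS.lambda2 hW.isHermitian hn))
        -- probability space, stochastic gradients and compressor
        (Ω Ξ Z : Type*) [MeasurableSpace Ω] [MeasurableSpace Ξ] [MeasurableSpace Z]
        (P : Measure Ω) [IsProbabilityMeasure P] (ν : Measure Z) [IsProbabilityMeasure ν]
        (g : Fin n → CEDAS.Vec p → Ξ → CEDAS.Vec p)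
        (Q : CEDAS.Vec p → Z → CEDAS.Vec p)
        (ξ : Fin n → ℕ → Ω → Ξ) (z : Fin n → ℕ → Ω → Z)
        -- initial values and iterates
        (xinit : Fin n → CEDAS.Vec p) (x : Fin n → ℕ → Ω → CEDAS.Vec p)
        (_ : x = CEDAS.iterate W γ α (CEDAS.stepsize θ μ m) g Q xinit xinit ξ z)
        (_ : CEDAS.IsGradientOracle P σ f g ξ z (CEDAS.queryPoint xinit x))
        (_ : CEDAS.IsUnbiasedCompressor C Q ν)
        (_ : CEDAS.IsFreshCompressorSample P ν ξ z)
        -- orders of magnitude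
        (_ : ∑ i, ‖gradient (f i) xstar‖ ^ 2 ≤ c₁ * (n : ℝ) ^ 3)
        (_ : ∑ i, ‖xinit i - xstar‖ ^ 2 ≤ c₂ * (n : ℝ) ^ 2)
        (_ : 1 / (1 - CEDAS.lambda2 hW.isHermitian hn) ≤ c₃ * (n : ℝ) ^ q)
        (_ : C ≤ c₄ * (n : ℝ) ^ r),
        ((CEDAS.transientTime n B (CEDAS.expectedError P x xstar) : ℕ∞) : ℝ≥0∞) ≤
          ENNReal.ofReal
            (A * (n * C ^ 3 / (1 - CEDAS.lambda2 hW.isHermitian hn) ^ 2)) := by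
  have hM : 0 < offsetConst θ L μ := by
    have : 0 < θ := by linarith
    rw [offsetConst]
    positivity
  set M := offsetConst θ L μ with hM_def
  -- The constants `c₁`, `c₂`, `c₄` have no prescribed sign; absolute values keep the witnesses
  -- positive before any instance is given.
  set H := M * (373248 / cγ) * |c₄| ^ 3 * c₃ ^ 2 with hH_def
  set c := startConst L μ σ |c₁| |c₂| with hc_def
  have hc : 0 ≤ c := by
    rw [hc_def, startConst, initialConst]
    positivity
  obtain ⟨b, hb, hbound⟩ := exists_sumSq_le_envelope L μ σ θ |c₁| |c₂| hθ hμ (abs_nonneg _)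
    (abs_nonneg _)
  -- The first witness combines rounding, the threshold (1 + M) n/κ and the bound on 1/κ; the added
  -- 1 in the second keeps it positive even if `b` is 0.
  refine ⟨2 * ((1 + M) * (373248 / cγ)), b * (3 + c * H) + 1, by positivity, by positivity, ?_⟩
  intro n p hn G W hW f hf xstar hxstar C α γ m hC hα hγ hγ' hm Ω Ξ Z _ _ _ P _ ν _ g Q ξ z xinit
    x hx horacle hcomp hfresh hsum₁ hsum₂ h3 h4
  subst hx
  obtain ⟨hl1, hl, v, lam, j₀, hB⟩ := hW.lambda2_lt_one_and_exists_modeBasis hn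
  set l := lambda2 hW.isHermitian hn
  have hC0 : 0 < C := by linarith
  have hn1 : (1 : ℝ) ≤ n := by exact_mod_cast (by omega : 1 ≤ n)
  have hn0 : (0 : ℝ) < n := by linarith
  have ht := isTuned (by linarith) hL hμ hcγ hl hl1 hC hα hγ hγ' hm
  set κ := γ / 2 * (1 - l)
  let D : Setup n p Ω Ξ Z := ⟨W, γ, α, stepsize θ μ m, f, g, Q, ξ, z, xinit, xstar⟩
  have hD : D.IsValid P ν L μ σ C :=
    { n_pos := by omega
      row_sum := hW.row_sum
      col_sum := fun j => (Finset.sum_congr rfl fun i _ => hW.symm.apply j i).trans (hW.row_sum j)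
      smooth := hf
      isMin := hxstar
      oracle := horacle
      comp := hcomp
      fresh := hfresh
      C_nonneg := hC0.le }
  have hκ := ht.κ_pos
  have hκ1 : κ ≤ 1 := (ht.κ_le.trans ht.γ_le).trans (by norm_num)
  have hnκ : 1 ≤ (n : ℝ) / κ := by rw [le_div_iff₀ hκ]; linarith
  have hmain : ∀ k : ℕ, (1 + M) * (n / κ) ≤ k → expectedError P D.sol D.xs k
      ≤ ENNReal.ofReal ((b * (3 + c * H) + 1) / (n * k)) := by
    intro k hk
    have hk0 : (0 : ℝ) < k := lt_of_lt_of_le (by positivity) hk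
    rw [hD.expectedError_eq]
    refine ENNReal.ofReal_le_ofReal ?_
    have h5 := hbound hD hB ht hl1 rfl
      (hsum₁.trans (mul_le_mul_of_nonneg_right (le_abs_self c₁) (by positivity)))
      (hsum₂.trans (mul_le_mul_of_nonneg_right (le_abs_self c₂) (by positivity))) k
    have hm0 : 0 < m := pos_of_mul_pos_right (a := κ) (by linarith [ht.le_offset]) hκ.le
    have h6 : envelope n κ m (3 / 2 * θ) (c * (n : ℝ) ^ 2) (m + k) ≤ (3 + c * H) / (n * k) :=
      envelope_le hn1 hκ hm0 hc ht.offset_le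
        -- The exponent condition is 4 + 3r + 2q ≤ 3θ/2. Of 3θ/2, the part 4θ/3 is at least 2 + 2q +
        -- 4r, and the rest θ/6 exceeds 3 since θ > 18.
        (ht.offset_le_rpow hcγ hl1 hC0 hn0 hM.le h3 h4) (by linarith) (by linarith) hk
    calc _ ≤ _ := h5
      _ ≤ b * ((3 + c * H) / (n * k)) := by gcongr
      _ = b * (3 + c * H) / (n * k) := by ring
      _ ≤ _ := by gcongr; linarith
  refine (transientTime_le (by nlinarith) hmain).trans (ENNReal.ofReal_le_ofReal ?_)
  have hl' : 0 < 1 - l := by linarith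
  have h7 : (n : ℝ) / κ ≤ n / (cγ * ((1 - l) ^ 2 / (373248 * C ^ 3))) := by
    gcongr
    exact ht.le_κ
  have h8 : (n : ℝ) / (cγ * ((1 - l) ^ 2 / (373248 * C ^ 3)))
      = 373248 / cγ * (n * C ^ 3 / (1 - l) ^ 2) := by field_simp
  rw [h8] at h7
  calc 2 * ((1 + M) * (n / κ)) ≤ 2 * ((1 + M) * (373248 / cγ * (n * C ^ 3 / (1 - l) ^ 2))) := by
        gcongr
    _ = _ := by ring
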